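/- Let $f(u,\bar u,v,\bar v)=\sum_{\nu,\mu}c_{\nu,\mu}\,u^{\nu_1}v^{\nu_2}\bar u^{\mu_1}\bar v^{\mu_2}$ be a mixed polynomial in two complex variables with $c_{0,0}=0$. Its Newton polygon $\Gamma_+(f)$ is the convex hull of $\bigcup_{c_{\nu,\mu}\ne 0}\big(\nu+\mu+(\mathbb{R}_{\ge 0})^2\big)$ and its Newton boundary $\Gamma(f)$ is the union of the compact faces of $\Gamma_+(f)$. For a face $\Delta$ of $\Gamma(f)$ let $f_\Delta$ be the sum of the terms of $f$ with $\nu+\mu\in\Delta$. For a mixed polynomial $h$ let $V(h)$ be its zero set and $\Sigma(h)$ the set of points where $h:\mathbb{R}^4\to\mathbb{R}^2$ is not a submersion. Assume that $f$ is convenient ($\Gamma(f)$ meets both coordinate axes), non-degenerate ($\Sigma(f_\Delta)\cap V(f_\Delta)\cap(\mathbb{C}^*)^2=\emptyset$ for every face $\Delta$ of $\Gamma(f)$) and $\Gamma$-nice ($V(f_\Delta)\cap(\mathbb{C}^*)^2=\emptyset$ for every non-extreme vertex $\Delta$ of $\Gamma(f)$). Let $\Delta_0,\dots,\Delta_N$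 be the vertices of $\Gamma(f)$ from left to right, so that $\Delta_0$ lies on the vertical axis, and let $\Delta^1_i$ be the 1-face bounded by $\Delta_{i-1}$ and $\Delta_i$, $1\le i\le N$. For $h:\mathbb{C}\to\mathbb{C}$, the multiplicity with sign $\mathrm{m}_\mathrm{s}(h,\alpha)$ is the mapping degree of $h/|h|$ on all sufficiently small circles about $\alpha$. Put $f^t_{\Delta_i}(u)=f_{\Delta_i}(u,\bar u,\mathrm{e}^{\mathrm{i}t},\mathrm{e}^{-\mathrm{i}t})$ and $f^\varphi_{\Delta_i}(v)=f_{\Delta_i}(\mathrm{e}^{\mathrm{i}\varphi},\mathrm{e}^{-\mathrm{i}\varphi},v,\bar v)$. Let $L_i$ be the set of zeros with $u\ne 0$ of $g_i:\mathbb{C}\times S^1\to\mathbb{C}$, $g_i(u,\mathrm{e}^{\mathrm{i}t})=f_{\Delta^1_i}(u,\bar u,\mathrm{e}^{\mathrm{i}t},\mathrm{e}^{-\mathrm{i}t})$, oriented by $\arg g_i$, that is, so that $g_i$ maps positive bases of the planes transverse to $L_i$ to positive bases of $\mathbb{C}$. Fix $0=\varepsilon_0<\varepsilon_1<\dots<\varepsilon_N=1$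 and regard $L_i$ as an oriented link in $\{(u,v)\in S^3:\varepsilon_{i-1}<|u|<\varepsilon_i\}$, by an identification of this shell with $\mathbb{C}^*\times S^1$ that preserves the orientation and the arguments of $u$ and $v$: the point $(u,\mathrm{e}^{\mathrm{i}t})$ corresponds to $\big(\rho\,\tfrac{u}{|u|},\sqrt{1-\rho^2}\,\mathrm{e}^{\mathrm{i}t}\big)$ with $\rho=\tfrac{\varepsilon_{i-1}+\varepsilon_i|u|}{1+|u|}$. Let $V_i=\{(u,v)\in S^3:|u|\le\varepsilon_i,\ v\ne 0\}$ and $W_i=\{(u,v)\in S^3:|u|\ge\varepsilon_i,\ u\ne 0\}$ be the solid tori about $\{u=0\}$ and $\{v=0\}$. For an oriented link $L$ in $V_i$ let $w(L)$ be its winding number in $V_i$, i.e. its algebraic intersection number with any transverse meridional disk $\{\arg v=t\}\cap V_i$ (oriented by $u$); for $L$ in $W_i$ let $w'(L)$ be its winding number in $W_i$, i.e. its algebraic intersection number with any transverse meridional disk $\{\arg u=\varphi\}\cap W_i$ (oriented by $v$). Then all multiplicities and winding numbers below are well defined (transverse disks of these forms exist, and their intersections with the links are finite), and for every $i\in\{1,\dots,N\}$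 and all $t,\varphi\in\mathbb{R}$: (1) the winding number of $L_i$ in $V_i$ is $w(L_i)=\mathrm{m}_\mathrm{s}(f^t_{\Delta_i},0)-\mathrm{m}_\mathrm{s}(f^t_{\Delta_{i-1}},0)$; (2) the winding number of $L_i$ in $W_{i-1}$ is $w'(L_i)=\mathrm{m}_\mathrm{s}(f^\varphi_{\Delta_{i-1}},0)-\mathrm{m}_\mathrm{s}(f^\varphi_{\Delta_i},0)$; (3) the winding number of $L_1\cup\dots\cup L_i$ in $V_i$ is $w(L_1\cup\dots\cup L_i)=\mathrm{m}_\mathrm{s}(f^t_{\Delta_i},0)$; (4) the winding number of $L_i\cup\dots\cup L_N$ in $W_{i-1}$ is $w'(L_i\cup\dots\cup L_N)=\mathrm{m}_\mathrm{s}(f^\varphi_{\Delta_{i-1}},0)$. -/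

import Mathlib

noncomputable section

namespace MixedLink

/-! ### Mixed polynomials in two complex variables -/

/-- Mixed polynomials `f(u, ū, v, v̄)`: formal polynomials in four variables, which stand, in this
order, for `u, ū, v, v̄`. -/
abbrev MixedPolynomial : Type := MvPolynomial (Fin 4) ℂ

/-- The function `(u, v) ↦ f(u, ū, v, v̄)`. -/
def evalAt (f : MixedPolynomial) (z : ℂ × ℂ) : ℂ :=
  MvPolynomial.eval ![z.1, star z.1, z.2, star z.2] f

/-- For the monomial `u^ν₁ ū^μ₁ v^ν₂ v̄^μ₂` this is `ν + μ = (ν₁ + μ₁, ν₂ + μ₂)`. -/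
def bidegree (m : Fin 4 →₀ ℕ) : ℕ × ℕ := (m 0 + m 1, m 2 + m 3)

/-- A lattice point as a point of the real plane. -/
def toPlane (p : ℕ × ℕ) : ℝ × ℝ := ((p.1 : ℝ), (p.2 : ℝ))

/-- `supp f = {ν + μ | c_{ν,μ} ≠ 0}`. -/
def supp (f : MixedPolynomial) : Finset (ℕ × ℕ) := f.support.image bidegree

/-- The zero set `V(f)`. -/
def zeroSet (f : MixedPolynomial) : Set (ℂ × ℂ) := {z | evalAt f z = 0}

/-- The singular set `Σ(f)`: the points where `f`, as a real map `ℝ⁴ → ℝ²`, is not a submersion. -/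
def singularSet (f : MixedPolynomial) : Set (ℂ × ℂ) :=
  {z | ¬ Function.Surjective (fderiv ℝ (evalAt f) z)}

/-- `(ℂ \ {0})²`. -/
def torus : Set (ℂ × ℂ) := {z | z.1 ≠ 0 ∧ z.2 ≠ 0}

/-! ### The Newton polygon -/

/-- The Newton polygon `Γ₊(f)`: the convex hull of the union of the `ω + (ℝ_{≥0})²`,
`ω ∈ supp f`. -/
def newtonPolygon (f : MixedPolynomial) : Set (ℝ × ℝ) :=
  convexHull ℝ {x | ∃ ω ∈ supp f, (toPlane ω).1 ≤ x.1 ∧ (toPlane ω).2 ≤ x.2}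

/-- The compact (non-empty) faces of the Newton polygon. -/
def IsCompactFace (f : MixedPolynomial) (Δ : Set (ℝ × ℝ)) : Prop :=
  Δ.Nonempty ∧ IsExposed ℝ (newtonPolygon f) Δ ∧ IsCompact Δ

/-- The Newton boundary `Γ(f)`, the union of the compact faces. -/
def newtonBoundary (f : MixedPolynomial) : Set (ℝ × ℝ) :=
  ⋃₀ {Δ | IsCompactFace f Δ}

/-- The face function `f_Δ`, the sum of the terms of `f` with `ν + μ ∈ Δ`. -/
def faceFunction (f : MixedPolynomial) (Δ : Set (ℝ × ℝ)) : MixedPolynomial :=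
  open Classical in
  ∑ m ∈ f.support.filter (fun m => toPlane (bidegree m) ∈ Δ),
    MvPolynomial.monomial m (f.coeff m)

/-- `f` is convenient: the Newton boundary meets both coordinate axes. -/
def IsConvenient (f : MixedPolynomial) : Prop :=
  (∃ x ∈ newtonBoundary f, x.1 = 0) ∧ (∃ x ∈ newtonBoundary f, x.2 = 0)

/-- `f` is Newton non-degenerate. -/
def IsNonDegenerate (f : MixedPolynomial) : Prop :=
  ∀ Δ, IsCompactFace f Δ →
    singularSet (faceFunction f Δ) ∩ zeroSet (faceFunction f Δ) ∩ torus = ∅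

/-- The vertices (0-faces) of the Newton boundary, listed from left to right (distinct vertices
have distinct first coordinates). Every vertex is a point of the support. -/
def vertexList (f : MixedPolynomial) : List (ℕ ×ₗ ℕ) :=
  open Classical in
  (((supp f).filter (fun p => IsCompactFace f {toPlane p})).image (fun p => toLex p)).sort

/-- The number `N` of 1-faces of the Newton boundary, one less than the number of vertices. -/
def numEdges (f : MixedPolynomial) : ℕ := (vertexList f).length - 1

/-- The vertex `Δ_i` of the Newton boundary, `0 ≤ i ≤ N`, counted from left to right. -/
def vertex (f : MixedPolynomial) (i : ℕ) : ℕ × ℕ :=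
  ofLex ((vertexList f).getD i (toLex (0, 0)))

/-- The 1-face `Δ¹_i` of the Newton boundary, `1 ≤ i ≤ N`: the edge bounded by the consecutive
vertices `Δ_{i-1}` and `Δ_i`. -/
def edge (f : MixedPolynomial) (i : ℕ) : Set (ℝ × ℝ) :=
  segment ℝ (toPlane (vertex f (i - 1))) (toPlane (vertex f i))

/-- The face function `f_{Δ_i}` of a vertex. -/
def vertexFunction (f : MixedPolynomial) (i : ℕ) : MixedPolynomial :=
  faceFunction f {toPlane (vertex f i)}

/-- `f` is `Γ`-nice: `f_Δ` has no zero in `(ℂ \ {0})²` for each non-extreme vertex `Δ`. -/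
def IsGammaNice (f : MixedPolynomial) : Prop :=
  ∀ i, 0 < i → i < numEdges f → zeroSet (vertexFunction f i) ∩ torus = ∅

/-! ### Multiplicities with sign -/

/-- `h` has no zero on the circle of radius `r` about `α`, and the mapping degree of `h / |h|` from
this circle to the unit circle is `n`: a continuous choice of the argument of `h` grows by `2πn`
along the circle. -/
def HasCircleDegree (h : ℂ → ℂ) (α : ℂ) (r : ℝ) (n : ℤ) : Prop :=
  (∀ x : ℝ, h (circleMap α r x) ≠ 0) ∧
  ∃ θ : ℝ → ℝ, Continuous θ ∧
    (∀ x : ℝ, h (circleMap α r x) / (‖h (circleMap α r x)‖ : ℂ) =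
      Complex.exp ((θ x : ℂ) * Complex.I)) ∧
    θ (2 * Real.pi) - θ 0 = 2 * Real.pi * (n : ℝ)

/-- The multiplicity with sign of `h` at `α` exists and is `n`: the degree of `h / |h|` on all
sufficiently small circles about `α` is `n`. -/
def HasSignedMultiplicity (h : ℂ → ℂ) (α : ℂ) (n : ℤ) : Prop :=
  ∀ᶠ r in nhdsWithin (0 : ℝ) (Set.Ioi 0), HasCircleDegree h α r n

/-- The multiplicity with sign `m_s(h, α)`; it is `0` by convention if it does not exist. -/
def signedMultiplicity (h : ℂ → ℂ) (α : ℂ) : ℤ :=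
  open Classical in
  if H : ∃ n, HasSignedMultiplicity h α n then H.choose else 0

/-- `f^t_{Δ_i}(u) = f_{Δ_i}(u, ū, e^{it}, e^{-it})`. -/
def vertexPolyU (f : MixedPolynomial) (i : ℕ) (t : ℝ) (u : ℂ) : ℂ :=
  evalAt (vertexFunction f i) (u, Complex.exp ((t : ℂ) * Complex.I))

/-- `f^φ_{Δ_i}(v) = f_{Δ_i}(e^{iφ}, e^{-iφ}, v, v̄)`. -/
def vertexPolyV (f : MixedPolynomial) (i : ℕ) (φ : ℝ) (v : ℂ) : ℂ :=
  evalAt (vertexFunction f i) (Complex.exp ((φ : ℂ) * Complex.I), v)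

/-! ### Orientations -/

/-- The determinant of two vectors of `ℂ = ℝ²`. -/
def det2 (a b : ℂ) : ℝ := Matrix.det !![a.re, a.im; b.re, b.im]

/-- The determinant of three vectors of `ℂ × ℝ = ℝ³`. -/
def det3 (a b c : ℂ × ℝ) : ℝ :=
  Matrix.det !![a.1.re, a.1.im, a.2; b.1.re, b.1.im, b.2; c.1.re, c.1.im, c.2]

/-- The determinant of four vectors of `ℂ² = ℝ⁴`. -/
def det4 (a b c d : ℂ × ℂ) : ℝ :=
  Matrix.det !![a.1.re, a.1.im, a.2.re, a.2.im; b.1.re, b.1.im, b.2.re, b.2.im;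
    c.1.re, c.1.im, c.2.re, c.2.im; d.1.re, d.1.im, d.2.re, d.2.im]

/-- `σ` is a positive tangent vector at `q` of the zero set of `G : ℂ × ℝ → ℂ`, when the zero set
is oriented by `arg G` (each small loop with linking number `1` about the zero set is a loop along
which `arg G` increases by `2π`): `σ` is a non-zero vector of the kernel of the derivative, and if
`(n₁, n₂, σ)` is a positive basis of `ℂ × ℝ`, then the images of `n₁, n₂` under the derivative are a
positive basis of `ℂ`. -/
def IsPositiveTangent (G : ℂ × ℝ → ℂ) (q σ : ℂ × ℝ) : Prop :=
  σ ≠ 0 ∧ fderiv ℝ G q σ = 0 ∧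
    ∀ n₁ n₂ : ℂ × ℝ, 0 < det3 n₁ n₂ σ → 0 < det2 (fderiv ℝ G q n₁) (fderiv ℝ G q n₂)

/-! ### The links `L_i` in the 3-sphere -/

/-- The unit sphere `S³` of `ℂ²`. -/
def sphere3 : Set (ℂ × ℂ) := {z | ‖z.1‖ ^ 2 + ‖z.2‖ ^ 2 = 1}

/-- An oriented link in `S³`: a set of points, and for each point the set of the positive tangent
vectors there. -/
structure OrientedLink where
  carrier : Set (ℂ × ℂ)
  positive : ℂ × ℂ → Set (ℂ × ℂ)

/-- The union of a family of oriented links. -/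
def OrientedLink.union {ι : Type} (s : Set ι) (L : ι → OrientedLink) : OrientedLink where
  carrier := ⋃ j ∈ s, (L j).carrier
  positive := fun p => ⋃ j ∈ s, (L j).positive p

/-- The map `g_i : ℂ × S¹ → ℂ`, `g_i(u, e^{it}) = f_{Δ¹_i}(u, ū, e^{it}, e^{-it})`, in the
coordinates `(u, t)`. -/
def edgeMap (f : MixedPolynomial) (i : ℕ) (q : ℂ × ℝ) : ℂ :=
  evalAt (faceFunction f (edge f i)) (q.1, Complex.exp ((q.2 : ℂ) * Complex.I))

/-- An increasing diffeomorphism from `(0, ∞)` to `(a, b)`. -/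
def shellRadius (a b R : ℝ) : ℝ := (a + b * R) / (1 + R)

/-- The identification of `(ℂ \ {0}) × S¹` with the open shell `{(u, v) ∈ S³ | a < |u| < b}`, in the
coordinates `(u, t)` of the former. It preserves the orientation and the arguments of both complex
coordinates. -/
def shellMap (a b : ℝ) (q : ℂ × ℝ) : ℂ × ℂ :=
  (((shellRadius a b ‖q.1‖ / ‖q.1‖ : ℝ) : ℂ) * q.1,
    ((Real.sqrt (1 - shellRadius a b ‖q.1‖ ^ 2) : ℝ) : ℂ) * Complex.exp ((q.2 : ℂ) * Complex.I))

/-- The link `L_i = {(u, e^{it}) | g_i(u, e^{it}) = 0, u ≠ 0}` of the `i`-th 1-face, with the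
orientation given by `arg g_i`, as a link in the shell `{(u, v) ∈ S³ | ε_{i-1} < |u| < ε_i}`. -/
def edgeLink (f : MixedPolynomial) (ε : ℕ → ℝ) (i : ℕ) : OrientedLink where
  carrier := shellMap (ε (i - 1)) (ε i) '' {q | q.1 ≠ 0 ∧ edgeMap f i q = 0}
  positive := fun p => {τ | ∃ q σ : ℂ × ℝ, q.1 ≠ 0 ∧ edgeMap f i q = 0 ∧
    IsPositiveTangent (edgeMap f i) q σ ∧
    p = shellMap (ε (i - 1)) (ε i) q ∧ τ = fderiv ℝ (shellMap (ε (i - 1)) (ε i)) q σ}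

/-- The radii `0 = ε_0 < ε_1 < ⋯ < ε_{N-1} < ε_N = 1` that separate the shells. -/
def IsShellRadii (N : ℕ) (ε : ℕ → ℝ) : Prop :=
  ε 0 = 0 ∧ ε N = 1 ∧ ∀ i < N, ε i < ε (i + 1)

/-! ### Winding numbers in solid tori -/

/-- The solid torus `V_i = {(u, v) ∈ S³ | |u| ≤ ε_i}` about the core `u = 0`, for `i < N`. For
`ε_i = 1` it is the open solid torus `S³ \ {v = 0}`. -/
def solidTorusV (r : ℝ) : Set (ℂ × ℂ) := {z ∈ sphere3 | ‖z.1‖ ≤ r ∧ z.2 ≠ 0}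

/-- The solid torus `W_i = S³ \ int V_i = {(u, v) ∈ S³ | |u| ≥ ε_i}` about the core `v = 0`, for
`i > 0`. For `ε_i = 0` it is the open solid torus `S³ \ {u = 0}`. -/
def solidTorusW (r : ℝ) : Set (ℂ × ℂ) := {z ∈ sphere3 | r ≤ ‖z.1‖ ∧ z.1 ≠ 0}

/-- The disks `arg v = t`, parametrized (with their orientations) by `u`. They intersect the solid
tori about `u = 0` in meridional disks. -/
def diskU (t : ℝ) (u : ℂ) : ℂ × ℂ :=
  (u, ((Real.sqrt (1 - ‖u‖ ^ 2) : ℝ) : ℂ) * Complex.exp ((t : ℂ) * Complex.I))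

/-- The disks `arg u = φ`, parametrized (with their orientations) by `v`. They intersect the solid
tori about `v = 0` in meridional disks. -/
def diskV (φ : ℝ) (v : ℂ) : ℂ × ℂ :=
  (((Real.sqrt (1 - ‖v‖ ^ 2) : ℝ) : ℂ) * Complex.exp ((φ : ℂ) * Complex.I), v)

/-- The orientation of the frame of `T S³` at `D(z)` that consists of the oriented basis of the disk
`D` and of `τ`; `S³` is the oriented boundary of the ball (outward normal first). -/
def frameDet (D : ℂ → ℂ × ℂ) (z : ℂ) (τ : ℂ × ℂ) : ℝ :=
  det4 (D z) (fderiv ℝ D z 1) (fderiv ℝ D z Complex.I) τ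

/-- The intersection points of a link with the disk `D` inside `V`, as points of the parameter
plane. -/
def intersectionPoints (V : Set (ℂ × ℂ)) (D : ℂ → ℂ × ℂ) (L : OrientedLink) : Set ℂ :=
  {z | D z ∈ V ∧ D z ∈ L.carrier}

/-- The oriented link `L` is transverse to the disk `D` inside `V`. -/
def IsTransverse (V : Set (ℂ × ℂ)) (D : ℂ → ℂ × ℂ) (L : OrientedLink) : Prop :=
  ∀ z ∈ intersectionPoints V D L,
    (L.positive (D z)).Nonempty ∧ ∀ τ ∈ L.positive (D z), frameDet D z τ ≠ 0

/-- The algebraic intersection number of a disk and a link that is transverse to it: the number of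
positive intersection points minus the number of negative intersection points. -/
def algebraicIntersection (V : Set (ℂ × ℂ)) (D : ℂ → ℂ × ℂ) (L : OrientedLink) : ℤ :=
  ({z ∈ intersectionPoints V D L | ∃ τ ∈ L.positive (D z), 0 < frameDet D z τ}.ncard : ℤ) -
    ({z ∈ intersectionPoints V D L | ∃ τ ∈ L.positive (D z), frameDet D z τ < 0}.ncard : ℤ)

/-- The winding number of `L` in the solid torus `V` is `w`, where `D s`, `s ∈ ℝ`, are the
meridional disks of `V`: some of the disks are transverse to `L`, and each disk that is transverse
to `L` meets it in a finite set, with algebraic intersection number `w`. -/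
def HasWindingNumber (V : Set (ℂ × ℂ)) (D : ℝ → ℂ → ℂ × ℂ) (L : OrientedLink) (w : ℤ) : Prop :=
  (∃ s, IsTransverse V (D s) L) ∧
  ∀ s, IsTransverse V (D s) L →
    (intersectionPoints V (D s) L).Finite ∧ algebraicIntersection V (D s) L = w

/-- The winding number `w(L) = w` in the solid torus `V_i`, where `r = ε_i`. -/
def HasWindingNumberV (r : ℝ) (L : OrientedLink) (w : ℤ) : Prop :=
  HasWindingNumber (solidTorusV r) diskU L w

/-- The winding number `w'(L) = w` in the solid torus `W_i`, where `r = ε_i`. -/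
def HasWindingNumberW (r : ℝ) (L : OrientedLink) (w : ℤ) : Prop :=
  HasWindingNumber (solidTorusW r) diskV L w

end MixedLink

end

noncomputable section
namespace MixedLink

open Complex Filter Topology

/-! ### Degrees of loops in the punctured plane -/

/-! Cut `L_i` with the disk `arg v = t`. Up to a radial change of `|u|`, the intersection is the
zero set in an annulus of `h(u) = g_i(u, e^{it})`. Since `L_i` is oriented by `arg g_i` and the
identification of the shell preserves the orientation, the sign of a transverse intersection point
is the sign of the Jacobian of `h` there. For a function with only non-degenerate zeros in an
annulus, the signed number of zeros is the degree of `h/|h|` on the outer circle minus that on the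
inner one.

These two degrees come from the vertices. As `u → 0` the terms of lowest degree in `u` dominate
`g_i`, and they form the function of `Δ_{i-1}`; as `u → ∞` the function of `Δ_i` dominates. Neither
has a zero on the torus, so the two degrees are the multiplicities with sign, which gives (1). On
the disk `arg u = φ`, parametrized by `v`, a growing `|v|` means a shrinking `|u|`; the two ends
change roles, and (2) has the opposite order. For unions of links the differences telescope. What is
left at the extreme vertex is `0`, because `f_{Δ_0}` does not involve `u` and `f_{Δ_N}` does not
involve `v`; this gives (3) and (4).

The count of zeros is `degree_sub_degree_eq_sum` and `signed_count_zeros`, which divide out one zero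
after the other. The asymptotics are `edge_degree_small` and `edge_degree_large`; they rest on
`evalAt_vertexFunction_ne_zero`, where the Γ-nice condition serves the inner vertices and
non-degeneracy the two extreme ones. The comparison of signs is `exists_det4_fderiv_shellMap` and
`sign_frameDet`. Transverse disks exist by a one-dimensional Sard theorem, `ae_regular_value`,
applied to the arguments of `u` and `v` on the link. It needs `L_i` to be a regular curve; this is
`surjective_fderiv_edgeMap`, which combines non-degeneracy on the edge with the weighted Euler
relation. That the segment between consecutive vertices is a face, so that non-degeneracy applies to
it, is `isCompactFace_segment`. -/

/-- The `2π`-periodic path `γ` has no zero, and a continuous choice of its argument grows by `2πn`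
over a period. -/
def HasLoopDegree (γ : ℝ → ℂ) (n : ℤ) : Prop :=
  ∃ θ : ℝ → ℝ, Continuous θ ∧
    (∀ x : ℝ, γ x / (‖γ x‖ : ℂ) = Complex.exp ((θ x : ℂ) * Complex.I)) ∧
    θ (2 * Real.pi) - θ 0 = 2 * Real.pi * (n : ℝ)

/-- At a zero of `γ` the quotient `γ x / ‖γ x‖` is `0 / 0 = 0` by convention, whereas the
exponential never vanishes. So the lifting condition alone already contains non-vanishing. -/
theorem HasLoopDegree.ne_zero {γ : ℝ → ℂ} {n : ℤ} (h : HasLoopDegree γ n) (x : ℝ) : γ x ≠ 0 := by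
  obtain ⟨θ, -, h, -⟩ := h
  intro h0
  have := h x
  rw [h0, zero_div] at this
  exact Complex.exp_ne_zero _ this.symm

theorem hasCircleDegree_iff {h : ℂ → ℂ} {α : ℂ} {r : ℝ} {n : ℤ} :
    HasCircleDegree h α r n ↔ HasLoopDegree (fun x => h (circleMap α r x)) n :=
  ⟨fun H => H.2, fun H => ⟨H.ne_zero, H⟩⟩

/-- The difference of two arguments, divided by `2π`, is a continuous integer-valued function on
`ℝ`, hence constant. -/
theorem HasLoopDegree.unique {γ : ℝ → ℂ} {m n : ℤ} (hm : HasLoopDegree γ m)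
    (hn : HasLoopDegree γ n) : m = n := by
  obtain ⟨θ, hθ, h1, h2⟩ := hm
  obtain ⟨η, hη, h3, h4⟩ := hn
  have hk : ∀ x, ∃ k : ℤ, (θ x - η x) / (2 * Real.pi) = k := by
    intro x
    have := (h1 x).symm.trans (h3 x)
    rw [Complex.exp_eq_exp_iff_exists_int] at this
    obtain ⟨k, hk⟩ := this
    refine ⟨k, ?_⟩
    have h5 : ((θ x : ℂ) - η x) = k * (2 * Real.pi) := by
      have : ((θ x : ℂ) - η x) * I = k * (2 * Real.pi) * I := by linear_combination hk
      exact mul_right_cancel₀ Complex.I_ne_zero this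
    have h6 : θ x - η x = k * (2 * Real.pi) := by exact_mod_cast h5
    rw [h6]
    field_simp
  choose k hk using hk
  have hkc : Continuous k := by
    have : Continuous (fun x => (k x : ℝ)) := by
      simp_rw [← hk]
      fun_prop
    exact Int.isClosedEmbedding_coe_real.isEmbedding.continuous_iff.2 this
  have h7 : k (2 * Real.pi) = k 0 :=
    PreconnectedSpace.constant inferInstance hkc
  have h8 := hk (2 * Real.pi)
  rw [h7, ← hk 0, div_left_inj' (by positivity)] at h8
  have h9 : 2 * Real.pi * (m : ℝ) = 2 * Real.pi * n := by rw [← h2, ← h4]; linarith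
  exact_mod_cast mul_left_cancel₀ (by positivity) h9

theorem HasLoopDegree.mul {γ δ : ℝ → ℂ} {m n : ℤ} (hm : HasLoopDegree γ m)
    (hn : HasLoopDegree δ n) : HasLoopDegree (fun x => γ x * δ x) (m + n) := by
  obtain ⟨θ, hθ, h1, h2⟩ := hm
  obtain ⟨η, hη, h3, h4⟩ := hn
  refine ⟨fun x => θ x + η x, hθ.add hη, fun x => ?_, ?_⟩
  · push_cast
    rw [add_mul, Complex.exp_add, ← h1, ← h3, norm_mul, Complex.ofReal_mul, mul_div_mul_comm]
  · push_cast
    linarith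

theorem HasLoopDegree.inv {γ : ℝ → ℂ} {n : ℤ} (hn : HasLoopDegree γ n) :
    HasLoopDegree (fun x => (γ x)⁻¹) (-n) := by
  obtain ⟨θ, hθ, h1, h2⟩ := hn
  refine ⟨fun x => - θ x, hθ.neg, fun x => ?_, ?_⟩
  · push_cast
    rw [neg_mul, Complex.exp_neg, ← h1, norm_inv, Complex.ofReal_inv, inv_div_inv, inv_div]
  · push_cast
    linarith

theorem HasLoopDegree.conj {γ : ℝ → ℂ} {n : ℤ} (hn : HasLoopDegree γ n) :
    HasLoopDegree (fun x => star (γ x)) (-n) := by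
  obtain ⟨θ, hθ, h1, h2⟩ := hn
  refine ⟨fun x => - θ x, hθ.neg, fun x => ?_, ?_⟩
  · have := congrArg star (h1 x)
    rw [norm_star]
    simpa [← Complex.exp_conj] using this
  · push_cast
    linarith

theorem HasLoopDegree.div {γ δ : ℝ → ℂ} {m n : ℤ} (hm : HasLoopDegree γ m)
    (hn : HasLoopDegree δ n) : HasLoopDegree (fun x => γ x / δ x) (m - n) := by
  simpa only [div_eq_mul_inv, sub_eq_add_neg] using hm.mul hn.inv

/-- A periodic loop in the slit plane has degree `0`. -/
theorem hasLoopDegree_zero_of_slitPlane {γ : ℝ → ℂ} (hc : Continuous γ)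
    (hp : γ (2 * Real.pi) = γ 0) (hs : ∀ x, γ x ∈ Complex.slitPlane) : HasLoopDegree γ 0 := by
  refine ⟨fun x => Complex.arg (γ x), ?_, fun x => ?_, ?_⟩
  · exact continuous_iff_continuousAt.2 fun x =>
      (Complex.continuousAt_arg (hs x)).comp hc.continuousAt
  · have h0 : (‖γ x‖ : ℂ) ≠ 0 := by
      simpa using Complex.slitPlane_ne_zero (hs x)
    rw [div_eq_iff h0, mul_comm, Complex.norm_mul_exp_arg_mul_I]
  · simp [hp]

theorem hasLoopDegree_const {c : ℂ} (hc : c ≠ 0) : HasLoopDegree (fun _ => c) 0 := by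
  refine ⟨fun _ => Complex.arg c, continuous_const, fun x => ?_, by simp⟩
  have h0 : (‖c‖ : ℂ) ≠ 0 := by simpa using hc
  rw [div_eq_iff h0, mul_comm, Complex.norm_mul_exp_arg_mul_I]

theorem HasLoopDegree.real_smul {γ : ℝ → ℂ} {n : ℤ} (hn : HasLoopDegree γ n) {c : ℝ}
    (hc : 0 < c) : HasLoopDegree (fun x => (c : ℂ) * γ x) n := by
  simpa using (hasLoopDegree_const (c := (c : ℂ)) (by exact_mod_cast hc.ne')).mul hn

/-- Two loops closer to each other than to the origin have the same degree. -/
theorem HasLoopDegree.of_norm_sub_lt {γ δ : ℝ → ℂ} {n : ℤ} (hn : HasLoopDegree γ n)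
    (hγ : Continuous γ) (hδ : Continuous δ) (hγp : γ (2 * Real.pi) = γ 0)
    (hδp : δ (2 * Real.pi) = δ 0) (h : ∀ x, ‖δ x - γ x‖ < ‖γ x‖) : HasLoopDegree δ n := by
  have hne := hn.ne_zero
  have h1 : HasLoopDegree (fun x => δ x / γ x) 0 := by
    refine hasLoopDegree_zero_of_slitPlane (hδ.div hγ hne) (by simp [hγp, hδp]) fun x => ?_
    -- The quotient `δ/γ` stays in the unit disk about `1`, where the principal argument is
    -- continuous, so it has degree `0`.
    have h2 : ‖δ x / γ x - 1‖ < 1 := by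
      rw [div_sub_one (hne x), norm_div, div_lt_one (norm_pos_iff.2 (hne x))]
      exact h x
    left
    have := (abs_lt.1 ((Complex.abs_re_le_norm _).trans_lt h2)).1
    simp only [sub_re, one_re] at this
    linarith
  have h2 := h1.mul hn
  rw [zero_add] at h2
  simpa [hne] using h2

/-- Lift the path through the covering `exp : ℂ → ℂ \ {0}`; the imaginary part of the lift is an
argument, and periodicity makes its increment a multiple of `2π`. -/
theorem exists_hasLoopDegree {γ : ℝ → ℂ} (hc : Continuous γ) (hp : γ (2 * Real.pi) = γ 0)
    (h0 : ∀ x, γ x ≠ 0) : ∃ n, HasLoopDegree γ n := by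
  obtain ⟨F, ⟨-, hF⟩, -⟩ := isCoveringMap_exp.existsUnique_continuousMap_lifts
    (⟨fun x => ⟨γ x, h0 x⟩, hc.subtype_mk _⟩ : C(ℝ, {z : ℂ // z ≠ 0})) 0 (Complex.log (γ 0))
    (Subtype.ext (Complex.exp_log (h0 0)))
  have hF' : ∀ x, Complex.exp (F x) = γ x := fun x => congrArg Subtype.val (congrFun hF x)
  have h1 := (hF' (2 * Real.pi)).trans (hp.trans (hF' 0).symm)
  rw [Complex.exp_eq_exp_iff_exists_int] at h1
  obtain ⟨n, hn⟩ := h1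
  refine ⟨n, fun x => (F x).im, Complex.continuous_im.comp F.continuous, fun x => ?_, ?_⟩
  · rw [← hF' x, Complex.norm_exp, Complex.ofReal_exp, ← Complex.exp_sub]
    congr 1
    rw [sub_eq_iff_eq_add', Complex.re_add_im]
  · simp only [hn]
    simp
    ring

/-- The degree of a continuous family of loops is constant. -/
theorem HasLoopDegree.of_homotopy {X : Type*} [TopologicalSpace X] [PreconnectedSpace X]
    {H : X → ℝ → ℂ} (hc : Continuous fun p : X × ℝ => H p.1 p.2)
    (hp : ∀ s, Function.Periodic (H s) (2 * Real.pi)) (h0 : ∀ s x, H s x ≠ 0) {a b : X} {n : ℤ}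
    (ha : HasLoopDegree (H a) n) : HasLoopDegree (H b) n := by
  have hcs : ∀ s, Continuous (H s) := fun s => hc.comp (by fun_prop : Continuous fun x => (s, x))
  have hps : ∀ s, H s (2 * Real.pi) = H s 0 := fun s => by simpa using hp s 0
  choose d hd using fun s => exists_hasLoopDegree (hcs s) (hps s) (h0 s)
  have hloc : IsLocallyConstant d := by
    refine (IsLocallyConstant.iff_eventually_eq d).2 fun s => ?_
    -- Closeness of the loops is uniform on one period by compactness, and periodicity then extends
    -- it to all of `ℝ`.
    have h1 : ∀ᶠ s' in 𝓝 s, ∀ x ∈ Set.Icc 0 (2 * Real.pi), ‖H s' x - H s x‖ < ‖H s x‖ := by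
      refine isCompact_Icc.eventually_forall_of_forall_eventually fun x _ => ?_
      have hf : Continuous fun p : X × ℝ => ‖H s p.2‖ - ‖H p.1 p.2 - H s p.2‖ := by
        have := hcs s
        fun_prop
      have h2 : ∀ᶠ p in 𝓝 (s, x), 0 < ‖H s p.2‖ - ‖H p.1 p.2 - H s p.2‖ :=
        hf.continuousAt.eventually (lt_mem_nhds (by simpa using h0 s x))
      filter_upwards [h2] with p hp
      linarith
    filter_upwards [h1] with s' hs'
    refine (hd s').unique ((hd s).of_norm_sub_lt (hcs s) (hcs s') (hps s) (hps s') fun x => ?_)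
    obtain ⟨y, hy, hxy⟩ := (show Function.Periodic (fun x => (H s' x, H s x)) (2 * Real.pi) from
      fun x => by simp only [hp s x, hp s' x]).exists_mem_Ico₀ Real.two_pi_pos x
    simp only [Prod.mk.injEq] at hxy
    rw [hxy.1, hxy.2]
    exact hs' y ⟨hy.1, hy.2.le⟩
  have := hloc.apply_eq_of_preconnectedSpace a b
  have h2 := ha.unique (hd a)
  rw [h2, this]
  exact hd b

/-- The degrees on the boundary circles of an annulus without zeros are the same. -/
theorem HasCircleDegree.of_annulus {h : ℂ → ℂ} {a b r R : ℝ} (ha : 0 ≤ a) (hr : r ∈ Set.Icc a b)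
    (hR : R ∈ Set.Icc a b) (hc : ∀ z, a ≤ ‖z‖ → ‖z‖ ≤ b → ContinuousAt h z)
    (h0 : ∀ z, a ≤ ‖z‖ → ‖z‖ ≤ b → h z ≠ 0) {n : ℤ} (hn : HasCircleDegree h 0 r n) :
    HasCircleDegree h 0 R n := by
  rw [hasCircleDegree_iff] at hn ⊢
  have hz : ∀ (s : Set.Icc a b) (x : ℝ), ‖circleMap 0 s x‖ = s := fun s x => by
    simpa using ha.trans s.2.1
  have : PreconnectedSpace (Set.Icc a b) := Subtype.preconnectedSpace isPreconnected_Icc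
  refine HasLoopDegree.of_homotopy (X := Set.Icc a b)
    (H := fun s x => h (circleMap 0 s x)) ?_ (fun s => (periodic_circleMap 0 s).comp h) (fun s x => ?_)
    (a := ⟨r, hr⟩) (b := ⟨R, hR⟩) hn
  · refine continuous_iff_continuousAt.2 fun p => ?_
    refine ContinuousAt.comp (f := fun p : Set.Icc a b × ℝ => circleMap 0 p.1 p.2)
      (hc _ (by rw [hz]; exact p.1.2.1) (by rw [hz]; exact p.1.2.2)) ?_
    unfold circleMap
    fun_prop
  · exact h0 _ (by rw [hz]; exact s.2.1) (by rw [hz]; exact s.2.2)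

theorem hasLoopDegree_exp : HasLoopDegree (fun x => Complex.exp (x * Complex.I)) 1 :=
  ⟨fun x => x, continuous_id, fun x => by simp [Complex.norm_exp_ofReal_mul_I], by simp⟩

/-- On the circle, `z - z₀` differs from `z` by less than `|z|`. -/
theorem hasCircleDegree_sub_inside {z₀ : ℂ} {R : ℝ} (h : ‖z₀‖ < R) :
    HasCircleDegree (fun z => z - z₀) 0 R 1 := by
  have hR : 0 < R := (norm_nonneg _).trans_lt h
  rw [hasCircleDegree_iff]
  have h1 : HasLoopDegree (circleMap 0 R) 1 := by
    have := hasLoopDegree_exp.real_smul hR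
    convert this using 2
    simp [circleMap]
  refine h1.of_norm_sub_lt (continuous_circleMap _ _) (by fun_prop) ?_ ?_ fun x => ?_
  · simpa using periodic_circleMap 0 R 0
  · simpa using periodic_circleMap 0 R 0
  · simpa [abs_of_pos hR] using h

/-- On the circle, `z - z₀` differs from the constant `-z₀` by less than `|z₀|`. -/
theorem hasCircleDegree_sub_outside {z₀ : ℂ} {r : ℝ} (hr : 0 ≤ r) (h : r < ‖z₀‖) :
    HasCircleDegree (fun z => z - z₀) 0 r 0 := by
  rw [hasCircleDegree_iff]
  have h1 : HasLoopDegree (fun _ => - z₀) 0 := hasLoopDegree_const (by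
    intro h0
    rw [neg_eq_zero.1 h0, norm_zero] at h
    linarith)
  refine h1.of_norm_sub_lt continuous_const (by fun_prop) rfl ?_ fun x => ?_
  · simpa using periodic_circleMap 0 r 0
  · simpa [abs_of_nonneg hr] using h

/-! ### Counting non-degenerate zeros in an annulus -/

/-- The identity of `ℂ` or the complex conjugation. -/
def orient (b : Bool) (y : ℂ) : ℂ := if b then y else star y

/-- The degree of `orient b`. -/
def orientSign (b : Bool) : ℤ := if b then 1 else -1

@[simp] theorem norm_orient (b : Bool) (y : ℂ) : ‖orient b y‖ = ‖y‖ := by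
  cases b <;> simp [orient]

theorem continuous_orient (b : Bool) : Continuous (orient b) := by
  cases b
  · exact continuous_star
  · exact continuous_id

theorem orient_eq_zero {b : Bool} {y : ℂ} : orient b y = 0 ↔ y = 0 := by
  rw [← norm_eq_zero, norm_orient, norm_eq_zero]

theorem hasCircleDegree_orient_inside {z₀ : ℂ} {R : ℝ} (h : ‖z₀‖ < R) (b : Bool) :
    HasCircleDegree (fun z => orient b (z - z₀)) 0 R (orientSign b) := by
  have := hasCircleDegree_sub_inside h
  rw [hasCircleDegree_iff] at this ⊢
  cases b
  · simpa [orient, orientSign] using this.conj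
  · simpa [orient, orientSign] using this

theorem hasCircleDegree_orient_outside {z₀ : ℂ} {r : ℝ} (hr : 0 ≤ r) (h : r < ‖z₀‖) (b : Bool) :
    HasCircleDegree (fun z => orient b (z - z₀)) 0 r 0 := by
  have := hasCircleDegree_sub_outside hr h
  rw [hasCircleDegree_iff] at this ⊢
  cases b
  · simpa [orient, orientSign] using this.conj
  · simpa [orient, orientSign] using this

/-- Near its zero `z`, the function `h` is closer to a non-vanishing continuous multiple of
`orient b (y - z)` than this multiple is to `0`. -/
def LooksLike (h : ℂ → ℂ) (z : ℂ) (b : Bool) : Prop :=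
  ∃ ω : ℂ → ℂ, ∃ c : ℝ, c < 1 ∧ ∀ᶠ y in 𝓝 z, ContinuousAt ω y ∧ ω y ≠ 0 ∧
    ‖h y - ω y * orient b (y - z)‖ ≤ c * (‖ω y‖ * ‖y - z‖)

/-- A zero `y ≠ z` would give `|ω y| |y - z| ≤ c |ω y| |y - z|` with `c < 1`. Hence the zeros of
this kind are isolated. -/
theorem LooksLike.eventually_ne {h : ℂ → ℂ} {z : ℂ} {b : Bool} (H : LooksLike h z b) :
    ∀ᶠ y in 𝓝[≠] z, h y ≠ 0 := by
  obtain ⟨ω, c, hc, H⟩ := H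
  filter_upwards [H.filter_mono nhdsWithin_le_nhds, self_mem_nhdsWithin] with y hy hyz h0
  obtain ⟨-, h1, h2⟩ := hy
  rw [h0, zero_sub, norm_neg, norm_mul, norm_orient] at h2
  have : 0 < ‖ω y‖ * ‖y - z‖ := mul_pos (norm_pos_iff.2 h1) (norm_pos_iff.2 (sub_ne_zero.2 hyz))
  nlinarith

/-- The same `c` works with `ω / w` in place of `ω`. This keeps the local form at the remaining
zeros when one zero is divided out. -/
theorem LooksLike.div {h w : ℂ → ℂ} {z : ℂ} {b : Bool} (H : LooksLike h z b)
    (hw : ∀ᶠ y in 𝓝 z, ContinuousAt w y ∧ w y ≠ 0) : LooksLike (fun y => h y / w y) z b := by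
  obtain ⟨ω, c, hc, H⟩ := H
  refine ⟨fun y => ω y / w y, c, hc, ?_⟩
  filter_upwards [H, hw] with y ⟨h1, h2, h3⟩ ⟨h4, h5⟩
  refine ⟨h1.div h4 h5, div_ne_zero h2 h5, ?_⟩
  have : h y / w y - ω y / w y * orient b (y - z) = (h y - ω y * orient b (y - z)) / w y := by
    ring
  rw [this, norm_div, norm_div, div_mul_eq_mul_div, ← mul_div_assoc]
  gcongr

theorem LooksLike.congr {h k : ℂ → ℂ} {z : ℂ} {b : Bool} (H : LooksLike h z b)
    (hk : h =ᶠ[𝓝 z] k) : LooksLike k z b := by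
  obtain ⟨ω, c, hc, H⟩ := H
  refine ⟨ω, c, hc, ?_⟩
  filter_upwards [H, hk] with y h1 h2
  rwa [← h2]

theorem det2_eq (a b : ℂ) : det2 a b = a.re * b.im - a.im * b.re := by
  simp [det2, Matrix.det_fin_two]

/-- A differentiable function with a non-degenerate zero looks like `y - z` or its conjugate. -/
theorem looksLike_of_hasFDerivAt {h : ℂ → ℂ} {z : ℂ} {T : ℂ →L[ℝ] ℂ} (hd : HasFDerivAt h T z)
    (h0 : h z = 0) {b : Bool} (hb : 0 < (orientSign b : ℝ) * det2 (T 1) (T Complex.I)) :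
    LooksLike h z b := by
  -- The Wirtinger derivatives: `T y = α y + β ȳ` has Jacobian `|α|² - |β|²`, so its sign tells
  -- which of the two terms dominates.
  set α : ℂ := (T 1 - I * T I) / 2 with hα
  set β : ℂ := (T 1 + I * T I) / 2 with hβ
  have hT : ∀ y, T y = α * y + β * star y := by
    intro y
    have h1 : T y = y.re * T 1 + y.im * T I := by
      conv_lhs => rw [← Complex.re_add_im y]
      rw [map_add]
      congr 1
      · have := T.map_smul y.re 1
        simpa using this
      · have := T.map_smul y.im I
        simpa using this
    have h2 : star y = y.re - y.im * I := by
      apply Complex.ext <;> simp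
    rw [h1, h2, hα, hβ]
    conv_rhs => rw [← Complex.re_add_im y]
    simp only [add_re, ofReal_re, mul_re, I_re, mul_zero, ofReal_im, I_im, mul_one, sub_self,
      add_zero, add_im, mul_im, zero_add]
    linear_combination (y.im * T I) * I_mul_I
  have hdet : det2 (T 1) (T I) = ‖α‖ ^ 2 - ‖β‖ ^ 2 := by
    rw [det2_eq, ← Complex.normSq_eq_norm_sq, ← Complex.normSq_eq_norm_sq, Complex.normSq_apply,
      Complex.normSq_apply, hα, hβ]
    simp
    ring
  obtain ⟨a, a', hbig, hTa⟩ : ∃ a a' : ℂ, ‖a'‖ < ‖a‖ ∧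
      ∀ y, ‖T y - a * orient b y‖ = ‖a'‖ * ‖y‖ := by
    cases b
    · refine ⟨β, α, ?_, fun y => ?_⟩
      · simp [orientSign, hdet] at hb
        exact lt_of_pow_lt_pow_left₀ 2 (norm_nonneg _) hb
      · simp [hT, orient]
    · refine ⟨α, β, ?_, fun y => ?_⟩
      · simp [orientSign, hdet] at hb
        exact lt_of_pow_lt_pow_left₀ 2 (norm_nonneg _) hb
      · simp [hT, orient]
  have ha : 0 < ‖a‖ := (norm_nonneg _).trans_lt hbig
  -- With `c` strictly between `|a'|/|a|` and `1`, the slack `c|a| - |a'|` absorbs the remainder of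
  -- the derivative.
  obtain ⟨c, hc1, hc2⟩ := exists_between ((div_lt_one ha).2 hbig)
  rw [div_lt_iff₀ ha] at hc1
  refine ⟨fun _ => a, c, hc2, ?_⟩
  have h3 := hd.isLittleO.def (sub_pos.2 hc1)
  filter_upwards [h3] with y hy
  refine ⟨continuousAt_const, norm_pos_iff.1 ha, ?_⟩
  rw [h0, sub_zero] at hy
  calc ‖h y - a * orient b (y - z)‖
      = ‖(h y - T (y - z)) + (T (y - z) - a * orient b (y - z))‖ := by congr 1; ring
    _ ≤ (c * ‖a‖ - ‖a'‖) * ‖y - z‖ + ‖a'‖ * ‖y - z‖ :=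
        (norm_add_le _ _).trans (add_le_add hy (hTa _).le)
    _ = c * (‖a‖ * ‖y - z‖) := by ring

/-- If `h` has finitely many zeros in an annulus, and looks like `y - z` or its conjugate at each of
them, then the signed number of these zeros is the difference of the degrees of `h` on the boundary
circles. -/
theorem degree_sub_degree_eq_sum (b : ℂ → Bool) {r R : ℝ} (hr : 0 ≤ r) (hrR : r ≤ R)
    (Z : Finset ℂ) : ∀ (h : ℂ → ℂ) {m n : ℤ},
    (∀ z, r ≤ ‖z‖ → ‖z‖ ≤ R → ContinuousAt h z) →
    (∀ z, r ≤ ‖z‖ → ‖z‖ ≤ R → z ∉ Z → h z ≠ 0) →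
    (∀ z ∈ Z, r < ‖z‖ ∧ ‖z‖ < R ∧ LooksLike h z (b z)) →
    HasCircleDegree h 0 r m → HasCircleDegree h 0 R n →
    n - m = ∑ z ∈ Z, orientSign (b z) := by
  induction Z using Finset.induction_on with
  | empty =>
    intro h m n hc h0 _ hm hn
    have := hm.of_annulus hr ⟨le_rfl, hrR⟩ ⟨hrR, le_rfl⟩ hc (fun z h1 h2 => h0 z h1 h2 (by simp))
    rw [hasCircleDegree_iff] at this hn
    simp [this.unique hn]
  | insert z₀ Z hz₀ ih =>
    intro h m n hc h0 hZ hm hn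
    obtain ⟨hz1, hz2, ω, c, hc1, hω⟩ := hZ z₀ (Finset.mem_insert_self _ _)
    -- The ball of radius `δ` about `z₀` lies in the open annulus and contains no other zero, so
    -- changes made inside it affect neither the boundary circles nor the rest of `Z`.
    have h1 : ∀ᶠ y in 𝓝 z₀, r < ‖y‖ ∧ ‖y‖ < R ∧ y ∉ Z := by
      have h2 : ∀ᶠ y in 𝓝 z₀, r < ‖y‖ := continuous_norm.continuousAt.eventually (lt_mem_nhds hz1)
      have h3 : ∀ᶠ y in 𝓝 z₀, ‖y‖ < R := continuous_norm.continuousAt.eventually (gt_mem_nhds hz2)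
      have h4 : ∀ᶠ y in 𝓝 z₀, y ∉ Z :=
        Z.finite_toSet.isClosed.isOpen_compl.mem_nhds (by simpa using hz₀)
      filter_upwards [h2, h3, h4] with y a b c using ⟨a, b, c⟩
    obtain ⟨δ, hδ, hball⟩ := Metric.eventually_nhds_iff_ball.1 (hω.and h1)
    set ρ : ℝ := δ / 2 with hρdef
    have hρ : 0 < ρ := half_pos hδ
    set χ : ℂ → ℝ := fun y => max 0 (1 - ‖y - z₀‖ / ρ) with hχ
    have hχc : Continuous χ := by fun_prop
    have hχ0 : ∀ y, ρ ≤ ‖y - z₀‖ → χ y = 0 := fun y hy => by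
      rw [hχ]
      exact max_eq_left (by rw [sub_nonpos, one_le_div hρ]; exact hy)
    have hχn : ∀ y, 0 ≤ χ y := fun y => le_max_left _ _
    have hχ1 : ∀ y, χ y ≤ 1 := fun y => max_le zero_le_one (by
      have : 0 ≤ ‖y - z₀‖ / ρ := by positivity
      linarith)
    have hχz : χ z₀ = 1 := by simp [hχ]
    set e : ℂ → ℂ := fun y => orient (b z₀) (y - z₀) with he
    have hec : Continuous e := (continuous_orient _).comp (by fun_prop)
    have he0 : ∀ y, y ≠ z₀ → e y ≠ 0 := fun y hy => by
      rw [he]; simpa [orient_eq_zero, sub_eq_zero] using hy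
    have hen : ∀ y, ‖e y‖ = ‖y - z₀‖ := fun y => norm_orient _ _
    -- The zero `z₀` is divided out: far from `z₀`, `k` is the quotient `h / e`; the cone `χ`
    -- interpolates to `ω` at `z₀`, where `h / e` may have no limit. As `h / e` is within `c|ω|` of
    -- `ω`, the interpolation has no zero near `z₀`.
    set k : ℂ → ℂ := fun y => χ y * ω y + (1 - χ y) * (h y / e y) with hk
    have hkout : ∀ y, ρ ≤ ‖y - z₀‖ → k y = h y / e y := fun y hy => by
      simp [hk, hχ0 y hy]
    have hkin : ∀ y, ‖y - z₀‖ < δ → ‖k y - ω y‖ ≤ (1 - χ y) * (c * ‖ω y‖) := by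
      intro y hy
      obtain ⟨⟨-, -, h3⟩, -⟩ := hball y (by simpa [dist_eq_norm] using hy)
      have h4 : k y - ω y = ((1 - χ y : ℝ) : ℂ) * (h y / e y - ω y) := by
        simp only [hk]; push_cast; ring
      have h5 : 0 ≤ 1 - χ y := sub_nonneg.2 (hχ1 y)
      rw [h4, norm_mul, Complex.norm_real, Real.norm_of_nonneg h5]
      -- At `z₀` the quotient `h / e` has only its default value, but its weight `1 - χ` is `0`.
      rcases eq_or_ne y z₀ with rfl | hyz
      · simp [hχz]
      · have h6 : 0 < ‖y - z₀‖ := norm_pos_iff.2 (sub_ne_zero.2 hyz)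
        have h7 : h y / e y - ω y = (h y - ω y * e y) / e y := by
          rw [sub_div, mul_div_cancel_right₀ _ (he0 y hyz)]
        rw [h7, norm_div, hen]
        gcongr
        rw [div_le_iff₀ h6, mul_assoc]
        exact h3
    have hkc : ∀ z, r ≤ ‖z‖ → ‖z‖ ≤ R → ContinuousAt k z := by
      intro z hz hz'
      rcases eq_or_ne z z₀ with rfl | hzz
      · have h3 : ContinuousAt ω z := (hball z (Metric.mem_ball_self hδ)).1.1
        have h4 : Tendsto (fun y => k y - ω y) (𝓝 z) (𝓝 0) := by
          have h5 : ContinuousAt (fun y => (1 - χ y) * (c * ‖ω y‖)) z :=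
            ((continuous_const.sub hχc).continuousAt).mul (h3.norm.const_mul c)
          have h6 : Tendsto (fun y => (1 - χ y) * (c * ‖ω y‖)) (𝓝 z) (𝓝 0) := by
            simpa [ContinuousAt, hχz] using h5
          refine squeeze_zero_norm' ?_ h6
          filter_upwards [Metric.ball_mem_nhds z hδ] with y hy
          exact hkin y (by simpa [dist_eq_norm] using hy)
        have h7 : k z = ω z := by simp [hk, hχz]
        have h8 := h4.add h3
        simpa [ContinuousAt, h7] using h8
      · have h3 : ContinuousAt (fun y => h y / e y) z :=
          (hc z hz hz').div hec.continuousAt (he0 z hzz)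
        rcases lt_or_ge ‖z - z₀‖ δ with h4 | h4
        · have h5 : ContinuousAt ω z := (hball z (by simpa [dist_eq_norm] using h4)).1.1
          have h6 : ContinuousAt (fun y => (χ y : ℂ)) z :=
            (Complex.continuous_ofReal.comp hχc).continuousAt
          exact (h6.mul h5).add ((continuousAt_const.sub h6).mul h3)
        · refine h3.congr ?_
          have h5 : ρ < ‖z - z₀‖ := by rw [hρdef]; linarith
          have h6 : ∀ᶠ y in 𝓝 z, ρ < ‖y - z₀‖ :=
            (by fun_prop : Continuous fun y : ℂ => ‖y - z₀‖).continuousAt.eventually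
              (lt_mem_nhds h5)
          filter_upwards [h6] with y hy
          exact (hkout y hy.le).symm
    have hk0 : ∀ z, r ≤ ‖z‖ → ‖z‖ ≤ R → z ∉ Z → k z ≠ 0 := by
      intro z hz hz' hzZ
      rcases lt_or_ge ‖z - z₀‖ δ with h4 | h4
      · intro h5
        have h6 := hkin z h4
        have h7 : 0 < ‖ω z‖ := norm_pos_iff.2 (hball z (by simpa [dist_eq_norm] using h4)).1.2.1
        rw [h5, zero_sub, norm_neg] at h6
        have h8 : 0 ≤ 1 - χ z := sub_nonneg.2 (hχ1 z)
        -- `LooksLike` only requires `c < 1`, so `c` may be negative.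
        rcases le_or_gt c 0 with h9 | h9
        · nlinarith [mul_nonneg h8 (mul_nonneg (neg_nonneg.2 h9) h7.le)]
        · have h10 : (1 - χ z) * (c * ‖ω z‖) ≤ 1 * (c * ‖ω z‖) := by
            gcongr
            linarith [hχn z]
          nlinarith
      · have hzz : z ≠ z₀ := by
          rintro rfl
          rw [sub_self, norm_zero] at h4
          linarith
        rw [hkout z (by rw [hρdef]; linarith)]
        exact div_ne_zero (h0 z hz hz' (by simp [hzz, hzZ])) (he0 z hzz)
    have hfar : ∀ z, (z ∈ Z ∨ ‖z‖ = r ∨ ‖z‖ = R) → δ ≤ ‖z - z₀‖ := by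
      intro z hz
      by_contra! hlt
      obtain ⟨-, h3, h4, h5⟩ := hball z (by simpa [dist_eq_norm] using hlt)
      rcases hz with h | h | h
      · exact h5 h
      · exact h3.ne' h
      · exact h4.ne h
    have hkZ : ∀ z ∈ Z, r < ‖z‖ ∧ ‖z‖ < R ∧ LooksLike k z (b z) := by
      intro z hz
      obtain ⟨h3, h4, h5⟩ := hZ z (Finset.mem_insert_of_mem hz)
      refine ⟨h3, h4, ?_⟩
      have hzz : z ≠ z₀ := fun h => hz₀ (h ▸ hz)
      have h6 : LooksLike (fun y => h y / e y) z (b z) := by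
        refine h5.div ?_
        filter_upwards [isOpen_ne.mem_nhds hzz] with y hy
        exact ⟨hec.continuousAt, he0 y hy⟩
      refine h6.congr ?_
      have h7 : ρ < ‖z - z₀‖ := by rw [hρdef]; linarith [hfar z (Or.inl hz)]
      have h8 : ∀ᶠ y in 𝓝 z, ρ < ‖y - z₀‖ :=
        (by fun_prop : Continuous fun y : ℂ => ‖y - z₀‖).continuousAt.eventually
          (lt_mem_nhds h7)
      filter_upwards [h8] with y hy
      exact (hkout y hy.le).symm
    -- On both boundary circles `k = h / e`. The factor `e` has degree `0` on the inner circle,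
    -- which does not enclose `z₀`, and `orientSign (b z₀)` on the outer one.
    have hkm : HasCircleDegree k 0 r (m - 0) := by
      have h3 := hasCircleDegree_orient_outside hr hz1 (b z₀)
      rw [hasCircleDegree_iff] at h3 hm ⊢
      convert hm.div h3 using 2 with x
      refine hkout _ ?_
      have := hfar (circleMap 0 r x) (Or.inr (Or.inl (by simp [abs_of_nonneg hr])))
      rw [hρdef]
      linarith
    have hkn : HasCircleDegree k 0 R (n - orientSign (b z₀)) := by
      have h3 := hasCircleDegree_orient_inside hz2 (b z₀)
      rw [hasCircleDegree_iff] at h3 hn ⊢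
      convert hn.div h3 using 2 with x
      refine hkout _ ?_
      have := hfar (circleMap 0 R x) (Or.inr (Or.inr (by simp [abs_of_nonneg (hr.trans hrR)])))
      rw [hρdef]
      linarith
    have := ih k hkc hk0 hkZ hkm hkn
    rw [Finset.sum_insert hz₀, ← this]
    ring

/-- The signed count of the zeros of a function in an open annulus, all of which are
non-degenerate. -/
theorem signed_count_zeros {h : ℂ → ℂ} {A B r R : ℝ} (hA : 0 ≤ A) (hr : A < r) (hrR : r < R)
    (hR : R < B) (hd : ∀ z, A < ‖z‖ → ‖z‖ < B → ContinuousAt h z)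
    (hz : ∀ z, A < ‖z‖ → ‖z‖ < B → h z = 0 →
      DifferentiableAt ℝ h z ∧ det2 (fderiv ℝ h z 1) (fderiv ℝ h z Complex.I) ≠ 0)
    (h0 : ∀ z, A < ‖z‖ → ‖z‖ ≤ r → h z ≠ 0) (h1 : ∀ z, R ≤ ‖z‖ → ‖z‖ < B → h z ≠ 0)
    {m n : ℤ} (hm : HasCircleDegree h 0 r m) (hn : HasCircleDegree h 0 R n) :
    {z | (A < ‖z‖ ∧ ‖z‖ < B) ∧ h z = 0}.Finite ∧
    ({z | ((A < ‖z‖ ∧ ‖z‖ < B) ∧ h z = 0) ∧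
        0 < det2 (fderiv ℝ h z 1) (fderiv ℝ h z Complex.I)}.ncard : ℤ) -
      ({z | ((A < ‖z‖ ∧ ‖z‖ < B) ∧ h z = 0) ∧
        det2 (fderiv ℝ h z 1) (fderiv ℝ h z Complex.I) < 0}.ncard : ℤ) = n - m := by
  classical
  set I : Set ℂ := {z | (A < ‖z‖ ∧ ‖z‖ < B) ∧ h z = 0} with hI
  set J : ℂ → ℝ := fun z => det2 (fderiv ℝ h z 1) (fderiv ℝ h z Complex.I) with hJ
  set b : ℂ → Bool := fun z => decide (0 < J z) with hb
  have hin : ∀ z ∈ I, r < ‖z‖ ∧ ‖z‖ < R := by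
    rintro z ⟨⟨h2, h3⟩, h4⟩
    constructor
    · by_contra! h5
      exact h0 z h2 h5 h4
    · by_contra! h5
      exact h1 z h5 h3 h4
  have hlook : ∀ z ∈ I, LooksLike h z (b z) := by
    rintro z ⟨⟨h2, h3⟩, h4⟩
    obtain ⟨h5, h6⟩ := hz z h2 h3 h4
    refine looksLike_of_hasFDerivAt h5.hasFDerivAt h4 ?_
    change 0 < _ * J z
    rcases lt_or_gt_of_ne h6 with h7 | h7
    · have : b z = false := by simpa [hb] using h7.le
      simpa [this, orientSign] using h7
    · have : b z = true := by simpa [hb] using h7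
      simpa [this, orientSign] using h7
  have hfin : I.Finite := by
    by_contra hinf
    -- Infinitely many zeros would accumulate in the closed annulus between `r` and `R`, by
    -- continuity at a zero; but zeros are isolated.
    have hK : IsCompact {z : ℂ | r ≤ ‖z‖ ∧ ‖z‖ ≤ R} := by
      refine Metric.isCompact_of_isClosed_isBounded ?_ ?_
      · exact (isClosed_le continuous_const continuous_norm).inter
          (isClosed_le continuous_norm continuous_const)
      · exact (Metric.isBounded_closedBall (x := (0 : ℂ)) (r := R)).subset
          fun z hz => by simpa using hz.2
    obtain ⟨z, hzK, hacc⟩ := Set.Infinite.exists_accPt_of_subset_isCompact hinf hK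
      fun z hz => ⟨(hin z hz).1.le, (hin z hz).2.le⟩
    have hzA : A < ‖z‖ := hr.trans_le hzK.1
    have hzB : ‖z‖ < B := hzK.2.trans_lt hR
    rw [accPt_iff_frequently_nhdsNE] at hacc
    have hz0 : h z = 0 := by
      by_contra hne
      have := ((hd z hzA hzB).eventually_ne hne).filter_mono (nhdsWithin_le_nhds (s := {z}ᶜ))
      exact hacc (this.mono fun y hy hyI => hy hyI.2)
    exact hacc ((hlook z ⟨⟨hzA, hzB⟩, hz0⟩).eventually_ne.mono fun y hy hyI => hy hyI.2)
  refine ⟨hfin, ?_⟩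
  have key := degree_sub_degree_eq_sum b (hA.trans hr.le) hrR.le hfin.toFinset h
    (fun z h2 h3 => hd z (hr.trans_le h2) (h3.trans_lt hR))
    (fun z h2 h3 h4 h5 => h4 (by simpa using ⟨⟨hr.trans_le h2, h3.trans_lt hR⟩, h5⟩))
    (fun z h2 => ⟨(hin z (by simpa using h2)).1, (hin z (by simpa using h2)).2,
      hlook z (by simpa using h2)⟩) hm hn
  rw [key]
  have hpos : {z | ((A < ‖z‖ ∧ ‖z‖ < B) ∧ h z = 0) ∧ 0 < J z} =
      ↑(hfin.toFinset.filter fun z => b z = true) := by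
    ext z; simp [hb, hI]
  have hneg : {z | ((A < ‖z‖ ∧ ‖z‖ < B) ∧ h z = 0) ∧ J z < 0} =
      ↑(hfin.toFinset.filter fun z => ¬ b z = true) := by
    ext z
    simp only [Set.mem_ofPred_eq, Finset.coe_filter, Set.Finite.mem_toFinset, hI, hb,
      decide_eq_true_eq, not_lt]
    exact ⟨fun h => ⟨h.1, h.2.le⟩, fun h => ⟨h.1, h.2.lt_of_ne (hz z h.1.1.1 h.1.1.2 h.1.2).2⟩⟩
  rw [hpos, hneg, Set.ncard_coe_finset, Set.ncard_coe_finset,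
    ← Finset.sum_filter_add_sum_filter_not hfin.toFinset (fun z => b z = true)]
  have s1 : ∑ z ∈ hfin.toFinset.filter (fun z => b z = true), orientSign (b z) =
      ∑ z ∈ hfin.toFinset.filter (fun z => b z = true), 1 :=
    Finset.sum_congr rfl fun z hz => by simp [(Finset.mem_filter.1 hz).2, orientSign]
  have s2 : ∑ z ∈ hfin.toFinset.filter (fun z => ¬ b z = true), orientSign (b z) =
      ∑ z ∈ hfin.toFinset.filter (fun z => ¬ b z = true), -1 :=
    Finset.sum_congr rfl fun z hz => by
      have := (Finset.mem_filter.1 hz).2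
      simp only [Bool.not_eq_true] at this
      simp [this, orientSign]
  rw [s1, s2]
  simp
  ring

open MeasureTheory

/-! ### Regular values of a linear function on a smooth curve -/

theorem finrank_ker_eq_one {T : ℂ × ℝ →L[ℝ] ℂ} (hT : Function.Surjective T) :
    Module.finrank ℝ (LinearMap.ker (T : ℂ × ℝ →ₗ[ℝ] ℂ)) = 1 := by
  have h1 := LinearMap.finrank_range_add_finrank_ker (T : ℂ × ℝ →ₗ[ℝ] ℂ)
  rw [LinearMap.range_eq_top.2 hT, finrank_top, Complex.finrank_real_complex,
    Module.finrank_prod, Complex.finrank_real_complex, Module.finrank_self] at h1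
  omega

theorem exists_smul_eq_of_mem_ker {T : ℂ × ℝ →L[ℝ] ℂ} (hT : Function.Surjective T)
    {σ τ : ℂ × ℝ} (hσ : T σ = 0) (hσ0 : σ ≠ 0) (hτ : T τ = 0) : ∃ c : ℝ, c • σ = τ := by
  have h1 := (finrank_eq_one_iff_of_nonzero'
    (⟨σ, hσ⟩ : LinearMap.ker (T : ℂ × ℝ →ₗ[ℝ] ℂ)) (fun h => hσ0 (congrArg Subtype.val h))).1 (finrank_ker_eq_one hT)
  obtain ⟨c, hc⟩ := h1 ⟨τ, hτ⟩
  exact ⟨c, congrArg Subtype.val hc⟩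

/-- Near a point of the regular curve `M = 0`, the critical values on it of a linear function `l`
are a null set. -/
theorem exists_nhds_volume_image_eq_zero {M : ℂ × ℝ → ℂ} (hM : ContDiff ℝ 1 M)
    (hs : ∀ q, M q = 0 → Function.Surjective (fderiv ℝ M q)) (l : ℂ × ℝ →L[ℝ] ℝ) {q₀ : ℂ × ℝ}
    (hq₀ : M q₀ = 0) :
    ∃ U ∈ 𝓝 q₀, volume (l '' ({q | M q = 0 ∧ ∃ σ, σ ≠ 0 ∧ fderiv ℝ M q σ = 0 ∧ l σ = 0} ∩ U)) =
      0 := by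
  have hT := hs q₀ hq₀
  obtain ⟨σ₀, hσ₀⟩ : ∃ σ₀ : LinearMap.ker (fderiv ℝ M q₀ : ℂ × ℝ →ₗ[ℝ] ℂ), σ₀ ≠ 0 := by
    have := Module.finrank_pos_iff_exists_ne_zero (R := ℝ)
      (M := LinearMap.ker (fderiv ℝ M q₀ : ℂ × ℝ →ₗ[ℝ] ℂ))
    exact this.1 (by rw [finrank_ker_eq_one hT]; exact one_pos)
  -- A functional that is non-zero on the tangent line completes `M` to a local diffeomorphism `(M,
  -- m)`. Then `m` is a parameter of the curve, and the claim becomes the Sard theorem for a real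
  -- function of one variable.
  obtain ⟨m, hm⟩ := SeparatingDual.exists_eq_one (R := ℝ) (x := (σ₀ : ℂ × ℝ)) (by simpa using hσ₀)
  set Φ : ℂ × ℝ → ℂ × ℝ := fun q => (M q, m q) with hΦ
  have hΦc : ContDiff ℝ 1 Φ := hM.prodMk m.contDiff
  have hΦd : ∀ q, HasFDerivAt Φ ((fderiv ℝ M q).prod m) q := fun q =>
    (hM.differentiable one_ne_zero q).hasFDerivAt.prodMk m.hasFDerivAt
  have hinj : Function.Injective ((fderiv ℝ M q₀).prod m : ℂ × ℝ →ₗ[ℝ] ℂ × ℝ) := by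
    refine LinearMap.ker_eq_bot.1 (LinearMap.ker_eq_bot'.2 fun x hx => ?_)
    have hx1 : fderiv ℝ M q₀ x = 0 := congrArg Prod.fst hx
    have hx2 : m x = 0 := congrArg Prod.snd hx
    obtain ⟨c, rfl⟩ := exists_smul_eq_of_mem_ker hT σ₀.2 (by simpa using hσ₀) hx1
    rw [map_smul, hm, smul_eq_mul, mul_one] at hx2
    rw [hx2, zero_smul]
  set e : (ℂ × ℝ) ≃L[ℝ] (ℂ × ℝ) := (LinearEquiv.ofInjectiveEndo _ hinj).toContinuousLinearEquiv
  have he : HasFDerivAt Φ (e : ℂ × ℝ →L[ℝ] ℂ × ℝ) q₀ := by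
    convert hΦd q₀ using 1
    ext x <;> rfl
  set P := hΦc.contDiffAt.toOpenPartialHomeomorph Φ he one_ne_zero with hP
  have hPΦ : ∀ q, P q = Φ q := fun q => rfl
  have hq₀P : q₀ ∈ P.source := hΦc.contDiffAt.mem_toOpenPartialHomeomorph_source he one_ne_zero
  have hsymm : ContDiffAt ℝ 1 P.symm (P q₀) := hΦc.contDiffAt.to_localInverse he one_ne_zero
  have hev : ∀ᶠ p in 𝓝 (P q₀), ContDiffAt ℝ 1 P.symm p := hsymm.eventually (by simp)
  have hU : ∀ᶠ q in 𝓝 q₀, q ∈ P.source ∧ ContDiffAt ℝ 1 P.symm (P q) :=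
    Filter.Eventually.and (P.open_source.mem_nhds hq₀P) ((P.continuousAt hq₀P).eventually hev)
  refine ⟨_, hU, ?_⟩
  set γ : ℝ → ℂ × ℝ := fun y => P.symm (0, y) with hγ
  set S : Set ℝ := {y | HasDerivAt (fun y => l (γ y)) 0 y} with hS
  have hnull : volume ((fun y => l (γ y)) '' S) = 0 := by
    refine addHaar_image_eq_zero_of_det_fderivWithin_eq_zero volume
      (f' := fun _ => ContinuousLinearMap.toSpanSingleton ℝ (0 : ℝ))
      (fun x hx => (show HasDerivAt _ _ _ from hx).hasFDerivAt.hasFDerivWithinAt) fun x _ => ?_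
    simp
  refine measure_mono_null ?_ hnull
  rintro _ ⟨q, ⟨⟨hq, σ, hσ0, hσ, hlσ⟩, hqs, hqc⟩, rfl⟩
  have hPq : P q = (0, m q) := by rw [hPΦ, hΦ]; simp [hq]
  have hγq : γ (m q) = q := by
    rw [hγ]
    simp only
    rw [← hPq, P.left_inv hqs]
  refine ⟨m q, ?_, by simp only [hγq]⟩
  rw [hPq] at hqc
  have hin : HasDerivAt (fun y : ℝ => ((0 : ℂ), y)) ((0 : ℂ), (1 : ℝ)) (m q) :=
    (hasDerivAt_const _ _).prodMk (hasDerivAt_id _)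
  have hγd : HasDerivAt γ (fderiv ℝ P.symm (0, m q) (0, 1)) (m q) :=
    ((hqc.differentiableAt one_ne_zero).hasFDerivAt).comp_hasDerivAt (m q) hin
  set τ := fderiv ℝ P.symm (0, m q) (0, 1)
  -- Differentiating `Φ (γ y) = (0, y)` shows that the velocity of `γ` lies in the kernel of the
  -- derivative of `M`. The kernel is a line spanned by `σ`, so `l` kills the velocity and `m q` is
  -- a critical point of `l ∘ γ`.
  have htar : ∀ᶠ y in 𝓝 (m q), Φ (γ y) = (0, y) := by
    have h1 : ((0 : ℂ), m q) ∈ P.target := hPq ▸ P.map_source hqs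
    have h2 : ContinuousAt (fun y : ℝ => ((0 : ℂ), y)) (m q) := hin.continuousAt
    filter_upwards [h2.eventually (P.open_target.mem_nhds h1)] with y hy
    exact P.right_inv hy
  have hΦγ : HasDerivAt (fun y => Φ (γ y)) (((fderiv ℝ M q).prod m) τ) (m q) := by
    refine HasFDerivAt.comp_hasDerivAt (l := Φ) (m q) ?_ hγd
    rw [hγq]
    exact hΦd q
  have heq := (hΦγ.congr_of_eventuallyEq (htar.mono fun y hy => hy.symm)).unique hin
  have hMτ : fderiv ℝ M q τ = 0 := congrArg Prod.fst heq
  obtain ⟨c, hc⟩ := exists_smul_eq_of_mem_ker (hs q hq) hσ hσ0 hMτ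
  have hlτ : l τ = 0 := by rw [← hc, map_smul, hlσ, smul_zero]
  have := l.hasFDerivAt.comp_hasDerivAt (m q) hγd
  rw [hlτ] at this
  exact this

/-- Almost every value of the linear function `l` is a regular value of its restriction to the
regular curve `M = 0`. -/
theorem ae_regular_value {M : ℂ × ℝ → ℂ} (hM : ContDiff ℝ 1 M)
    (hs : ∀ q, M q = 0 → Function.Surjective (fderiv ℝ M q)) (l : ℂ × ℝ →L[ℝ] ℝ) :
    ∀ᵐ s : ℝ, ∀ q, M q = 0 → l q = s → ∀ σ, fderiv ℝ M q σ = 0 → σ ≠ 0 → l σ ≠ 0 := by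
  set C : Set (ℂ × ℝ) := {q | M q = 0 ∧ ∃ σ, σ ≠ 0 ∧ fderiv ℝ M q σ = 0 ∧ l σ = 0} with hC
  -- The set function `S ↦ volume (l '' S)` is an outer measure on `ℂ × ℝ`, so local nullity gives
  -- global nullity without choosing a countable cover.
  have h1 : OuterMeasure.comap l (volume : Measure ℝ).toOuterMeasure C = 0 := by
    refine measure_null_of_locally_null C fun q hq => ?_
    obtain ⟨U, hU, hU0⟩ := exists_nhds_volume_image_eq_zero hM hs l hq.1
    refine ⟨C ∩ U, inter_mem_nhdsWithin _ hU, ?_⟩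
    rw [OuterMeasure.comap_apply]
    exact hU0
  rw [OuterMeasure.comap_apply] at h1
  have h2 : volume (l '' C) = 0 := h1
  filter_upwards [measure_eq_zero_iff_ae_notMem.1 h2] with s hsC q hq hl σ hσ hσ0 hlσ
  exact hsC ⟨q, ⟨hq, σ, hσ0, hσ, hlσ⟩, hl⟩

/-! ### Faces of the Newton polygon -/

theorem convex_newtonPolygon (f : MixedPolynomial) : Convex ℝ (newtonPolygon f) :=
  convex_convexHull ℝ _

theorem toPlane_mem_newtonPolygon {f : MixedPolynomial} {ω : ℕ × ℕ} (h : ω ∈ supp f) :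
    toPlane ω ∈ newtonPolygon f :=
  subset_convexHull ℝ _ ⟨ω, h, le_rfl, le_rfl⟩

/-- Translation by `y - x`, which has non-negative coordinates, maps the generating set into itself,
hence also its convex hull. -/
theorem newtonPolygon_upward {f : MixedPolynomial} {x y : ℝ × ℝ} (hx : x ∈ newtonPolygon f)
    (h1 : x.1 ≤ y.1) (h2 : x.2 ≤ y.2) : y ∈ newtonPolygon f := by
  have hsub : newtonPolygon f ⊆ (fun z => (y - x) + z) ⁻¹' newtonPolygon f := by
    refine convexHull_min ?_ ((convex_newtonPolygon f).translate_preimage_right _)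
    rintro z ⟨ω, hω, hz1, hz2⟩
    refine subset_convexHull ℝ _ ⟨ω, hω, ?_, ?_⟩
    · simp only [Prod.fst_add, Prod.fst_sub]; linarith
    · simp only [Prod.snd_add, Prod.snd_sub]; linarith
  simpa using hsub hx

/-- A convex subset of the Newton polygon on which a positive weight function is minimal, and which
contains all the points of the support with the minimal weight, is a face. -/
theorem isExposed_newtonPolygon {f : MixedPolynomial} {A B d : ℝ} (hA : 0 < A) (hB : 0 < B)
    {K : Set (ℝ × ℝ)} (hK : Convex ℝ K) (hKd : ∀ x ∈ K, A * x.1 + B * x.2 = d)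
    (hKP : K ⊆ newtonPolygon f)
    (hS : ∀ ω ∈ supp f, d < A * (toPlane ω).1 + B * (toPlane ω).2 ∨ toPlane ω ∈ K) :
    IsExposed ℝ (newtonPolygon f) K := by
  rintro ⟨k, hk⟩
  -- This union is convex, because a proper convex combination involving a point strictly above the
  -- line stays strictly above. It contains the generators, so it contains the polygon.
  have hQ : newtonPolygon f ⊆ {x | d < A * x.1 + B * x.2} ∪ K := by
    refine convexHull_min ?_ ?_
    · rintro x ⟨ω, hω, h1, h2⟩
      rcases hS ω hω with h | h
      · left
        have := mul_le_mul_of_nonneg_left h1 hA.le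
        have := mul_le_mul_of_nonneg_left h2 hB.le
        simp only [Set.mem_ofPred_eq]
        linarith
      · rcases h1.eq_or_lt with e1 | l1
        · rcases h2.eq_or_lt with e2 | l2
          · right
            rwa [show x = toPlane ω from Prod.ext e1.symm e2.symm]
          · left
            have := mul_lt_mul_of_pos_left l2 hB
            have := hKd _ h
            simp only [Set.mem_ofPred_eq]
            rw [← e1]
            linarith
        · left
          have := mul_lt_mul_of_pos_left l1 hA
          have := mul_le_mul_of_nonneg_left h2 hB.le
          have := hKd _ h
          simp only [Set.mem_ofPred_eq]
          linarith
    · intro x hx y hy a b ha hb hab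
      have hge : ∀ z ∈ {x : ℝ × ℝ | d < A * x.1 + B * x.2} ∪ K, d ≤ A * z.1 + B * z.2 := by
        rintro z (hz | hz)
        · exact le_of_lt hz
        · exact (hKd z hz).ge
      rcases ha.eq_or_lt with rfl | ha
      · rw [zero_add] at hab
        simpa [hab] using hy
      rcases hb.eq_or_lt with rfl | hb
      · rw [add_zero] at hab
        simpa [hab] using hx
      have key : A * (a • x + b • y).1 + B * (a • x + b • y).2 - d =
          a * (A * x.1 + B * x.2 - d) + b * (A * y.1 + B * y.2 - d) := by
        simp only [Prod.fst_add, Prod.snd_add, Prod.smul_fst, Prod.smul_snd, smul_eq_mul]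
        linear_combination d * hab
      by_cases hxy : x ∈ K ∧ y ∈ K
      · exact Or.inr (hK hxy.1 hxy.2 ha.le hb.le hab)
      · left
        simp only [Set.mem_ofPred_eq]
        have h1 := mul_nonneg ha.le (sub_nonneg.2 (hge x hx))
        have h2 := mul_nonneg hb.le (sub_nonneg.2 (hge y hy))
        rcases not_and_or.1 hxy with h | h
        · have h3 : d < A * x.1 + B * x.2 := hx.resolve_right h
          have := mul_pos ha (sub_pos.2 h3)
          linarith
        · have h3 : d < A * y.1 + B * y.2 := hy.resolve_right h
          have := mul_pos hb (sub_pos.2 h3)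
          linarith
  have hge : ∀ z ∈ newtonPolygon f, d ≤ A * z.1 + B * z.2 := by
    intro z hz
    rcases hQ hz with h | h
    · exact le_of_lt h
    · exact (hKd z h).ge
  -- Exposed sets are sets of maxima, hence the sign.
  set l : StrongDual ℝ (ℝ × ℝ) :=
    -(A • ContinuousLinearMap.fst ℝ ℝ ℝ + B • ContinuousLinearMap.snd ℝ ℝ ℝ) with hl
  have hlx : ∀ x, l x = -(A * x.1 + B * x.2) := fun x => by simp [hl]
  refine ⟨l, Set.Subset.antisymm (fun x hx => ⟨hKP hx, fun y hy => ?_⟩) fun x hx => ?_⟩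
  · rw [hlx, hlx, hKd x hx]
    linarith [hge y hy]
  · have := hx.2 k (hKP hk)
    rw [hlx, hlx, hKd k hk] at this
    rcases hQ hx.1 with h | h
    · simp only [Set.mem_ofPred_eq] at h
      linarith
    · exact h

/-- The points of the support that are vertices of the Newton boundary. -/
def IsVertex (f : MixedPolynomial) (p : ℕ × ℕ) : Prop :=
  p ∈ supp f ∧ IsCompactFace f {toPlane p}

/-- A strict minimizer of a positive weight on the support is an exposed point. This is the way
vertices are produced below. -/
theorem isVertex_of_weights {f : MixedPolynomial} {A B : ℝ} (hA : 0 < A) (hB : 0 < B) {p : ℕ × ℕ}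
    (hp : p ∈ supp f)
    (h : ∀ ω ∈ supp f, ω ≠ p → A * p.1 + B * p.2 < A * ω.1 + B * ω.2) : IsVertex f p := by
  refine ⟨hp, Set.singleton_nonempty _, ?_, isCompact_singleton⟩
  refine isExposed_newtonPolygon hA hB (d := A * p.1 + B * p.2) (convex_singleton _) ?_ ?_ ?_
  · rintro x rfl
    simp [toPlane]
  · rintro x rfl
    exact toPlane_mem_newtonPolygon hp
  · intro ω hω
    by_cases hωp : ω = p
    · exact Or.inr (by simp [hωp])
    · exact Or.inl (by simpa [toPlane] using h ω hω hωp)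

theorem IsVertex.mem_extremePoints {f : MixedPolynomial} {p : ℕ × ℕ} (h : IsVertex f p) :
    toPlane p ∈ (newtonPolygon f).extremePoints ℝ :=
  isExtreme_singleton.1 h.2.2.1.isExtreme

/-- The only point of the Newton polygon to the lower left of a vertex is the vertex. -/
theorem IsVertex.eq_of_le {f : MixedPolynomial} {p : ℕ × ℕ} (h : IsVertex f p) {c : ℝ × ℝ}
    (hc : c ∈ newtonPolygon f) (h1 : c.1 ≤ p.1) (h2 : c.2 ≤ p.2) : c = toPlane p := by
  have hx := h.mem_extremePoints
  rw [_root_.mem_extremePoints] at hx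
  -- The reflection of `c` in the vertex lies to its upper right, so the vertex is the midpoint of
  -- two points of the polygon.
  have hmem : (2 : ℝ) • toPlane p - c ∈ newtonPolygon f :=
    newtonPolygon_upward hx.1 (by simp [toPlane]; linarith) (by simp [toPlane]; linarith)
  refine (hx.2 c hc _ hmem ⟨1 / 2, 1 / 2, by norm_num, by norm_num, by norm_num, ?_⟩).1
  ext <;> simp <;> ring

theorem IsVertex.eq_of_fst_eq {f : MixedPolynomial} {p q : ℕ × ℕ} (hp : IsVertex f p)
    (hq : IsVertex f q) (h : p.1 = q.1) : p = q := by
  rcases le_total p.2 q.2 with h2 | h2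
  · have := hq.eq_of_le hp.mem_extremePoints.1 (by simp [toPlane, h]) (by simpa [toPlane] using h2)
    simp only [toPlane, Prod.mk.injEq, Nat.cast_inj] at this
    exact Prod.ext this.1 this.2
  · have := hp.eq_of_le hq.mem_extremePoints.1 (by simp [toPlane, h]) (by simpa [toPlane] using h2)
    simp only [toPlane, Prod.mk.injEq, Nat.cast_inj] at this
    exact (Prod.ext this.1 this.2).symm

theorem IsVertex.snd_lt_of_fst_lt {f : MixedPolynomial} {p q : ℕ × ℕ} (hp : IsVertex f p)
    (hq : IsVertex f q) (h : p.1 < q.1) : q.2 < p.2 := by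
  by_contra! h2
  have := hq.eq_of_le hp.mem_extremePoints.1 (by simpa [toPlane] using h.le)
    (by simpa [toPlane] using h2)
  simp only [toPlane, Prod.mk.injEq, Nat.cast_inj] at this
  omega

/-- A vertex is not above a chord of the Newton polygon. -/
theorem IsVertex.not_above_chord {f : MixedPolynomial} {p : ℕ × ℕ} (hp : IsVertex f p) {A B : ℝ}
    (hB : 0 < B) {x y : ℝ × ℝ} (hx : x ∈ newtonPolygon f) (hy : y ∈ newtonPolygon f)
    (h1 : x.1 < p.1) (h2 : p.1 < y.1) (hxd : A * x.1 + B * x.2 ≤ A * p.1 + B * p.2)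
    (hyd : A * y.1 + B * y.2 ≤ A * p.1 + B * p.2) : False := by
  have hxy : 0 < y.1 - x.1 := by linarith
  -- The barycentric weights of the point of the chord at the abscissa of `p`. That point is not
  -- above `p`, so it equals `p`, and extremality forces `x = p`.
  set a : ℝ := (y.1 - p.1) / (y.1 - x.1) with ha
  set b : ℝ := (p.1 - x.1) / (y.1 - x.1) with hb
  have ha0 : 0 < a := div_pos (by linarith) hxy
  have hb0 : 0 < b := div_pos (by linarith) hxy
  have hab : a + b = 1 := by
    rw [ha, hb, ← add_div, div_eq_one_iff_eq hxy.ne']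
    ring
  have hc1 : (a • x + b • y).1 = p.1 := by
    simp only [Prod.fst_add, Prod.smul_fst, smul_eq_mul]
    rw [ha, hb]
    field_simp
    ring
  have hc2 : (a • x + b • y).2 ≤ p.2 := by
    have h3 := mul_le_mul_of_nonneg_left hxd ha0.le
    have h4 := mul_le_mul_of_nonneg_left hyd hb0.le
    have h5 : A * (a • x + b • y).1 + B * (a • x + b • y).2 ≤ A * p.1 + B * p.2 := by
      simp only [Prod.fst_add, Prod.snd_add, Prod.smul_fst, Prod.smul_snd, smul_eq_mul]
      have h6 : a * (A * p.1 + B * p.2) + b * (A * p.1 + B * p.2) = A * p.1 + B * p.2 := by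
        rw [← add_mul, hab, one_mul]
      linarith
    rw [hc1] at h5
    exact le_of_mul_le_mul_left (by linarith) hB
  have hc := hp.eq_of_le (convex_newtonPolygon f hx hy ha0.le hb0.le hab) hc1.le hc2
  have hext := (_root_.mem_extremePoints.1 hp.mem_extremePoints).2 x hx y hy
    ⟨a, b, ha0, hb0, hab, hc⟩
  have := congrArg Prod.fst hext.1
  simp only [toPlane] at this
  linarith

/-- The segment between consecutive vertices is a compact face. -/
theorem isCompactFace_segment {f : MixedPolynomial} {p q : ℕ × ℕ} (hp : IsVertex f p)
    (hq : IsVertex f q) (hpq : p.1 < q.1)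
    (hcons : ∀ s, IsVertex f s → s.1 ≤ p.1 ∨ q.1 ≤ s.1) :
    IsCompactFace f (segment ℝ (toPlane p) (toPlane q)) := by
  have hpq2 := hp.snd_lt_of_fst_lt hq hpq
  -- The pair `(a, b)` is the inner normal of the segment, with positive integer entries.
  set a : ℕ := p.2 - q.2 with ha
  set b : ℕ := q.1 - p.1 with hb
  have ha0 : 0 < a := by omega
  have hb0 : 0 < b := by omega
  have haR : (a : ℝ) = p.2 - q.2 := by rw [ha, Nat.cast_sub hpq2.le]
  have hbR : (b : ℝ) = q.1 - p.1 := by rw [hb, Nat.cast_sub hpq.le]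
  have hbR0 : (0 : ℝ) < b := by exact_mod_cast hb0
  have haR0 : (0 : ℝ) < a := by exact_mod_cast ha0
  have hpqd : (a : ℝ) * q.1 + b * q.2 = a * p.1 + b * p.2 := by rw [haR, hbR]; ring
  have hP : toPlane p ∈ newtonPolygon f := hp.mem_extremePoints.1
  have hQ : toPlane q ∈ newtonPolygon f := hq.mem_extremePoints.1
  -- A point of the support on or below the line of the segment, but to the left or right of it,
  -- would put an endpoint on or above a chord.
  have hout : ∀ s ∈ supp f, (a : ℝ) * s.1 + b * s.2 ≤ a * p.1 + b * p.2 → p.1 ≤ s.1 ∧ s.1 ≤ q.1 := by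
    intro s hs hsd
    have hS := toPlane_mem_newtonPolygon hs
    constructor
    · by_contra! hlt
      exact hp.not_above_chord hbR0 hS hQ (by simpa [toPlane] using hlt)
        (by simpa [toPlane] using hpq) hsd hpqd.le
    · by_contra! hlt
      exact hq.not_above_chord hbR0 hP hS (by simpa [toPlane] using hpq)
        (by simpa [toPlane] using hlt) hpqd.ge (hsd.trans hpqd.ge)
  have hge : ∀ s ∈ supp f, a * p.1 + b * p.2 ≤ a * s.1 + b * s.2 := by
    by_contra! hcon
    obtain ⟨s₀, hs₀, hlt⟩ := hcon
    -- All abscissas are below `m`, so minimizing weight times `m` plus abscissa is minimizing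
    -- lexicographically, and the residue modulo `m` recovers the abscissa. The minimizer is
    -- therefore unique, a vertex below the line and over the segment, which consecutiveness
    -- excludes.
    set m : ℕ := (supp f).sup Prod.fst + 1 with hm
    have hlt_m : ∀ s ∈ supp f, s.1 < m := fun s hs =>
      Nat.lt_succ_of_le (Finset.le_sup (f := Prod.fst) hs)
    obtain ⟨s, hs, hmin⟩ := Finset.exists_min_image (supp f)
      (fun s => (a * s.1 + b * s.2) * m + s.1) ⟨s₀, hs₀⟩
    have hvert : IsVertex f s := by
      refine isVertex_of_weights (A := ((a * m + 1 : ℕ) : ℝ)) (B := ((b * m : ℕ) : ℝ))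
        (by positivity) (by positivity) hs fun ω hω hne => ?_
      have hle := hmin ω hω
      have hne' : (a * s.1 + b * s.2) * m + s.1 ≠ (a * ω.1 + b * ω.2) * m + ω.1 := by
        intro heq
        have h1 : s.1 = ω.1 := by
          have := congrArg (· % m) heq
          simpa [Nat.add_mod, Nat.mod_eq_of_lt (hlt_m s hs), Nat.mod_eq_of_lt (hlt_m ω hω)]
            using this
        rw [h1, add_left_inj] at heq
        have h2 := Nat.eq_of_mul_eq_mul_right (by omega) heq
        have h3 := Nat.eq_of_mul_eq_mul_left hb0 (Nat.add_left_cancel h2)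
        exact hne (Prod.ext h1 h3).symm
      have hlt' := lt_of_le_of_ne hle hne'
      have : (a * m + 1) * s.1 + b * m * s.2 < (a * m + 1) * ω.1 + b * m * ω.2 := by
        linarith
      exact_mod_cast this
    have hsd : a * s.1 + b * s.2 < a * p.1 + b * p.2 := by
      have h1 := hmin s₀ hs₀
      have h2 := hlt_m s₀ hs₀
      have h3 : (a * s.1 + b * s.2) * m < (a * s₀.1 + b * s₀.2 + 1) * m := by
        rw [add_mul _ 1 m]
        omega
      have := Nat.lt_of_mul_lt_mul_right h3
      omega
    have hsdR : (a : ℝ) * s.1 + b * s.2 < a * p.1 + b * p.2 := by exact_mod_cast hsd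
    obtain ⟨h1, h2⟩ := hout s hs hsdR.le
    rcases hcons s hvert with h | h
    · rw [hvert.eq_of_fst_eq hp (le_antisymm h h1)] at hsd
      omega
    · rw [hvert.eq_of_fst_eq hq (le_antisymm h2 h)] at hsdR
      linarith
  refine ⟨⟨_, left_mem_segment ℝ _ _⟩, ?_, ?_⟩
  · refine isExposed_newtonPolygon haR0 hbR0 (d := a * p.1 + b * p.2) (convex_segment _ _) ?_
      ((convex_newtonPolygon f).segment_subset hP hQ) ?_
    · rintro x ⟨c, c', hc, hc', hcc, rfl⟩
      simp only [toPlane, Prod.fst_add, Prod.snd_add, Prod.smul_fst, Prod.smul_snd, smul_eq_mul]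
      linear_combination c' * hpqd + (a * p.1 + b * p.2) * hcc
    · intro s hs
      have hges : (a : ℝ) * p.1 + b * p.2 ≤ a * s.1 + b * s.2 := by exact_mod_cast hge s hs
      rcases hges.lt_or_eq with h | h
      · exact Or.inl h
      right
      obtain ⟨h1, h2⟩ := hout s hs h.ge
      have h1' : (p.1 : ℝ) ≤ s.1 := by exact_mod_cast h1
      have h2' : (s.1 : ℝ) ≤ q.1 := by exact_mod_cast h2
      refine ⟨(q.1 - s.1) / b, (s.1 - p.1) / b, div_nonneg (by linarith) hbR0.le,
        div_nonneg (by linarith) hbR0.le, ?_, ?_⟩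
      · rw [← add_div, div_eq_one_iff_eq hbR0.ne', hbR]
        ring
      · have hb' : (b : ℝ) ≠ 0 := hbR0.ne'
        refine Prod.ext ?_ ?_
        · simp only [toPlane, Prod.fst_add, Prod.smul_fst, smul_eq_mul]
          rw [div_mul_eq_mul_div, div_mul_eq_mul_div, ← add_div, div_eq_iff hb', hbR]
          ring
        · simp only [toPlane, Prod.snd_add, Prod.smul_snd, smul_eq_mul]
          rw [div_mul_eq_mul_div, div_mul_eq_mul_div, ← add_div, div_eq_iff hb']
          rw [haR, hbR] at h
          rw [hbR]
          linear_combination h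
  · rw [segment_eq_image]
    exact isCompact_Icc.image (by fun_prop)

/-! ### The list of the vertices -/

theorem mem_vertexList {f : MixedPolynomial} {p : ℕ ×ₗ ℕ} :
    p ∈ vertexList f ↔ IsVertex f (ofLex p) := by
  classical
  simp only [vertexList, Finset.mem_sort, Finset.mem_image, Finset.mem_filter, IsVertex]
  constructor
  · rintro ⟨q, hq, rfl⟩
    exact hq
  · intro h
    exact ⟨ofLex p, h, rfl⟩

theorem vertex_eq_getElem {f : MixedPolynomial} {i : ℕ} (h : i < (vertexList f).length) :
    vertex f i = ofLex ((vertexList f)[i]) := by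
  simp [vertex, h]

theorem exists_vertex_eq {f : MixedPolynomial} {p : ℕ × ℕ} (h : IsVertex f p) :
    ∃ i < (vertexList f).length, vertex f i = p := by
  obtain ⟨i, hi, h⟩ := List.getElem_of_mem (mem_vertexList.2 (show IsVertex f (ofLex (toLex p)) from h))
  exact ⟨i, hi, by rw [vertex_eq_getElem hi, h]; rfl⟩

theorem isVertex_of_lt_length {f : MixedPolynomial} {i : ℕ} (h : i < (vertexList f).length) :
    IsVertex f (vertex f i) := by
  rw [vertex_eq_getElem h]
  exact mem_vertexList.1 (List.getElem_mem h)

/-- The list is sorted lexicographically; since different vertices have different abscissas, the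
first coordinate decides. -/
theorem vertex_fst_lt {f : MixedPolynomial} {i j : ℕ} (hij : i < j)
    (hj : j < (vertexList f).length) : (vertex f i).1 < (vertex f j).1 := by
  have hi := hij.trans hj
  have hlt : (vertexList f)[i] < (vertexList f)[j] :=
    (Finset.sortedLT_sort _).getElem_lt_getElem_iff.2 hij
  rw [Prod.Lex.lt_iff] at hlt
  rw [vertex_eq_getElem hi, vertex_eq_getElem hj]
  rcases hlt with h | ⟨h, h'⟩
  · exact h
  · have := (mem_vertexList.1 (List.getElem_mem hi)).eq_of_fst_eq
      (mem_vertexList.1 (List.getElem_mem hj)) h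
    rw [this] at h'
    exact absurd h' (lt_irrefl _)

theorem vertex_fst_le {f : MixedPolynomial} {i j : ℕ} (hij : i ≤ j)
    (hj : j < (vertexList f).length) : (vertex f i).1 ≤ (vertex f j).1 := by
  rcases hij.eq_or_lt with rfl | h
  · exact le_rfl
  · exact (vertex_fst_lt h hj).le

/-- If `l` were positive on the whole support, it would be positive on the whole polygon. For a
coordinate `l`, this turns a boundary point on an axis into a support point on it. -/
theorem exists_mem_supp_of_mem_newtonBoundary {f : MixedPolynomial} {x : ℝ × ℝ}
    (hx : x ∈ newtonBoundary f) (l : ℝ × ℝ →ₗ[ℝ] ℝ) (hl : l x = 0)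
    (hl0 : ∀ y : ℝ × ℝ, 0 ≤ y.1 → 0 ≤ y.2 → 0 ≤ l y) : ∃ ω ∈ supp f, l (toPlane ω) = 0 := by
  obtain ⟨Δ, hΔ, hxΔ⟩ := hx
  have hxP : x ∈ newtonPolygon f := hΔ.2.1.subset hxΔ
  by_contra! hne
  have hpos : newtonPolygon f ⊆ {y | 0 < l y} := by
    refine convexHull_min ?_ (convex_halfSpace_gt l.isLinear 0)
    rintro y ⟨ω, hω, h1, h2⟩
    have h3 : 0 ≤ l (toPlane ω) := hl0 _ (by simp [toPlane]) (by simp [toPlane])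
    have h4 : 0 ≤ l (y - toPlane ω) := hl0 _ (by simpa using h1) (by simpa using h2)
    rw [map_sub] at h4
    have := lt_of_le_of_ne h3 (hne ω hω).symm
    simp only [Set.mem_ofPred_eq]
    linarith
  exact (hpos hxP).ne' hl

theorem exists_isVertex_fst_eq_zero {f : MixedPolynomial} (h : IsConvenient f) :
    ∃ p, IsVertex f p ∧ p.1 = 0 := by
  obtain ⟨x, hx, hx0⟩ := h.1
  obtain ⟨ω, hω, hω0⟩ := exists_mem_supp_of_mem_newtonBoundary hx (LinearMap.fst ℝ ℝ ℝ) hx0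
    fun y h _ => h
  have hω0 : ω.1 = 0 := by simpa [toPlane] using hω0
  obtain ⟨p, hp, hmin⟩ := Finset.exists_min_image ((supp f).filter fun s => s.1 = 0) Prod.snd
    ⟨ω, by simp [hω, hω0]⟩
  rw [Finset.mem_filter] at hp
  -- The lowest support point on the axis. With the weight `p.2 + 1` on the abscissa, every support
  -- point off the axis already weighs more than `p`.
  refine ⟨p, isVertex_of_weights (A := ((p.2 + 1 : ℕ) : ℝ)) (B := 1) (by positivity) one_pos hp.1
    fun s hs hsp => ?_, hp.2⟩
  have : (p.2 + 1) * p.1 + 1 * p.2 < (p.2 + 1) * s.1 + 1 * s.2 := by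
    rw [hp.2]
    rcases Nat.eq_zero_or_pos s.1 with h0 | h0
    · have h1 := hmin s (by simp [hs, h0])
      have h2 : p.2 ≠ s.2 := fun h2 => hsp (Prod.ext (h0.trans hp.2.symm) h2.symm)
      rw [h0]
      omega
    · nlinarith
  exact_mod_cast this

theorem exists_isVertex_snd_eq_zero {f : MixedPolynomial} (h : IsConvenient f) :
    ∃ p, IsVertex f p ∧ p.2 = 0 := by
  obtain ⟨x, hx, hx0⟩ := h.2
  obtain ⟨ω, hω, hω0⟩ := exists_mem_supp_of_mem_newtonBoundary hx (LinearMap.snd ℝ ℝ ℝ) hx0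
    fun y _ h => h
  have hω0 : ω.2 = 0 := by simpa [toPlane] using hω0
  obtain ⟨p, hp, hmin⟩ := Finset.exists_min_image ((supp f).filter fun s => s.2 = 0) Prod.fst
    ⟨ω, by simp [hω, hω0]⟩
  rw [Finset.mem_filter] at hp
  refine ⟨p, isVertex_of_weights (A := 1) (B := ((p.1 + 1 : ℕ) : ℝ)) one_pos (by positivity) hp.1
    fun s hs hsp => ?_, hp.2⟩
  have : 1 * p.1 + (p.1 + 1) * p.2 < 1 * s.1 + (p.1 + 1) * s.2 := by
    rw [hp.2]
    rcases Nat.eq_zero_or_pos s.2 with h0 | h0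
    · have h1 := hmin s (by simp [hs, h0])
      have h2 : p.1 ≠ s.1 := fun h2 => hsp (Prod.ext h2.symm (h0.trans hp.2.symm))
      rw [h0]
      omega
    · nlinarith
  exact_mod_cast this

/-- The subtraction in `numEdges` is truncated; convenience ensures that the list is not empty. -/
theorem lt_length_of_le_numEdges {f : MixedPolynomial} (h : IsConvenient f) {i : ℕ}
    (hi : i ≤ numEdges f) : i < (vertexList f).length := by
  obtain ⟨p, hp, -⟩ := exists_isVertex_fst_eq_zero h
  obtain ⟨j, hj, -⟩ := exists_vertex_eq hp
  unfold numEdges at hi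
  omega

theorem vertex_zero_fst {f : MixedPolynomial} (h : IsConvenient f) : (vertex f 0).1 = 0 := by
  obtain ⟨p, hp, h0⟩ := exists_isVertex_fst_eq_zero h
  obtain ⟨j, hj, rfl⟩ := exists_vertex_eq hp
  have := vertex_fst_le (Nat.zero_le j) hj
  omega

theorem vertex_numEdges_snd {f : MixedPolynomial} (h : IsConvenient f) :
    (vertex f (numEdges f)).2 = 0 := by
  obtain ⟨p, hp, h0⟩ := exists_isVertex_snd_eq_zero h
  obtain ⟨j, hj, rfl⟩ := exists_vertex_eq hp
  have hN := lt_length_of_le_numEdges h le_rfl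
  have hj' : j ≤ numEdges f := by unfold numEdges; omega
  rcases hj'.eq_or_lt with rfl | hlt
  · exact h0
  · have := hp.snd_lt_of_fst_lt (isVertex_of_lt_length hN) (vertex_fst_lt hlt hN)
    omega

theorem isCompactFace_edge {f : MixedPolynomial} (h : IsConvenient f) {i : ℕ} (hi : 1 ≤ i)
    (hiN : i ≤ numEdges f) : IsCompactFace f (edge f i) := by
  have h1 := lt_length_of_le_numEdges h hiN
  have h0 : i - 1 < (vertexList f).length := by omega
  refine isCompactFace_segment (isVertex_of_lt_length h0) (isVertex_of_lt_length h1)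
    (vertex_fst_lt (by omega) h1) fun s hs => ?_
  obtain ⟨j, hj, rfl⟩ := exists_vertex_eq hs
  rcases le_or_gt j (i - 1) with hji | hji
  · exact Or.inl (vertex_fst_le hji h0)
  · exact Or.inr (vertex_fst_le (by omega) hj)

/-! ### Mixed monomials and face functions -/

/-- The mixed monomial `u^ν₁ ū^μ₁ v^ν₂ v̄^μ₂`. -/
def mono (m : Fin 4 →₀ ℕ) (z : ℂ × ℂ) : ℂ :=
  z.1 ^ m 0 * star z.1 ^ m 1 * (z.2 ^ m 2 * star z.2 ^ m 3)

open Classical in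
/-- The exponents of the terms of the face function `f_Δ`. -/
def faceSupport (f : MixedPolynomial) (Δ : Set (ℝ × ℝ)) : Finset (Fin 4 →₀ ℕ) :=
  f.support.filter fun m => toPlane (bidegree m) ∈ Δ

theorem mem_faceSupport {f : MixedPolynomial} {Δ : Set (ℝ × ℝ)} {m : Fin 4 →₀ ℕ} :
    m ∈ faceSupport f Δ ↔ m ∈ f.support ∧ toPlane (bidegree m) ∈ Δ := by
  classical
  exact Finset.mem_filter

theorem evalAt_monomial (m : Fin 4 →₀ ℕ) (c : ℂ) (z : ℂ × ℂ) :
    evalAt (MvPolynomial.monomial m c) z = c * mono m z := by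
  rw [evalAt, MvPolynomial.eval_monomial, Finsupp.prod_fintype _ _ (by simp), Fin.prod_univ_four]
  congr 1
  simp [mono]
  ring

theorem evalAt_faceFunction (f : MixedPolynomial) (Δ : Set (ℝ × ℝ)) (z : ℂ × ℂ) :
    evalAt (faceFunction f Δ) z = ∑ m ∈ faceSupport f Δ, f.coeff m * mono m z := by
  rw [evalAt, faceFunction, map_sum]
  exact Finset.sum_congr rfl fun m _ => evalAt_monomial m _ z

theorem contDiff_star_complex : ContDiff ℝ 1 (fun z : ℂ => star z) :=
  Complex.conjCLE.contDiff

theorem contDiff_mono (m : Fin 4 →₀ ℕ) : ContDiff ℝ 1 (mono m) := by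
  have h1 : ContDiff ℝ 1 (fun z : ℂ × ℂ => star z.1) := contDiff_star_complex.comp contDiff_fst
  have h2 : ContDiff ℝ 1 (fun z : ℂ × ℂ => star z.2) := contDiff_star_complex.comp contDiff_snd
  exact ((contDiff_fst.pow _).mul (h1.pow _)).mul ((contDiff_snd.pow _).mul (h2.pow _))

theorem contDiff_evalAt_faceFunction (f : MixedPolynomial) (Δ : Set (ℝ × ℝ)) :
    ContDiff ℝ 1 (evalAt (faceFunction f Δ)) := by
  rw [show evalAt (faceFunction f Δ) = fun z => ∑ m ∈ faceSupport f Δ, f.coeff m * mono m z from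
    funext (evalAt_faceFunction f Δ)]
  exact ContDiff.sum fun m _ => contDiff_const.mul (contDiff_mono m)

theorem mono_real_smul (m : Fin 4 →₀ ℕ) (x y : ℝ) (u v : ℂ) :
    mono m ((x : ℂ) * u, (y : ℂ) * v) =
      (x : ℂ) ^ (bidegree m).1 * (y : ℂ) ^ (bidegree m).2 * mono m (u, v) := by
  simp only [mono, bidegree, star_mul', Complex.star_def, Complex.conj_ofReal]
  ring

theorem toPlane_injective : Function.Injective toPlane := by
  rintro ⟨a, b⟩ ⟨c, d⟩ h
  simpa [toPlane] using h

theorem bidegree_of_mem_faceSupport_vertex {f : MixedPolynomial} {i : ℕ} {m : Fin 4 →₀ ℕ}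
    (h : m ∈ faceSupport f {toPlane (vertex f i)}) : bidegree m = vertex f i := by
  exact toPlane_injective (mem_faceSupport.1 h).2

/-- A function of a vertex is homogeneous in each variable. -/
theorem evalAt_vertexFunction_smul (f : MixedPolynomial) (i : ℕ) (x y : ℝ) (u v : ℂ) :
    evalAt (vertexFunction f i) ((x : ℂ) * u, (y : ℂ) * v) =
      (x : ℂ) ^ (vertex f i).1 * (y : ℂ) ^ (vertex f i).2 * evalAt (vertexFunction f i) (u, v) := by
  rw [vertexFunction, evalAt_faceFunction, evalAt_faceFunction, Finset.mul_sum]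
  refine Finset.sum_congr rfl fun m hm => ?_
  rw [mono_real_smul, bidegree_of_mem_faceSupport_vertex hm]
  ring

theorem evalAt_vertexFunction_of_fst_eq_zero {f : MixedPolynomial} {i : ℕ}
    (h : (vertex f i).1 = 0) (u u' v : ℂ) :
    evalAt (vertexFunction f i) (u, v) = evalAt (vertexFunction f i) (u', v) := by
  rw [vertexFunction, evalAt_faceFunction, evalAt_faceFunction]
  refine Finset.sum_congr rfl fun m hm => ?_
  have h1 := congrArg Prod.fst (bidegree_of_mem_faceSupport_vertex hm)
  simp only [bidegree, h, Nat.add_eq_zero_iff] at h1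
  simp [mono, h1.1, h1.2]

theorem evalAt_vertexFunction_of_snd_eq_zero {f : MixedPolynomial} {i : ℕ}
    (h : (vertex f i).2 = 0) (u v v' : ℂ) :
    evalAt (vertexFunction f i) (u, v) = evalAt (vertexFunction f i) (u, v') := by
  rw [vertexFunction, evalAt_faceFunction, evalAt_faceFunction]
  refine Finset.sum_congr rfl fun m hm => ?_
  have h1 := congrArg Prod.snd (bidegree_of_mem_faceSupport_vertex hm)
  simp only [bidegree, h, Nat.add_eq_zero_iff] at h1
  simp [mono, h1.1, h1.2]

/-! ### Non-vanishing of the functions of the vertices -/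

/-- Used to turn homogeneity or independence of a variable into vectors of the kernel of the
derivative. -/
theorem fderiv_eq_zero_of_curve {E F : Type*} [NormedAddCommGroup E] [NormedSpace ℝ E]
    [NormedAddCommGroup F] [NormedSpace ℝ F] {g : E → F} {z d : E} (hg : DifferentiableAt ℝ g z)
    {c : ℝ → E} {s : ℝ} (hc : HasDerivAt c d s) (hcs : c s = z) (h : ∀ x, g (c x) = g z) :
    fderiv ℝ g z d = 0 := by
  subst hcs
  have h1 : HasDerivAt (g ∘ c) (fderiv ℝ g (c s) d) s := hg.hasFDerivAt.comp_hasDerivAt s hc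
  have h2 : g ∘ c = fun _ => g (c s) := funext h
  rw [h2] at h1
  exact h1.unique (hasDerivAt_const _ _)

/-- With a non-zero vector in its kernel, `T` has real rank at most one: its image is the line
through `T (I v)`. -/
theorem not_surjective_of_ofReal_mul {T : ℂ →L[ℝ] ℂ} {v : ℂ} (hv : v ≠ 0) (hT : T v = 0) :
    ¬ Function.Surjective T := by
  intro hs
  have hall : ∀ w : ℂ, T w = ((w / v).im : ℂ) * T (Complex.I * v) := by
    intro w
    have h1 : w = (w / v).re • v + (w / v).im • (Complex.I * v) := by
      calc w = w / v * v := (div_mul_cancel₀ w hv).symm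
        _ = ((w / v).re + (w / v).im * Complex.I) * v := by rw [Complex.re_add_im]
        _ = _ := by simp only [Complex.real_smul]; ring
    conv_lhs => rw [h1, map_add, map_smul, map_smul, hT]
    simp
  set ξ := T (Complex.I * v)
  by_cases h0 : ξ = 0
  · obtain ⟨w, hw⟩ := hs 1
    rw [hall w, h0, mul_zero] at hw
    exact zero_ne_one hw
  · obtain ⟨w, hw⟩ := hs (Complex.I * ξ)
    rw [hall w] at hw
    have := congrArg Complex.im (mul_right_cancel₀ h0 hw)
    simp at this

theorem IsNonDegenerate.surjective {f : MixedPolynomial} (hf : IsNonDegenerate f)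
    {Δ : Set (ℝ × ℝ)} (hΔ : IsCompactFace f Δ) {z : ℂ × ℂ} (hz : z ∈ torus)
    (h0 : evalAt (faceFunction f Δ) z = 0) :
    Function.Surjective (fderiv ℝ (evalAt (faceFunction f Δ)) z) := by
  by_contra hs
  have : z ∈ singularSet (faceFunction f Δ) ∩ zeroSet (faceFunction f Δ) ∩ torus :=
    ⟨⟨hs, h0⟩, hz⟩
  rw [hf Δ hΔ] at this
  exact this

theorem differentiable_vertexFunction (f : MixedPolynomial) (i : ℕ) :
    Differentiable ℝ (evalAt (vertexFunction f i)) :=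
  (contDiff_evalAt_faceFunction f _).differentiable one_ne_zero

/-- For an inner vertex this is the Γ-nice condition. At an extreme vertex the function depends on
one variable only and is homogeneous in it under real scaling; at a zero, its derivative would kill
the other variable and the radial direction, so its rank would be at most one, against
non-degeneracy. -/
theorem evalAt_vertexFunction_ne_zero {f : MixedPolynomial} (hconv : IsConvenient f)
    (hnd : IsNonDegenerate f) (hnice : IsGammaNice f) {i : ℕ} (hi : i ≤ numEdges f) {z : ℂ × ℂ}
    (hz : z ∈ torus) : evalAt (vertexFunction f i) z ≠ 0 := by
  intro h0
  obtain ⟨u, v⟩ := z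
  have hface : IsCompactFace f {toPlane (vertex f i)} :=
    (isVertex_of_lt_length (lt_length_of_le_numEdges hconv hi)).2
  have hsurj := hnd.surjective hface hz h0
  have hdiff := differentiable_vertexFunction f i (u, v)
  change Function.Surjective (fderiv ℝ (evalAt (vertexFunction f i)) (u, v)) at hsurj
  set T := fderiv ℝ (evalAt (vertexFunction f i)) (u, v) with hT
  have hTu : T (u, 0) = 0 := by
    refine fderiv_eq_zero_of_curve hdiff (c := fun x : ℝ => ((x : ℂ) * u, v)) (s := 1)
      (HasDerivAt.prodMk ?_ (hasDerivAt_const _ _)) (by simp) fun x => ?_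
    · simpa using (Complex.ofRealCLM.hasDerivAt (x := 1)).mul_const u
    · have := evalAt_vertexFunction_smul f i x 1 u v
      simp only [Complex.ofReal_one, one_mul] at this
      rw [this, h0, mul_zero]
  have hTv : T (0, v) = 0 := by
    refine fderiv_eq_zero_of_curve hdiff (c := fun x : ℝ => (u, (x : ℂ) * v)) (s := 1)
      (HasDerivAt.prodMk (hasDerivAt_const _ _) ?_) (by simp) fun x => ?_
    · simpa using (Complex.ofRealCLM.hasDerivAt (x := 1)).mul_const v
    · have := evalAt_vertexFunction_smul f i 1 x u v
      simp only [Complex.ofReal_one, one_mul] at this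
      rw [this, h0, mul_zero]
  have hline : ∀ w : ℂ, HasDerivAt (fun x : ℝ => (x : ℂ) * w) w 0 := fun w => by
    simpa using (Complex.ofRealCLM.hasDerivAt (x := 0)).mul_const w
  by_cases hi0 : i = 0
  · subst hi0
    have hT1 : ∀ w, T (w, 0) = 0 := fun w =>
      fderiv_eq_zero_of_curve hdiff (c := fun x : ℝ => (u + (x : ℂ) * w, v)) (s := 0)
        (((hline w).const_add u).prodMk (hasDerivAt_const _ _)) (by simp)
        fun x => evalAt_vertexFunction_of_fst_eq_zero (vertex_zero_fst hconv) _ _ _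
    refine not_surjective_of_ofReal_mul (T := T.comp (ContinuousLinearMap.inr ℝ ℂ ℂ)) hz.2
      (by simpa using hTv) fun w => ?_
    obtain ⟨⟨a, b⟩, hab⟩ := hsurj w
    refine ⟨b, ?_⟩
    rw [← hab, show (a, b) = (a, 0) + (0, b) by simp, map_add, hT1, zero_add]
    rfl
  by_cases hiN : i = numEdges f
  · subst hiN
    have hT1 : ∀ w, T (0, w) = 0 := fun w =>
      fderiv_eq_zero_of_curve hdiff (c := fun x : ℝ => (u, v + (x : ℂ) * w)) (s := 0)
        ((hasDerivAt_const _ _).prodMk ((hline w).const_add v)) (by simp)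
        fun x => evalAt_vertexFunction_of_snd_eq_zero (vertex_numEdges_snd hconv) _ _ _
    refine not_surjective_of_ofReal_mul (T := T.comp (ContinuousLinearMap.inl ℝ ℂ ℂ)) hz.1
      (by simpa using hTu) fun w => ?_
    obtain ⟨⟨a, b⟩, hab⟩ := hsurj w
    refine ⟨a, ?_⟩
    rw [← hab, show (a, b) = (a, 0) + (0, b) by simp, map_add, hT1, add_zero]
    rfl
  · have : (u, v) ∈ zeroSet (vertexFunction f i) ∩ torus := ⟨h0, hz⟩
    rw [hnice i (by omega) (by omega)] at this
    exact this

/-! ### Multiplicities with sign of the functions of the vertices -/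

theorem exp_mul_I_periodic : Function.Periodic (fun x : ℝ => Complex.exp ((x : ℂ) * Complex.I))
    (2 * Real.pi) := fun x => by
  push_cast
  rw [add_mul, Complex.exp_periodic]

theorem exp_mem_torus (x y : ℝ) :
    (Complex.exp ((x : ℂ) * Complex.I), Complex.exp ((y : ℂ) * Complex.I)) ∈ torus :=
  ⟨Complex.exp_ne_zero _, Complex.exp_ne_zero _⟩

theorem HasSignedMultiplicity.signedMultiplicity_eq {h : ℂ → ℂ} {α : ℂ} {n : ℤ}
    (H : HasSignedMultiplicity h α n) : signedMultiplicity h α = n := by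
  have hex : ∃ n, HasSignedMultiplicity h α n := ⟨n, H⟩
  rw [signedMultiplicity, dif_pos hex]
  obtain ⟨r, h1, h2⟩ := (hex.choose_spec.and H).exists
  rw [hasCircleDegree_iff] at h1 h2
  exact h1.unique h2

/-- Without zeros on the torus, the degree is constant in `t` by homotopy. By homogeneity in `u`,
all circles about `0` give the degree of the unit circle. -/
theorem exists_signedMultiplicity_vertexPolyU {f : MixedPolynomial} (hconv : IsConvenient f)
    (hnd : IsNonDegenerate f) (hnice : IsGammaNice f) {i : ℕ} (hi : i ≤ numEdges f) :
    ∃ n : ℤ, ∀ t : ℝ, HasSignedMultiplicity (vertexPolyU f i t) 0 n ∧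
      HasLoopDegree (fun x : ℝ => vertexPolyU f i t (Complex.exp (x * Complex.I))) n := by
  have hc := (differentiable_vertexFunction f i).continuous
  have h0 := fun t x : ℝ => evalAt_vertexFunction_ne_zero hconv hnd hnice hi (exp_mem_torus x t)
  have hp : ∀ t : ℝ, Function.Periodic
      (fun x : ℝ => vertexPolyU f i t (Complex.exp (x * Complex.I))) (2 * Real.pi) :=
    fun t => exp_mul_I_periodic.comp (vertexPolyU f i t)
  obtain ⟨n, hn⟩ := exists_hasLoopDegree
    (γ := fun x : ℝ => vertexPolyU f i 0 (Complex.exp (x * Complex.I)))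
    (hc.comp (by fun_prop)) (by simp) (h0 0)
  refine ⟨n, fun t => ?_⟩
  have ht : HasLoopDegree (fun x : ℝ => vertexPolyU f i t (Complex.exp (x * Complex.I))) n :=
    hn.of_homotopy (H := fun t x : ℝ => vertexPolyU f i t (Complex.exp (x * Complex.I)))
      (hc.comp (by fun_prop)) hp h0
  refine ⟨?_, ht⟩
  filter_upwards [self_mem_nhdsWithin] with r hr
  rw [hasCircleDegree_iff]
  convert ht.real_smul (pow_pos (Set.mem_Ioi.1 hr) (vertex f i).1) using 2 with x
  have := evalAt_vertexFunction_smul f i r 1 (Complex.exp (x * Complex.I))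
    (Complex.exp (t * Complex.I))
  simpa [vertexPolyU, circleMap] using this

theorem exists_signedMultiplicity_vertexPolyV {f : MixedPolynomial} (hconv : IsConvenient f)
    (hnd : IsNonDegenerate f) (hnice : IsGammaNice f) {i : ℕ} (hi : i ≤ numEdges f) :
    ∃ n : ℤ, ∀ φ : ℝ, HasSignedMultiplicity (vertexPolyV f i φ) 0 n ∧
      HasLoopDegree (fun x : ℝ => vertexPolyV f i φ (Complex.exp (x * Complex.I))) n := by
  have hc := (differentiable_vertexFunction f i).continuous
  have h0 := fun φ x : ℝ => evalAt_vertexFunction_ne_zero hconv hnd hnice hi (exp_mem_torus φ x)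
  have hp : ∀ φ : ℝ, Function.Periodic
      (fun x : ℝ => vertexPolyV f i φ (Complex.exp (x * Complex.I))) (2 * Real.pi) :=
    fun φ => exp_mul_I_periodic.comp (vertexPolyV f i φ)
  obtain ⟨n, hn⟩ := exists_hasLoopDegree
    (γ := fun x : ℝ => vertexPolyV f i 0 (Complex.exp (x * Complex.I)))
    (hc.comp (by fun_prop)) (by simp) (h0 0)
  refine ⟨n, fun φ => ?_⟩
  have ht : HasLoopDegree (fun x : ℝ => vertexPolyV f i φ (Complex.exp (x * Complex.I))) n :=
    hn.of_homotopy (H := fun φ x : ℝ => vertexPolyV f i φ (Complex.exp (x * Complex.I)))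
      (hc.comp (by fun_prop)) hp h0
  refine ⟨?_, ht⟩
  filter_upwards [self_mem_nhdsWithin] with r hr
  rw [hasCircleDegree_iff]
  convert ht.real_smul (pow_pos (Set.mem_Ioi.1 hr) (vertex f i).2) using 2 with x
  have := evalAt_vertexFunction_smul f i 1 r (Complex.exp (φ * Complex.I))
    (Complex.exp (x * Complex.I))
  simpa [vertexPolyV, circleMap] using this

/-- The leftmost vertex lies on the vertical axis, so its function does not involve `u` and the loop
is constant. -/
theorem signedMultiplicity_vertexPolyU_zero {f : MixedPolynomial} (hconv : IsConvenient f)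
    (hnd : IsNonDegenerate f) (hnice : IsGammaNice f) (t : ℝ) :
    signedMultiplicity (vertexPolyU f 0 t) 0 = 0 := by
  obtain ⟨n, hn⟩ := exists_signedMultiplicity_vertexPolyU hconv hnd hnice (Nat.zero_le _)
  rw [(hn t).1.signedMultiplicity_eq]
  refine (hn t).2.unique ?_
  have h0 := evalAt_vertexFunction_ne_zero hconv hnd hnice (Nat.zero_le _) (exp_mem_torus 0 t)
  convert hasLoopDegree_const h0 using 2
  exact evalAt_vertexFunction_of_fst_eq_zero (vertex_zero_fst hconv) _ _ _

theorem signedMultiplicity_vertexPolyV_numEdges {f : MixedPolynomial} (hconv : IsConvenient f)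
    (hnd : IsNonDegenerate f) (hnice : IsGammaNice f) (φ : ℝ) :
    signedMultiplicity (vertexPolyV f (numEdges f) φ) 0 = 0 := by
  obtain ⟨n, hn⟩ := exists_signedMultiplicity_vertexPolyV hconv hnd hnice (le_refl (numEdges f))
  rw [(hn φ).1.signedMultiplicity_eq]
  refine (hn φ).2.unique ?_
  have h0 := evalAt_vertexFunction_ne_zero hconv hnd hnice le_rfl (exp_mem_torus φ 0)
  convert hasLoopDegree_const h0 using 2
  exact evalAt_vertexFunction_of_snd_eq_zero (vertex_numEdges_snd hconv) _ _ _

/-! ### Asymptotics of the functions of the 1-faces -/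

/-- The product of the unit circles. -/
def unitTorus : Set (ℂ × ℂ) := {z | ‖z.1‖ = 1 ∧ ‖z.2‖ = 1}

theorem isCompact_unitTorus : IsCompact unitTorus := by
  have : unitTorus = Metric.sphere (0 : ℂ) 1 ×ˢ Metric.sphere (0 : ℂ) 1 := by
    ext z; simp [unitTorus]
  rw [this]
  exact (isCompact_sphere _ _).prod (isCompact_sphere _ _)

/-- By compactness of the torus, non-vanishing at parameter `0` persists on an interval, and there
the parameter is a homotopy of loops. -/
theorem exists_forall_ne_zero_and_degree {K : ℝ × (ℂ × ℂ) → ℂ} (hK : Continuous K)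
    (h0 : ∀ z ∈ unitTorus, K (0, z) ≠ 0) :
    ∃ r₀ > 0, ∀ r, 0 ≤ r → r ≤ r₀ → (∀ z ∈ unitTorus, K (r, z) ≠ 0) ∧
      ∀ c : ℝ → ℂ × ℂ, Continuous c → Function.Periodic c (2 * Real.pi) →
        (∀ x, c x ∈ unitTorus) → ∀ n, HasLoopDegree (fun x => K (0, c x)) n →
          HasLoopDegree (fun x => K (r, c x)) n := by
  have h1 : ∀ᶠ r in 𝓝 (0 : ℝ), ∀ z ∈ unitTorus, K (r, z) ≠ 0 :=
    isCompact_unitTorus.eventually_forall_of_forall_eventually fun z hz =>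
      hK.continuousAt.eventually_ne (h0 z hz)
  obtain ⟨δ, hδ, hball⟩ := Metric.eventually_nhds_iff_ball.1 h1
  have hne : ∀ r, 0 ≤ r → r ≤ δ / 2 → ∀ z ∈ unitTorus, K (r, z) ≠ 0 := fun r hr hr' =>
    hball r (by rw [Metric.mem_ball, Real.dist_0_eq_abs, abs_of_nonneg hr]; linarith)
  refine ⟨δ / 2, half_pos hδ, fun r hr hr' => ⟨hne r hr hr', fun c hc hp hcT n hn => ?_⟩⟩
  have : PreconnectedSpace (Set.Icc 0 (δ / 2)) :=
    Subtype.preconnectedSpace isPreconnected_Icc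
  exact HasLoopDegree.of_homotopy (X := Set.Icc 0 (δ / 2)) (H := fun s x => K (s, c x))
    (hK.comp (by fun_prop)) (fun s => hp.comp fun z => K (s, z))
    (fun s x => hne s s.2.1 s.2.2 _ (hcT x)) (a := ⟨0, le_rfl, by positivity⟩)
    (b := ⟨r, hr, hr'⟩) hn

theorem fst_eq_imp_of_mem_segment {p q x : ℝ × ℝ} (hpq : p.1 < q.1) (hx : x ∈ segment ℝ p q) :
    p.1 ≤ x.1 ∧ x.1 ≤ q.1 ∧ (x.1 = p.1 → x = p) ∧ (x.1 = q.1 → x = q) := by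
  obtain ⟨a, b, ha, hb, hab, rfl⟩ := hx
  have hb' : b = 1 - a := by linarith
  subst hb'
  have h1 : (a • p + (1 - a) • q).1 = p.1 + (1 - a) * (q.1 - p.1) := by
    simp only [Prod.fst_add, Prod.smul_fst, smul_eq_mul]; ring
  have h2 : p.1 + (1 - a) * (q.1 - p.1) = q.1 - a * (q.1 - p.1) := by ring
  have h3 : 0 < q.1 - p.1 := sub_pos.2 hpq
  refine ⟨?_, ?_, fun h => ?_, fun h => ?_⟩
  · rw [h1]
    have := mul_nonneg hb h3.le
    linarith
  · rw [h1, h2]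
    have := mul_nonneg ha h3.le
    linarith
  · rw [h1, add_eq_left, mul_eq_zero] at h
    have h4 : a = 1 := by linarith [h.resolve_right h3.ne']
    simp [h4]
  · rw [h1, h2, sub_eq_self, mul_eq_zero] at h
    have h4 := h.resolve_right h3.ne'
    simp [h4]

theorem vertex_pred_lt {f : MixedPolynomial} (hconv : IsConvenient f) {i : ℕ} (hi : 1 ≤ i)
    (hiN : i ≤ numEdges f) : (vertex f (i - 1)).1 < (vertex f i).1 :=
  vertex_fst_lt (by omega) (lt_length_of_le_numEdges hconv hiN)

/-- An edge is not vertical, so the degree in `u` alone places a term on it; the two extreme degrees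
single out the vertex functions. -/
theorem bidegree_of_mem_faceSupport_edge {f : MixedPolynomial} (hconv : IsConvenient f) {i : ℕ}
    (hi : 1 ≤ i) (hiN : i ≤ numEdges f) {m : Fin 4 →₀ ℕ} (hm : m ∈ faceSupport f (edge f i)) :
    (vertex f (i - 1)).1 ≤ (bidegree m).1 ∧ (bidegree m).1 ≤ (vertex f i).1 ∧
      ((bidegree m).1 = (vertex f (i - 1)).1 → bidegree m = vertex f (i - 1)) ∧
      ((bidegree m).1 = (vertex f i).1 → bidegree m = vertex f i) := by
  obtain ⟨h1, h2, h3, h4⟩ := fst_eq_imp_of_mem_segment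
    (by simpa [toPlane] using vertex_pred_lt hconv hi hiN) (mem_faceSupport.1 hm).2
  refine ⟨by simpa [toPlane] using h1, by simpa [toPlane] using h2, fun h => ?_, fun h => ?_⟩
  · exact toPlane_injective (h3 (by simp [toPlane, h]))
  · exact toPlane_injective (h4 (by simp [toPlane, h]))

/-- Since `0 ^ 0 = 1`, exactly the terms with `d m = 0` survive at parameter `0`. -/
theorem sum_zero_pow_eq_vertexFunction {f : MixedPolynomial} {i j : ℕ}
    (hsub : toPlane (vertex f j) ∈ edge f i) {d : (Fin 4 →₀ ℕ) → ℕ}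
    (hd : ∀ m ∈ faceSupport f (edge f i), d m = 0 ↔ bidegree m = vertex f j) (z : ℂ × ℂ) :
    ∑ m ∈ faceSupport f (edge f i), f.coeff m * ((0 : ℝ) : ℂ) ^ d m * mono m z =
      evalAt (vertexFunction f j) z := by
  rw [vertexFunction, evalAt_faceFunction]
  symm
  refine Finset.sum_subset_zero_on_sdiff (fun m hm => ?_) (fun m hm => ?_) fun m hm => ?_
  · rw [mem_faceSupport] at hm ⊢
    exact ⟨hm.1, by rw [Set.mem_singleton_iff.1 hm.2]; exact hsub⟩
  · rw [Finset.mem_sdiff] at hm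
    have : d m ≠ 0 := fun h => hm.2 (mem_faceSupport.2
      ⟨(mem_faceSupport.1 hm.1).1, by rw [(hd m hm.1).1 h]; rfl⟩)
    simp [this]
  · have hm' : m ∈ faceSupport f (edge f i) := by
      rw [mem_faceSupport] at hm ⊢
      exact ⟨hm.1, by rw [Set.mem_singleton_iff.1 hm.2]; exact hsub⟩
    simp [(hd m hm').2 (bidegree_of_mem_faceSupport_vertex hm)]

theorem continuous_sum_pow_mono (f : MixedPolynomial) (s : Finset (Fin 4 →₀ ℕ))
    (d : (Fin 4 →₀ ℕ) → ℕ) :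
    Continuous fun p : ℝ × (ℂ × ℂ) => ∑ m ∈ s, f.coeff m * (p.1 : ℂ) ^ d m * mono m p.2 := by
  refine continuous_finsetSum _ fun m _ => ?_
  have := (contDiff_mono m).continuous
  fun_prop

/-- For small `|u|`, the function of a 1-face is dominated by its left vertex. -/
theorem edge_degree_small {f : MixedPolynomial} (hconv : IsConvenient f)
    (hnd : IsNonDegenerate f) (hnice : IsGammaNice f) {i : ℕ} (hi : 1 ≤ i)
    (hiN : i ≤ numEdges f) :
    ∃ r₀ > 0, ∀ r : ℝ, 0 < r → r ≤ r₀ →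
      (∀ z ∈ unitTorus, evalAt (faceFunction f (edge f i)) ((r : ℂ) * z.1, z.2) ≠ 0) ∧
      ∀ c : ℝ → ℂ × ℂ, Continuous c → Function.Periodic c (2 * Real.pi) →
        (∀ x, c x ∈ unitTorus) → ∀ n,
        HasLoopDegree (fun x => evalAt (vertexFunction f (i - 1)) (c x)) n →
        HasLoopDegree
          (fun x => evalAt (faceFunction f (edge f i)) ((r : ℂ) * (c x).1, (c x).2)) n := by
  -- After division by the lowest power of `r`, the function of the edge extends continuously to `r
  -- = 0`, with the function of the left vertex as its value there.
  set d : (Fin 4 →₀ ℕ) → ℕ := fun m => (bidegree m).1 - (vertex f (i - 1)).1 with hd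
  set K : ℝ × (ℂ × ℂ) → ℂ := fun p =>
    ∑ m ∈ faceSupport f (edge f i), f.coeff m * (p.1 : ℂ) ^ d m * mono m p.2 with hK
  have hKg : ∀ (r : ℝ) (z : ℂ × ℂ), evalAt (faceFunction f (edge f i)) ((r : ℂ) * z.1, z.2) =
      ((r ^ (vertex f (i - 1)).1 : ℝ) : ℂ) * K (r, z) := by
    intro r z
    rw [evalAt_faceFunction, hK, Finset.mul_sum]
    refine Finset.sum_congr rfl fun m hm => ?_
    have h1 := mono_real_smul m r 1 z.1 z.2
    have h2 := (bidegree_of_mem_faceSupport_edge hconv hi hiN hm).1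
    simp only [Complex.ofReal_one, one_mul, one_pow, mul_one] at h1
    rw [h1, ← Nat.add_sub_cancel' h2, pow_add]
    push_cast
    simp only [hd]
    ring
  have hK0 : ∀ z, K (0, z) = evalAt (vertexFunction f (i - 1)) z := by
    refine fun z => sum_zero_pow_eq_vertexFunction (left_mem_segment ℝ _ _) (fun m hm => ?_) z
    obtain ⟨h1, -, h2, -⟩ := bidegree_of_mem_faceSupport_edge hconv hi hiN hm
    exact ⟨fun h => h2 (le_antisymm (Nat.sub_eq_zero_iff_le.1 h) h1), fun h => by simp [hd, h]⟩
  obtain ⟨r₀, hr₀, H⟩ := exists_forall_ne_zero_and_degree (continuous_sum_pow_mono f _ d)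
    (fun z hz => by
      change K (0, z) ≠ 0
      rw [hK0]
      exact evalAt_vertexFunction_ne_zero hconv hnd hnice (by omega)
        ⟨norm_ne_zero_iff.1 (hz.1 ▸ one_ne_zero), norm_ne_zero_iff.1 (hz.2 ▸ one_ne_zero)⟩)
  refine ⟨r₀, hr₀, fun r hr hr' => ?_⟩
  obtain ⟨H1, H2⟩ := H r hr.le hr'
  have hpow : 0 < r ^ (vertex f (i - 1)).1 := pow_pos hr _
  refine ⟨fun z hz => ?_, fun c hc hp hcT n hn => ?_⟩
  · rw [hKg]
    exact mul_ne_zero (by exact_mod_cast hpow.ne') (H1 z hz)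
  · simp_rw [hKg]
    refine (H2 c hc hp hcT n ?_).real_smul hpow
    change HasLoopDegree (fun x => K (0, c x)) n
    simpa only [hK0] using hn

/-- For large `|u|`, the function of a 1-face is dominated by its right vertex. -/
theorem edge_degree_large {f : MixedPolynomial} (hconv : IsConvenient f)
    (hnd : IsNonDegenerate f) (hnice : IsGammaNice f) {i : ℕ} (hi : 1 ≤ i)
    (hiN : i ≤ numEdges f) :
    ∃ R₀ > 0, ∀ r : ℝ, R₀ ≤ r →
      (∀ z ∈ unitTorus, evalAt (faceFunction f (edge f i)) ((r : ℂ) * z.1, z.2) ≠ 0) ∧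
      ∀ c : ℝ → ℂ × ℂ, Continuous c → Function.Periodic c (2 * Real.pi) →
        (∀ x, c x ∈ unitTorus) → ∀ n,
        HasLoopDegree (fun x => evalAt (vertexFunction f i) (c x)) n →
        HasLoopDegree
          (fun x => evalAt (faceFunction f (edge f i)) ((r : ℂ) * (c x).1, (c x).2)) n := by
  -- After division by the highest power of `r`, the rest is a polynomial in `r⁻¹`, so large `r` is
  -- treated as a parameter near `0`.
  set d : (Fin 4 →₀ ℕ) → ℕ := fun m => (vertex f i).1 - (bidegree m).1 with hd
  set K : ℝ × (ℂ × ℂ) → ℂ := fun p =>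
    ∑ m ∈ faceSupport f (edge f i), f.coeff m * (p.1 : ℂ) ^ d m * mono m p.2 with hK
  have hKg : ∀ (r : ℝ) (z : ℂ × ℂ), 0 < r →
      evalAt (faceFunction f (edge f i)) ((r : ℂ) * z.1, z.2) =
      ((r ^ (vertex f i).1 : ℝ) : ℂ) * K (r⁻¹, z) := by
    intro r z hr
    rw [evalAt_faceFunction, hK, Finset.mul_sum]
    refine Finset.sum_congr rfl fun m hm => ?_
    have h1 := mono_real_smul m r 1 z.1 z.2
    have h2 := (bidegree_of_mem_faceSupport_edge hconv hi hiN hm).2.1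
    have h3 : (r : ℂ) ≠ 0 := by exact_mod_cast hr.ne'
    simp only [Complex.ofReal_one, one_mul, one_pow, mul_one] at h1
    have h4 : (r : ℂ) ^ (vertex f i).1 = (r : ℂ) ^ (bidegree m).1 * (r : ℂ) ^ d m := by
      rw [← pow_add, hd, Nat.add_sub_cancel' h2]
    rw [h1]
    push_cast
    rw [h4, inv_pow]
    field_simp
  have hK0 : ∀ z, K (0, z) = evalAt (vertexFunction f i) z := by
    refine fun z => sum_zero_pow_eq_vertexFunction (right_mem_segment ℝ _ _) (fun m hm => ?_) z
    obtain ⟨-, h1, -, h2⟩ := bidegree_of_mem_faceSupport_edge hconv hi hiN hm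
    exact ⟨fun h => h2 (le_antisymm h1 (Nat.sub_eq_zero_iff_le.1 h)), fun h => by simp [hd, h]⟩
  obtain ⟨r₀, hr₀, H⟩ := exists_forall_ne_zero_and_degree (continuous_sum_pow_mono f _ d)
    (fun z hz => by
      change K (0, z) ≠ 0
      rw [hK0]
      exact evalAt_vertexFunction_ne_zero hconv hnd hnice hiN
        ⟨norm_ne_zero_iff.1 (hz.1 ▸ one_ne_zero), norm_ne_zero_iff.1 (hz.2 ▸ one_ne_zero)⟩)
  refine ⟨r₀⁻¹, inv_pos.2 hr₀, fun r hr' => ?_⟩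
  have hr : 0 < r := (inv_pos.2 hr₀).trans_le hr'
  obtain ⟨H1, H2⟩ := H r⁻¹ (inv_nonneg.2 hr.le) (inv_le_of_inv_le₀ hr₀ hr')
  have hpow : 0 < r ^ (vertex f i).1 := pow_pos hr _
  refine ⟨fun z hz => ?_, fun c hc hp hcT n hn => ?_⟩
  · rw [hKg r z hr]
    exact mul_ne_zero (by exact_mod_cast hpow.ne') (H1 z hz)
  · simp_rw [fun x => hKg r (c x) hr]
    refine (H2 c hc hp hcT n ?_).real_smul hpow
    change HasLoopDegree (fun x => K (0, c x)) n
    simpa only [hK0] using hn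

/-! ### Regularity of the links of the 1-faces -/

theorem hasDerivAt_exp_mul_I (t : ℝ) :
    HasDerivAt (fun x : ℝ => Complex.exp ((x : ℂ) * Complex.I))
      (Complex.I * Complex.exp ((t : ℂ) * Complex.I)) t := by
  have h := ((Complex.ofRealCLM.hasDerivAt (x := t)).mul_const Complex.I).cexp
  simpa [mul_comm] using h

/-- The derivative of `(u, t) ↦ (u, e^{it})`. -/
theorem hasFDerivAt_cylinder (q : ℂ × ℝ) :
    HasFDerivAt (fun q : ℂ × ℝ => (q.1, Complex.exp ((q.2 : ℂ) * Complex.I)))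
      ((ContinuousLinearMap.fst ℝ ℂ ℝ).prod
        ((ContinuousLinearMap.toSpanSingleton ℝ
          (Complex.I * Complex.exp ((q.2 : ℂ) * Complex.I))).comp
            (ContinuousLinearMap.snd ℝ ℂ ℝ))) q :=
  hasFDerivAt_fst.prodMk
    (HasFDerivAt.comp (g := fun x : ℝ => Complex.exp ((x : ℂ) * Complex.I)) q
      (hasDerivAt_exp_mul_I q.2).hasFDerivAt hasFDerivAt_snd)

theorem fderiv_edgeMap (f : MixedPolynomial) (i : ℕ) (q σ : ℂ × ℝ) :
    fderiv ℝ (edgeMap f i) q σ =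
      fderiv ℝ (evalAt (faceFunction f (edge f i))) (q.1, Complex.exp ((q.2 : ℂ) * Complex.I))
        (σ.1, (σ.2 : ℂ) * (Complex.I * Complex.exp ((q.2 : ℂ) * Complex.I))) := by
  have hg := ((contDiff_evalAt_faceFunction f (edge f i)).differentiable one_ne_zero
    (q.1, Complex.exp ((q.2 : ℂ) * Complex.I))).hasFDerivAt
  have h := (HasFDerivAt.comp (g := evalAt (faceFunction f (edge f i))) q hg
    (hasFDerivAt_cylinder q)).fderiv
  have h' : fderiv ℝ (edgeMap f i) q σ = _ := congrArg (fun T : ℂ × ℝ →L[ℝ] ℂ => T σ) h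
  rw [h']
  simp

theorem contDiff_edgeMap (f : MixedPolynomial) (i : ℕ) : ContDiff ℝ 1 (edgeMap f i) := by
  have hc : ContDiff ℝ 1 (fun q : ℂ × ℝ => (q.1, Complex.exp ((q.2 : ℂ) * Complex.I))) :=
    contDiff_fst.prodMk (((Complex.ofRealCLM.contDiff.comp contDiff_snd).mul contDiff_const).cexp)
  exact (contDiff_evalAt_faceFunction f (edge f i)).comp hc

/-- The function of a 1-face is weighted homogeneous with positive weights. -/
theorem exists_weights_edge {f : MixedPolynomial} (hconv : IsConvenient f) {i : ℕ} (hi : 1 ≤ i)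
    (hiN : i ≤ numEdges f) :
    ∃ P Q d : ℕ, 0 < P ∧ 0 < Q ∧ ∀ (x : ℝ) (u v : ℂ),
      evalAt (faceFunction f (edge f i)) (((x ^ P : ℝ) : ℂ) * u, ((x ^ Q : ℝ) : ℂ) * v) =
        (x : ℂ) ^ d * evalAt (faceFunction f (edge f i)) (u, v) := by
  have h1 := lt_length_of_le_numEdges hconv hiN
  have h0 : i - 1 < (vertexList f).length := by omega
  have hlt := vertex_pred_lt hconv hi hiN
  have hlt2 := (isVertex_of_lt_length h0).snd_lt_of_fst_lt (isVertex_of_lt_length h1) hlt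
  set p := vertex f (i - 1) with hp
  set q := vertex f i with hq
  -- The weights are the inner normal of the edge, and `d` is its constant value on the edge. Both
  -- entries are positive because the vertices descend strictly from left to right.
  refine ⟨p.2 - q.2, q.1 - p.1, (p.2 - q.2) * p.1 + (q.1 - p.1) * p.2, by omega, by omega, ?_⟩
  intro x u v
  rw [evalAt_faceFunction, evalAt_faceFunction, Finset.mul_sum]
  refine Finset.sum_congr rfl fun m hm => ?_
  rw [mono_real_smul]
  have hd : (p.2 - q.2) * (bidegree m).1 + (q.1 - p.1) * (bidegree m).2 =
      (p.2 - q.2) * p.1 + (q.1 - p.1) * p.2 := by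
    obtain ⟨c, c', -, -, hcc, hseg⟩ := (mem_faceSupport.1 hm).2
    have e1 := congrArg Prod.fst hseg
    have e2 := congrArg Prod.snd hseg
    simp only [toPlane, Prod.fst_add, Prod.snd_add, Prod.smul_fst, Prod.smul_snd, smul_eq_mul,
      ← hp, ← hq] at e1 e2
    have : (((p.2 - q.2 : ℕ) : ℝ)) * (bidegree m).1 + ((q.1 - p.1 : ℕ) : ℝ) * (bidegree m).2 =
        ((p.2 - q.2 : ℕ) : ℝ) * p.1 + ((q.1 - p.1 : ℕ) : ℝ) * p.2 := by
      rw [← e1, ← e2, Nat.cast_sub hlt2.le, Nat.cast_sub hlt.le]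
      linear_combination (((p.2 : ℝ) - q.2) * p.1 + ((q.1 : ℝ) - p.1) * p.2) * hcc
    exact_mod_cast this
  rw [← hd]
  push_cast
  ring

/-- Non-degeneracy gives surjectivity on all of `ℂ²`. By weighted homogeneity the Euler vector `(P
u, Q v)` is in the kernel at a zero, and it is transverse to `|v| = 1` as `Q > 0`; hence the
restriction to `ℂ × S¹` is still surjective. -/
theorem surjective_fderiv_edgeMap {f : MixedPolynomial} (hconv : IsConvenient f)
    (hnd : IsNonDegenerate f) {i : ℕ} (hi : 1 ≤ i) (hiN : i ≤ numEdges f) {q : ℂ × ℝ}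
    (hq : q.1 ≠ 0) (h0 : edgeMap f i q = 0) : Function.Surjective (fderiv ℝ (edgeMap f i) q) := by
  set v := Complex.exp ((q.2 : ℂ) * Complex.I) with hv
  have hv0 : v ≠ 0 := Complex.exp_ne_zero _
  have hs := hnd.surjective (isCompactFace_edge hconv hi hiN) (z := (q.1, v)) ⟨hq, hv0⟩ h0
  obtain ⟨P, Q, d, -, hQ, hhom⟩ := exists_weights_edge hconv hi hiN
  have hQ' : (Q : ℝ) ≠ 0 := by exact_mod_cast hQ.ne'
  have hgd := (contDiff_evalAt_faceFunction f (edge f i)).differentiable one_ne_zero (q.1, v)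
  set T := fderiv ℝ (evalAt (faceFunction f (edge f i))) (q.1, v) with hT
  have hpow : ∀ (n : ℕ) (w : ℂ), HasDerivAt (fun x : ℝ => ((x ^ n : ℝ) : ℂ) * w) (n * w) 1 := by
    intro n w
    simpa using (((hasDerivAt_pow n (1 : ℝ)).ofReal_comp).mul_const w)
  have hEuler : T ((P : ℂ) * q.1, (Q : ℂ) * v) = 0 := by
    refine fderiv_eq_zero_of_curve hgd (s := 1) ((hpow P q.1).prodMk (hpow Q v)) (by simp)
      fun x => ?_
    rw [hhom, show evalAt (faceFunction f (edge f i)) (q.1, v) = 0 from h0, mul_zero]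
  intro w
  obtain ⟨⟨a, b⟩, hab⟩ := hs w
  -- The multiple of the Euler vector that removes the radial part of `b` and leaves a vector
  -- tangent to `|v| = 1`.
  set lam : ℝ := (b / v).re / Q with hlam
  refine ⟨(a - lam * (P * q.1), (b / v).im), ?_⟩
  rw [fderiv_edgeMap, ← hab]
  have hsplit : ((a - lam * (P * q.1), ((b / v).im : ℂ) * (Complex.I * v)) : ℂ × ℂ) =
      (a, b) - lam • ((P : ℂ) * q.1, (Q : ℂ) * v) := by
    refine Prod.ext ?_ ?_
    · simp
    · have h1 : ((lam : ℝ) : ℂ) * Q = (b / v).re := by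
        rw [hlam]
        push_cast
        rw [div_mul_cancel₀]
        exact_mod_cast hQ.ne'
      have h2 : b = ((b / v).re + (b / v).im * Complex.I) * v := by
        rw [Complex.re_add_im, div_mul_cancel₀ _ hv0]
      simp only [Prod.snd_sub, Prod.smul_snd, Complex.real_smul]
      linear_combination (-1 : ℂ) * h2 + v * h1
  change T ((a - lam * (P * q.1), ((b / v).im : ℂ) * (Complex.I * v))) = T (a, b)
  rw [hsplit, map_sub, map_smul, hEuler, smul_zero, sub_zero]

/-! ### Logarithmic coordinates, and regular values of the arguments of `u` and `v` on the link -/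

/-- The map `(z, t) ↦ g_i(e^z, e^{it})`. -/
def edgeMapExp (f : MixedPolynomial) (i : ℕ) (q : ℂ × ℝ) : ℂ := edgeMap f i (Complex.exp q.1, q.2)

theorem contDiff_edgeMapExp (f : MixedPolynomial) (i : ℕ) : ContDiff ℝ 1 (edgeMapExp f i) :=
  (contDiff_edgeMap f i).comp ((contDiff_fst.cexp).prodMk contDiff_snd)

theorem fderiv_edgeMapExp (f : MixedPolynomial) (i : ℕ) (q σ : ℂ × ℝ) :
    fderiv ℝ (edgeMapExp f i) q σ =
      fderiv ℝ (edgeMap f i) (Complex.exp q.1, q.2) (Complex.exp q.1 * σ.1, σ.2) := by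
  have hg := ((contDiff_edgeMap f i).differentiable one_ne_zero
    (Complex.exp q.1, q.2)).hasFDerivAt
  have hE : HasFDerivAt (fun q : ℂ × ℝ => Complex.exp q.1)
      (Complex.exp q.1 • ContinuousLinearMap.fst ℝ ℂ ℝ) q := hasFDerivAt_fst.cexp
  have h := (HasFDerivAt.comp (g := edgeMap f i) q hg (hE.prodMk hasFDerivAt_snd)).fderiv
  have h' : fderiv ℝ (edgeMapExp f i) q σ = _ := congrArg (fun T : ℂ × ℝ →L[ℝ] ℂ => T σ) h
  rw [h']
  simp

theorem surjective_fderiv_edgeMapExp {f : MixedPolynomial} (hconv : IsConvenient f)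
    (hnd : IsNonDegenerate f) {i : ℕ} (hi : 1 ≤ i) (hiN : i ≤ numEdges f) {q : ℂ × ℝ}
    (h0 : edgeMapExp f i q = 0) : Function.Surjective (fderiv ℝ (edgeMapExp f i) q) := by
  intro w
  obtain ⟨σ, hσ⟩ := surjective_fderiv_edgeMap hconv hnd hi hiN
    (q := (Complex.exp q.1, q.2)) (Complex.exp_ne_zero _) h0 w
  refine ⟨((Complex.exp q.1)⁻¹ * σ.1, σ.2), ?_⟩
  rw [fderiv_edgeMapExp, ← hσ]
  simp [Complex.exp_ne_zero]

/-- The coordinate `t` matters only modulo `2π`, so a point over the disk `arg v = s` may be moved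
to `t = s` exactly. -/
theorem edgeMap_eq_of_exp_eq (f : MixedPolynomial) (i : ℕ) {q : ℂ × ℝ} {s : ℝ}
    (h : Complex.exp ((q.2 : ℂ) * Complex.I) = Complex.exp ((s : ℂ) * Complex.I)) :
    edgeMap f i (q.1, s) = edgeMap f i q ∧
      fderiv ℝ (edgeMap f i) (q.1, s) = fderiv ℝ (edgeMap f i) q := by
  refine ⟨by simp only [edgeMap, h], ?_⟩
  refine ContinuousLinearMap.ext fun σ => ?_
  rw [fderiv_edgeMap, fderiv_edgeMap]
  simp only [h]

/-- For almost every `s`, the disk `arg v = s` is transverse to the link of the 1-face. -/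
theorem ae_regular_arg_snd {f : MixedPolynomial} (hconv : IsConvenient f)
    (hnd : IsNonDegenerate f) {i : ℕ} (hi : 1 ≤ i) (hiN : i ≤ numEdges f) :
    ∀ᵐ s : ℝ, ∀ q : ℂ × ℝ, q.1 ≠ 0 → edgeMap f i q = 0 →
      Complex.exp ((q.2 : ℂ) * Complex.I) = Complex.exp ((s : ℂ) * Complex.I) →
      ∀ σ, fderiv ℝ (edgeMap f i) q σ = 0 → σ ≠ 0 → σ.2 ≠ 0 := by
  -- In the coordinate `z = log u` the condition `u ≠ 0` disappears: the zero set is a regular curve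
  -- in all of `ℂ × ℝ`.
  filter_upwards [ae_regular_value (contDiff_edgeMapExp f i)
    (fun q h => surjective_fderiv_edgeMapExp hconv hnd hi hiN h)
    (ContinuousLinearMap.snd ℝ ℂ ℝ)] with s hs q hq h0 hqs σ hσ hσ0
  obtain ⟨e1, e2⟩ := edgeMap_eq_of_exp_eq f i hqs
  refine hs (Complex.log q.1, s) ?_ rfl (q.1⁻¹ * σ.1, σ.2) ?_ fun h => hσ0 ?_
  · simp only [edgeMapExp, Complex.exp_log hq, e1, h0]
  · simp only [fderiv_edgeMapExp, Complex.exp_log hq, mul_inv_cancel_left₀ hq, e2]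
    exact hσ
  · simpa [hq, Prod.ext_iff] using h

/-- For almost every `s`, the disk `arg u = s` is transverse to the link of the 1-face. -/
theorem ae_regular_arg_fst {f : MixedPolynomial} (hconv : IsConvenient f)
    (hnd : IsNonDegenerate f) {i : ℕ} (hi : 1 ≤ i) (hiN : i ≤ numEdges f) :
    ∀ᵐ s : ℝ, ∀ q : ℂ × ℝ, q.1 ≠ 0 → edgeMap f i q = 0 →
      q.1 = (‖q.1‖ : ℂ) * Complex.exp ((s : ℂ) * Complex.I) →
      ∀ σ, fderiv ℝ (edgeMap f i) q σ = 0 → σ ≠ 0 → (q.1⁻¹ * σ.1).im ≠ 0 := by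
  filter_upwards [ae_regular_value (contDiff_edgeMapExp f i)
    (fun q h => surjective_fderiv_edgeMapExp hconv hnd hi hiN h)
    (Complex.imCLM.comp (ContinuousLinearMap.fst ℝ ℂ ℝ))] with s hs q hq h0 hqs σ hσ hσ0
  -- The branch of the logarithm of `u` with imaginary part exactly `s`, so that the argument of `u`
  -- becomes the linear function `Im z`.
  set z : ℂ := (Real.log ‖q.1‖ : ℂ) + (s : ℂ) * Complex.I with hz
  have hexp : Complex.exp z = q.1 := by
    rw [hz, Complex.exp_add, ← Complex.ofReal_exp, Real.exp_log (norm_pos_iff.2 hq), ← hqs]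
  refine hs (z, q.2) ?_ (by simp [hz]) (q.1⁻¹ * σ.1, σ.2) ?_ fun h => hσ0 ?_
  · simp only [edgeMapExp, hexp]
    exact h0
  · simp only [fderiv_edgeMapExp, hexp, mul_inv_cancel_left₀ hq]
    exact hσ
  · simpa [hq, Prod.ext_iff] using h

/-! ### Positive tangent vectors -/

theorem det3_eq (a b c : ℂ × ℝ) : det3 a b c =
    a.1.re * (b.1.im * c.2 - b.2 * c.1.im) - a.1.im * (b.1.re * c.2 - b.2 * c.1.re) +
      a.2 * (b.1.re * c.1.im - b.1.im * c.1.re) := by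
  simp [det3, Matrix.det_fin_three]
  ring

/-- A regular point of the zero set has a positive tangent vector, the cross product of the
gradients of the real and the imaginary part. -/
theorem exists_isPositiveTangent {G : ℂ × ℝ → ℂ} {q : ℂ × ℝ}
    (hs : Function.Surjective (fderiv ℝ G q)) : ∃ σ, IsPositiveTangent G q σ := by
  set T := fderiv ℝ G q with hT
  set X := T (1, 0) with hX
  set Y := T (Complex.I, 0) with hY
  set Z := T (0, 1) with hZ
  have hTn : ∀ n : ℂ × ℝ, T n = n.1.re • X + n.1.im • Y + n.2 • Z := by
    intro n
    have : n = n.1.re • ((1 : ℂ), (0 : ℝ)) + n.1.im • (Complex.I, (0 : ℝ)) +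
        n.2 • ((0 : ℂ), (1 : ℝ)) := by
      refine Prod.ext ?_ ?_
      · simp [Complex.re_add_im]
      · simp
    conv_lhs => rw [this, map_add, map_add, map_smul, map_smul, map_smul]
  set σ : ℂ × ℝ := (⟨Y.re * Z.im - Z.re * Y.im, Z.re * X.im - X.re * Z.im⟩,
    X.re * Y.im - Y.re * X.im) with hσ
  -- The cross product makes the two determinants equal, so positivity passes from one to the other;
  -- surjectivity enters only in `σ ≠ 0`.
  have key : ∀ n₁ n₂, det2 (T n₁) (T n₂) = det3 n₁ n₂ σ := by
    intro n₁ n₂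
    rw [det2_eq, det3_eq, hTn n₁, hTn n₂, hσ]
    simp
    ring
  refine ⟨σ, ?_, ?_, fun n₁ n₂ h => by rwa [key]⟩
  · intro h0
    obtain ⟨n₁, h1⟩ := hs 1
    obtain ⟨n₂, h2⟩ := hs Complex.I
    have := key n₁ n₂
    rw [h1, h2, h0, det3_eq, det2_eq] at this
    simp at this
  · rw [hTn, hσ]
    apply Complex.ext
    · simp
      ring
    · simp
      ring

/-! ### The shells of the sphere -/

/-- The inverse of `shellRadius`. -/
def shellInv (a b ρ : ℝ) : ℝ := (ρ - a) / (b - ρ)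

/-- The open shell `{(u, v) ∈ S³ | a < |u| < b}`. -/
def shell (a b : ℝ) : Set (ℂ × ℂ) := {p | p ∈ sphere3 ∧ a < ‖p.1‖ ∧ ‖p.1‖ < b}

/-- The inverse of the identification `shellMap`, with values in `ℂ × S¹`. -/
def unshell (a b : ℝ) (p : ℂ × ℂ) : ℂ × ℂ :=
  (((shellInv a b ‖p.1‖ / ‖p.1‖ : ℝ) : ℂ) * p.1, ((‖p.2‖⁻¹ : ℝ) : ℂ) * p.2)

/-- A local inverse of `shellMap`, with the argument of `v` close to `t`. -/
def shellLocalInv (a b t : ℝ) (p : ℂ × ℂ) : ℂ × ℝ :=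
  (((shellInv a b ‖p.1‖ / ‖p.1‖ : ℝ) : ℂ) * p.1,
    t + (Complex.log (p.2 * Complex.exp (((-t : ℝ) : ℂ) * Complex.I))).im)

section Shell

variable {a b : ℝ}

theorem shellRadius_mem (hab : a < b) {R : ℝ} (hR : 0 < R) :
    a < shellRadius a b R ∧ shellRadius a b R < b := by
  unfold shellRadius
  constructor
  · rw [lt_div_iff₀ (by positivity)]
    nlinarith
  · rw [div_lt_iff₀ (by positivity)]
    nlinarith

theorem shellInv_shellRadius (hab : a < b) {R : ℝ} (hR : 0 < R) :
    shellInv a b (shellRadius a b R) = R := by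
  have h1 : (1 + R) ≠ 0 := by positivity
  have h2 : b - a ≠ 0 := (sub_pos.2 hab).ne'
  have h3 : shellRadius a b R - a = R * (b - a) / (1 + R) := by
    unfold shellRadius; field_simp; ring
  have h4 : b - shellRadius a b R = (b - a) / (1 + R) := by
    unfold shellRadius; field_simp; ring
  rw [shellInv, h3, h4]
  field_simp

theorem shellRadius_shellInv (hab : a < b) {ρ : ℝ} (hρ : ρ < b) :
    shellRadius a b (shellInv a b ρ) = ρ := by
  have h1 : b - ρ ≠ 0 := (sub_pos.2 hρ).ne'
  have h2 : b - a ≠ 0 := (sub_pos.2 hab).ne'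
  have h3 : 1 + shellInv a b ρ = (b - a) / (b - ρ) := by
    unfold shellInv; field_simp; ring
  rw [shellRadius, h3, shellInv]
  field_simp
  ring

theorem shellInv_pos {ρ : ℝ} (h : a < ρ) (h' : ρ < b) : 0 < shellInv a b ρ :=
  div_pos (sub_pos.2 h) (sub_pos.2 h')

theorem shellInv_le {ρ R : ℝ} (hR : 0 < R) (h' : ρ < b) (h : ρ ≤ shellRadius a b R) :
    shellInv a b ρ ≤ R := by
  rw [shellRadius, le_div_iff₀ (by positivity)] at h
  rw [shellInv, div_le_iff₀ (sub_pos.2 h')]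
  linarith

theorem le_shellInv {ρ R : ℝ} (hR : 0 < R) (h' : ρ < b) (h : shellRadius a b R ≤ ρ) :
    R ≤ shellInv a b ρ := by
  rw [shellRadius, div_le_iff₀ (by positivity)] at h
  rw [shellInv, le_div_iff₀ (sub_pos.2 h')]
  linarith

theorem shellRadius_lt_shellRadius (hab : a < b) {r R : ℝ} (hr : 0 < r) (hrR : r < R) :
    shellRadius a b r < shellRadius a b R := by
  have hR := hr.trans hrR
  rw [shellRadius, shellRadius, div_lt_div_iff₀ (by positivity) (by positivity)]
  nlinarith

theorem norm_shellMap_fst (ha : 0 ≤ a) (hab : a < b) {q : ℂ × ℝ} (hq : q.1 ≠ 0) :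
    ‖(shellMap a b q).1‖ = shellRadius a b ‖q.1‖ := by
  have h1 := norm_pos_iff.2 hq
  have h2 := (shellRadius_mem hab h1).1
  rw [shellMap, norm_mul, Complex.norm_real, Real.norm_of_nonneg (div_nonneg (by linarith) h1.le),
    div_mul_cancel₀ _ h1.ne']

theorem one_sub_sq_pos (ha : 0 ≤ a) (hb : b ≤ 1) {ρ : ℝ} (h : a < ρ) (h' : ρ < b) :
    0 < 1 - ρ ^ 2 := by nlinarith

theorem shellMap_mem_shell (ha : 0 ≤ a) (hab : a < b) (hb : b ≤ 1) {q : ℂ × ℝ} (hq : q.1 ≠ 0) :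
    shellMap a b q ∈ shell a b := by
  have h1 := norm_pos_iff.2 hq
  have h2 := shellRadius_mem hab h1
  have h3 := norm_shellMap_fst ha hab hq
  refine ⟨?_, by rw [h3]; exact h2.1, by rw [h3]; exact h2.2⟩
  change _ ^ 2 + _ ^ 2 = (1 : ℝ)
  rw [h3]
  simp only [shellMap]
  rw [norm_mul, Complex.norm_exp_ofReal_mul_I, mul_one, Complex.norm_real,
    Real.norm_of_nonneg (Real.sqrt_nonneg _), Real.sq_sqrt (one_sub_sq_pos ha hb h2.1 h2.2).le]
  ring

theorem fst_ne_zero_of_mem_shell (ha : 0 ≤ a) {p : ℂ × ℂ} (hp : p ∈ shell a b) : p.1 ≠ 0 :=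
  norm_pos_iff.1 (ha.trans_lt hp.2.1)

theorem norm_snd_of_mem_shell {p : ℂ × ℂ} (hp : p ∈ shell a b) :
    ‖p.2‖ = Real.sqrt (1 - ‖p.1‖ ^ 2) := by
  have : ‖p.1‖ ^ 2 + ‖p.2‖ ^ 2 = 1 := hp.1
  rw [← this, add_sub_cancel_left, Real.sqrt_sq (norm_nonneg _)]

theorem snd_ne_zero_of_mem_shell (ha : 0 ≤ a) (hb : b ≤ 1) {p : ℂ × ℂ} (hp : p ∈ shell a b) :
    p.2 ≠ 0 := by
  rw [← norm_pos_iff, norm_snd_of_mem_shell hp]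
  exact Real.sqrt_pos.2 (one_sub_sq_pos ha hb hp.2.1 hp.2.2)

theorem exp_neg_mul_exp (t : ℝ) :
    Complex.exp (((-t : ℝ) : ℂ) * Complex.I) * Complex.exp ((t : ℂ) * Complex.I) = 1 := by
  rw [← Complex.exp_add]
  simp

/-- The rotation by `-t` and the added `t` cancel in the exponential, whatever branch the logarithm
takes. So the identity needs no condition relating `t` to the argument of `v`. -/
theorem exp_shellLocalInv_snd (t : ℝ) {p : ℂ × ℂ} (hp : p.2 ≠ 0) :
    Complex.exp (((shellLocalInv a b t p).2 : ℂ) * Complex.I) = ((‖p.2‖⁻¹ : ℝ) : ℂ) * p.2 := by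
  set w := p.2 * Complex.exp (((-t : ℝ) : ℂ) * Complex.I) with hw
  have hn : ‖w‖ = ‖p.2‖ := by
    rw [hw, norm_mul, Complex.norm_exp_ofReal_mul_I, mul_one]
  have h1 := Complex.norm_mul_exp_arg_mul_I w
  have hp' : (‖p.2‖ : ℂ) ≠ 0 := by exact_mod_cast (norm_pos_iff.2 hp).ne'
  have h2 : Complex.exp ((Complex.arg w : ℂ) * Complex.I) = (‖p.2‖ : ℂ)⁻¹ * w := by
    rw [← h1, hn, inv_mul_cancel_left₀ hp', ← hn, h1]
  simp only [shellLocalInv, ← hw, Complex.log_im]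
  push_cast
  rw [add_mul, Complex.exp_add, h2, hw]
  linear_combination (‖p.2‖ : ℂ)⁻¹ * p.2 * exp_neg_mul_exp t

/-- The second coordinate enters `shellMap` only through its exponential. Thus `shellLocalInv` is a
right inverse for every `t`, but a left inverse in `shellLocalInv_shellMap` for the matching `t`. -/
theorem shellMap_shellLocalInv (ha : 0 ≤ a) (hab : a < b) (hb : b ≤ 1) (t : ℝ) {p : ℂ × ℂ}
    (hp : p ∈ shell a b) : shellMap a b (shellLocalInv a b t p) = p := by
  have hρ : 0 < ‖p.1‖ := ha.trans_lt hp.2.1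
  have hR := shellInv_pos hp.2.1 hp.2.2
  have hp2 := snd_ne_zero_of_mem_shell ha hb hp
  have hn : ‖(shellLocalInv a b t p).1‖ = shellInv a b ‖p.1‖ := by
    rw [shellLocalInv, norm_mul, Complex.norm_real, Real.norm_of_nonneg (by positivity),
      div_mul_cancel₀ _ hρ.ne']
  refine Prod.ext ?_ ?_
  · simp only [shellMap, hn, shellRadius_shellInv hab hp.2.2]
    simp only [shellLocalInv]
    rw [← mul_assoc, ← Complex.ofReal_mul]
    rw [div_mul_div_cancel₀ hR.ne', div_self hρ.ne']
    simp
  · simp only [shellMap, hn, shellRadius_shellInv hab hp.2.2, exp_shellLocalInv_snd t hp2,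
      ← norm_snd_of_mem_shell hp]
    rw [← mul_assoc, ← Complex.ofReal_mul, mul_inv_cancel₀ (norm_pos_iff.2 hp2).ne']
    simp

theorem shellLocalInv_fst_shellMap (ha : 0 ≤ a) (hab : a < b) {q : ℂ × ℝ} (hq : q.1 ≠ 0)
    (t : ℝ) : (shellLocalInv a b t (shellMap a b q)).1 = q.1 := by
  have h1 := norm_pos_iff.2 hq
  have h2 := shellRadius_mem hab h1
  have h3 : 0 < shellRadius a b ‖q.1‖ := ha.trans_lt h2.1
  simp only [shellLocalInv]
  rw [norm_shellMap_fst ha hab hq, shellInv_shellRadius hab h1]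
  simp only [shellMap]
  rw [← mul_assoc, ← Complex.ofReal_mul, div_mul_div_cancel₀ h3.ne', div_self h1.ne']
  simp

/-- The rotation puts `v` on the positive real axis, away from the branch cut of the logarithm. -/
theorem snd_shellMap_mul_exp (ha : 0 ≤ a) (hab : a < b) (hb : b ≤ 1) {q : ℂ × ℝ} (hq : q.1 ≠ 0) :
    ∃ B : ℝ, 0 < B ∧ (shellMap a b q).2 * Complex.exp (((-q.2 : ℝ) : ℂ) * Complex.I) = B := by
  have h2 := shellRadius_mem hab (norm_pos_iff.2 hq)
  refine ⟨_, Real.sqrt_pos.2 (one_sub_sq_pos ha hb h2.1 h2.2), ?_⟩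
  simp only [shellMap]
  rw [mul_assoc, mul_comm (Complex.exp _), exp_neg_mul_exp, mul_one]

theorem shellLocalInv_shellMap (ha : 0 ≤ a) (hab : a < b) (hb : b ≤ 1) {q : ℂ × ℝ}
    (hq : q.1 ≠ 0) : shellLocalInv a b q.2 (shellMap a b q) = q := by
  refine Prod.ext (shellLocalInv_fst_shellMap ha hab hq _) ?_
  obtain ⟨B, hB, h⟩ := snd_shellMap_mul_exp ha hab hb hq
  simp only [shellLocalInv]
  rw [h, Complex.log_im, Complex.arg_ofReal_of_nonneg hB.le, add_zero]

theorem unshell_eq (t : ℝ) {p : ℂ × ℂ} (hp : p.2 ≠ 0) : unshell a b p =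
    ((shellLocalInv a b t p).1,
      Complex.exp (((shellLocalInv a b t p).2 : ℂ) * Complex.I)) := by
  rw [exp_shellLocalInv_snd t hp]
  rfl

theorem differentiableAt_shellLocalInv (ha : 0 ≤ a) (hab : a < b) (hb : b ≤ 1) {q : ℂ × ℝ}
    (hq : q.1 ≠ 0) : DifferentiableAt ℝ (shellLocalInv a b q.2) (shellMap a b q) := by
  have hp := shellMap_mem_shell ha hab hb hq
  set p := shellMap a b q with hpdef
  have hp1 := fst_ne_zero_of_mem_shell ha hp
  have hn : DifferentiableAt ℝ (fun p : ℂ × ℂ => ‖p.1‖) p := differentiableAt_fst.norm ℝ hp1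
  have h1 : DifferentiableAt ℝ (fun p : ℂ × ℂ => shellInv a b ‖p.1‖ / ‖p.1‖) p := by
    have hn0 := (norm_pos_iff.2 hp1).ne'
    have hb0 := (sub_pos.2 hp.2.2).ne'
    simp only [shellInv, div_eq_mul_inv]
    fun_prop (disch := assumption)
  have h2 : DifferentiableAt ℝ (fun p : ℂ × ℂ => ((shellInv a b ‖p.1‖ / ‖p.1‖ : ℝ) : ℂ)) p :=
    Complex.ofRealCLM.differentiableAt.comp p h1
  obtain ⟨B, hB, h⟩ := snd_shellMap_mul_exp ha hab hb hq
  have hslit : p.2 * Complex.exp (((-q.2 : ℝ) : ℂ) * Complex.I) ∈ Complex.slitPlane := by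
    rw [h]
    exact Complex.ofReal_mem_slitPlane.2 hB
  have h3 : DifferentiableAt ℝ (fun p : ℂ × ℂ =>
      p.2 * Complex.exp (((-q.2 : ℝ) : ℂ) * Complex.I)) p :=
    differentiableAt_snd.mul_const _
  have h4 : DifferentiableAt ℝ Complex.log
      (p.2 * Complex.exp (((-q.2 : ℝ) : ℂ) * Complex.I)) :=
    (Complex.differentiableAt_log hslit).restrictScalars ℝ
  have h5 : DifferentiableAt ℝ (fun p : ℂ × ℂ =>
      (Complex.log (p.2 * Complex.exp (((-q.2 : ℝ) : ℂ) * Complex.I))).im) p :=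
    Complex.imCLM.differentiableAt.comp p (DifferentiableAt.comp (g := Complex.log) p h4 h3)
  exact (h2.mul differentiableAt_fst).prodMk (h5.const_add _)

/-! ### The identification of the shell preserves the orientation -/

theorem differentiableAt_shellRadius {R : ℝ} (hR : 0 < R) :
    HasDerivAt (shellRadius a b) ((b - a) / (1 + R) ^ 2) R := by
  have h1 : HasDerivAt (fun R : ℝ => a + b * R) b R := by
    simpa using ((hasDerivAt_id R).const_mul b).const_add a
  have h2 : HasDerivAt (fun R : ℝ => 1 + R) 1 R := (hasDerivAt_id R).const_add 1
  have h3 : HasDerivAt (shellRadius a b) _ R := h1.fun_div h2 (by positivity)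
  convert h3 using 1
  congr 1
  ring

theorem differentiableAt_shellMap (ha : 0 ≤ a) (hab : a < b) (hb : b ≤ 1) {q : ℂ × ℝ}
    (hq : q.1 ≠ 0) : DifferentiableAt ℝ (shellMap a b) q := by
  have hR := norm_pos_iff.2 hq
  have hρ := shellRadius_mem hab hR
  have hn : DifferentiableAt ℝ (fun q : ℂ × ℝ => ‖q.1‖) q := differentiableAt_fst.norm ℝ hq
  have h1 : DifferentiableAt ℝ (fun q : ℂ × ℝ => shellRadius a b ‖q.1‖) q :=
    DifferentiableAt.comp (g := shellRadius a b) q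
      (differentiableAt_shellRadius hR).differentiableAt hn
  have h1' : DifferentiableAt ℝ (fun q : ℂ × ℝ => shellRadius a b ‖q.1‖ / ‖q.1‖) q := by
    have hR0 := hR.ne'
    simp only [div_eq_mul_inv]
    fun_prop (disch := assumption)
  have h2 : DifferentiableAt ℝ (fun q : ℂ × ℝ =>
      ((shellRadius a b ‖q.1‖ / ‖q.1‖ : ℝ) : ℂ)) q :=
    Complex.ofRealCLM.differentiableAt.comp q h1'
  have h3 : DifferentiableAt ℝ (fun q : ℂ × ℝ =>
      ((Real.sqrt (1 - shellRadius a b ‖q.1‖ ^ 2) : ℝ) : ℂ)) q :=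
    Complex.ofRealCLM.differentiableAt.comp q
      (((h1.pow 2).const_sub 1).sqrt (one_sub_sq_pos ha hb hρ.1 hρ.2).ne')
  have h4 : DifferentiableAt ℝ (fun q : ℂ × ℝ => Complex.exp ((q.2 : ℂ) * Complex.I)) q :=
    DifferentiableAt.comp (g := fun x : ℝ => Complex.exp ((x : ℂ) * Complex.I)) q
      (hasDerivAt_exp_mul_I q.2).differentiableAt differentiableAt_snd
  exact (h2.mul differentiableAt_fst).prodMk (h3.mul h4)

theorem det4_eq (p x y z : ℂ × ℂ) : det4 p x y z =
    (p.1.re * x.1.im - p.1.im * x.1.re) * (y.2.re * z.2.im - y.2.im * z.2.re) -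
    (p.1.re * y.1.im - p.1.im * y.1.re) * (x.2.re * z.2.im - x.2.im * z.2.re) +
    (p.1.re * z.1.im - p.1.im * z.1.re) * (x.2.re * y.2.im - x.2.im * y.2.re) +
    (x.1.re * y.1.im - x.1.im * y.1.re) * (p.2.re * z.2.im - p.2.im * z.2.re) -
    (x.1.re * z.1.im - x.1.im * z.1.re) * (p.2.re * y.2.im - p.2.im * y.2.re) +
    (y.1.re * z.1.im - y.1.im * z.1.re) * (p.2.re * x.2.im - p.2.im * x.2.re) := by
  simp [det4, Matrix.det_succ_row_zero, Fin.sum_univ_succ, Fin.succAbove]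
  ring

/-- The derivative of `shellMap` multiplies volumes by a positive factor. -/
theorem exists_det4_fderiv_shellMap (ha : 0 ≤ a) (hab : a < b) (hb : b ≤ 1) {q : ℂ × ℝ}
    (hq : q.1 ≠ 0) : ∃ κ : ℝ, 0 < κ ∧ ∀ x y z : ℂ × ℝ,
      det4 (shellMap a b q) (fderiv ℝ (shellMap a b) q x) (fderiv ℝ (shellMap a b) q y)
        (fderiv ℝ (shellMap a b) q z) = κ * det3 x y z := by
  obtain ⟨u, t⟩ := q
  simp only at hq
  set L := fderiv ℝ (shellMap a b) (u, t) with hL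
  have hd := (differentiableAt_shellMap ha hab hb (q := (u, t)) hq).hasFDerivAt
  set R := ‖u‖ with hRdef
  have hR : 0 < R := norm_pos_iff.2 hq
  have hρm := shellRadius_mem hab hR
  set ρ := shellRadius a b R with hρ
  have hρ0 : 0 < ρ := ha.trans_lt hρm.1
  set α := ρ / R with hα
  set k := (b - a) / (1 + R) ^ 2 with hk
  have hk0 : 0 < k := div_pos (sub_pos.2 hab) (by positivity)
  set B := Real.sqrt (1 - ρ ^ 2) with hB
  have hB2 : 0 < 1 - ρ ^ 2 := one_sub_sq_pos ha hb hρm.1 hρm.2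
  have hB0 : 0 < B := Real.sqrt_pos.2 hB2
  have hBB : B ^ 2 = 1 - ρ ^ 2 := Real.sq_sqrt hB2.le
  set e := Complex.exp ((t : ℂ) * Complex.I) with he
  set j := -(ρ * (k * R)) / B with hj
  have F1 : L (u, 0) = ((k : ℂ) * u, (j : ℂ) * e) := by
    have hc : HasDerivAt (fun x : ℝ => ((x : ℂ) * u, t)) (u, 0) 1 :=
      HasDerivAt.prodMk (by simpa using (Complex.ofRealCLM.hasDerivAt (x := 1)).mul_const u)
        (hasDerivAt_const _ _)
    have h1 := HasFDerivAt.comp_hasDerivAt_of_eq (l := shellMap a b) (1 : ℝ) hd hc (by simp)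
    have hx : HasDerivAt (fun x : ℝ => shellRadius a b (x * R)) (k * R) 1 := by
      have h2 : HasDerivAt (fun x : ℝ => x * R) R 1 := by
        simpa using (hasDerivAt_id (1 : ℝ)).mul_const R
      have h3 : HasDerivAt (shellRadius a b) k (1 * R) := by
        rw [one_mul]; exact differentiableAt_shellRadius hR
      exact h3.comp 1 h2
    have hs : HasDerivAt (fun x : ℝ => Real.sqrt (1 - shellRadius a b (x * R) ^ 2)) j 1 := by
      have h2 : HasDerivAt (fun x : ℝ => 1 - shellRadius a b (x * R) ^ 2)
          (-(2 * ρ * (k * R))) 1 := by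
        simpa using (hx.fun_pow 2).const_sub 1
      have h3 := h2.sqrt (by rw [one_mul]; exact hB2.ne')
      rw [one_mul] at h3
      convert h3 using 1
      rw [hj, neg_div, neg_div, mul_assoc 2 ρ, mul_div_mul_left _ _ (two_ne_zero' ℝ)]
    have h4 : HasDerivAt (fun x : ℝ => (((shellRadius a b (x * R) / R : ℝ) : ℂ) * u,
        ((Real.sqrt (1 - shellRadius a b (x * R) ^ 2) : ℝ) : ℂ) * e))
        ((k : ℂ) * u, (j : ℂ) * e) 1 := by
      refine HasDerivAt.prodMk ?_ ?_
      · have h5 := ((hx.div_const R).ofReal_comp).mul_const u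
        rwa [mul_div_cancel_right₀ _ hR.ne'] at h5
      · exact hs.ofReal_comp.mul_const e
    refine h1.unique (h4.congr_of_eventuallyEq ?_)
    filter_upwards [lt_mem_nhds (zero_lt_one : (0 : ℝ) < 1)] with x hx0
    have hn : ‖(x : ℂ) * u‖ = x * R := by
      rw [norm_mul, Complex.norm_real, Real.norm_of_nonneg hx0.le]
    simp only [Function.comp_apply, shellMap, hn]
    refine Prod.ext ?_ rfl
    simp only
    have h6 : (x : ℂ) ≠ 0 := by exact_mod_cast hx0.ne'
    have h7 : (R : ℂ) ≠ 0 := by exact_mod_cast hR.ne'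
    push_cast
    field_simp
  have F2 : L (Complex.I * u, 0) = ((α : ℂ) * (Complex.I * u), 0) := by
    have hc : HasDerivAt (fun x : ℝ => (Complex.exp ((x : ℂ) * Complex.I) * u, t))
        (Complex.I * u, 0) 0 := by
      refine HasDerivAt.prodMk ?_ (hasDerivAt_const _ _)
      simpa using (hasDerivAt_exp_mul_I 0).mul_const u
    have h1 := HasFDerivAt.comp_hasDerivAt_of_eq (l := shellMap a b) (0 : ℝ) hd hc (by simp)
    have h4 : HasDerivAt (fun x : ℝ =>
        ((α : ℂ) * (Complex.exp ((x : ℂ) * Complex.I) * u), (B : ℂ) * e))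
        ((α : ℂ) * (Complex.I * u), 0) 0 := by
      refine HasDerivAt.prodMk ?_ (hasDerivAt_const _ _)
      simpa using ((hasDerivAt_exp_mul_I 0).mul_const u).const_mul (α : ℂ)
    refine h1.unique (h4.congr_of_eventuallyEq (Filter.Eventually.of_forall fun x => ?_))
    have hn : ‖Complex.exp ((x : ℂ) * Complex.I) * u‖ = R := by
      rw [norm_mul, Complex.norm_exp_ofReal_mul_I, one_mul]
    simp only [Function.comp_apply, shellMap, hn]
    rfl
  have F3 : L (0, 1) = (0, (B : ℂ) * (Complex.I * e)) := by
    have hc : HasDerivAt (fun x : ℝ => (u, x)) ((0 : ℂ), (1 : ℝ)) t :=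
      (hasDerivAt_const _ _).prodMk (hasDerivAt_id _)
    have h1 := HasFDerivAt.comp_hasDerivAt_of_eq (l := shellMap a b) t hd hc rfl
    have h4 : HasDerivAt (fun x : ℝ =>
        ((α : ℂ) * u, (B : ℂ) * Complex.exp ((x : ℂ) * Complex.I)))
        (0, (B : ℂ) * (Complex.I * e)) t :=
      (hasDerivAt_const _ _).prodMk ((hasDerivAt_exp_mul_I t).const_mul _)
    exact h1.unique h4
  have hS : shellMap a b (u, t) = ((α : ℂ) * u, (B : ℂ) * e) := rfl
  have hα0 : 0 < α := div_pos hρ0 hR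
  have hee : e.re ^ 2 + e.im ^ 2 = 1 := by
    have := Complex.norm_exp_ofReal_mul_I t
    rw [← he] at this
    rw [pow_two, pow_two, ← Complex.normSq_apply, Complex.normSq_eq_norm_sq, this, one_pow]
  have hBj : B * j = -(ρ * (k * R)) := mul_div_cancel₀ _ hB0.ne'
  have hαR : α * R = ρ := div_mul_cancel₀ _ hR.ne'
  -- The radial motion, with speed `k R` in `|u|` and `j` in `|v|`, is tangent to the sphere. By
  -- `|u|² + |v|² = 1`, the corresponding factor of the determinant reduces to `k`.
  have hαBj : B ^ 2 * k - α * (B * j) = k := by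
    rw [hBj, hBB]
    linear_combination k * ρ * hαR
  -- Every vector is split into its radial, angular and `t` components, on which the derivative is
  -- known from `F1`, `F2`, `F3`.
  have hbasis : ∀ n : ℂ × ℝ, ∃ x y : ℝ, n.1.re = x * u.re - y * u.im ∧
      n.1.im = x * u.im + y * u.re ∧
      L n = ((x * k : ℝ) * u + (y * α : ℝ) * (Complex.I * u),
        (x * j : ℝ) * e + (n.2 * B : ℝ) * (Complex.I * e)) := by
    intro n
    set w := n.1 / u with hw
    have hn : n.1 = w * u := (div_mul_cancel₀ _ hq).symm
    refine ⟨w.re, w.im, ?_, ?_, ?_⟩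
    · rw [hn, Complex.mul_re]
    · rw [hn, Complex.mul_im]
    · have hn2 : n = w.re • (u, (0 : ℝ)) + w.im • (Complex.I * u, (0 : ℝ)) +
          n.2 • ((0 : ℂ), (1 : ℝ)) := by
        refine Prod.ext ?_ (by simp)
        rw [hn]
        simp
        linear_combination (-u) * Complex.re_add_im w
      conv_lhs => rw [hn2, map_add, map_add, map_smul, map_smul, map_smul, F1, F2, F3]
      refine Prod.ext ?_ ?_ <;> simp <;> ring
  refine ⟨α * k, mul_pos hα0 hk0, fun n₁ n₂ n₃ => ?_⟩
  obtain ⟨x₁, y₁, h1, h1', hL1⟩ := hbasis n₁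
  obtain ⟨x₂, y₂, h2, h2', hL2⟩ := hbasis n₂
  obtain ⟨x₃, y₃, h3, h3', hL3⟩ := hbasis n₃
  rw [hS, hL1, hL2, hL3, det4_eq, det3_eq, h1, h1', h2, h2', h3, h3']
  simp only [Complex.add_re, Complex.add_im, Complex.mul_re, Complex.mul_im, Complex.ofReal_re,
    Complex.ofReal_im, Complex.I_re, Complex.I_im, zero_mul, one_mul, zero_sub, zero_add, sub_zero,
    add_zero]
  have key : ∀ (D : ℝ), D * (α * (u.re ^ 2 + u.im ^ 2) * (e.re ^ 2 + e.im ^ 2) *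
      (B ^ 2 * k - α * (B * j))) = D * (α * k * (u.re ^ 2 + u.im ^ 2)) := by
    intro D
    rw [hee, hαBj]
    ring
  linear_combination key (x₁ * (y₂ * n₃.2 - n₂.2 * y₃) - y₁ * (x₂ * n₃.2 - n₂.2 * x₃) +
    n₁.2 * (x₂ * y₃ - y₂ * x₃))

end Shell

/-! ### The links of the 1-faces and the disks -/

/-- The function on the shell of which `L_i` is the zero set. -/
def linkFun (f : MixedPolynomial) (ε : ℕ → ℝ) (i : ℕ) (p : ℂ × ℂ) : ℂ :=
  evalAt (faceFunction f (edge f i)) (unshell (ε (i - 1)) (ε i) p)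

/-- `linkFun` needs no choice of an argument of `v`; in any chart of the shell it is `edgeMap`. -/
theorem linkFun_eq_edgeMap (f : MixedPolynomial) (ε : ℕ → ℝ) (i : ℕ) (t : ℝ) {p : ℂ × ℂ}
    (hp : p.2 ≠ 0) :
    linkFun f ε i p = edgeMap f i (shellLocalInv (ε (i - 1)) (ε i) t p) := by
  rw [linkFun, unshell_eq t hp]
  rfl

/-- The radii of the `i`-th shell are admissible. -/
def IsShell (ε : ℕ → ℝ) (i : ℕ) : Prop := 0 ≤ ε (i - 1) ∧ ε (i - 1) < ε i ∧ ε i ≤ 1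

theorem mem_carrier_edgeLink {f : MixedPolynomial} {ε : ℕ → ℝ} {i : ℕ} (hε : IsShell ε i)
    {p : ℂ × ℂ} : p ∈ (edgeLink f ε i).carrier ↔
      p ∈ shell (ε (i - 1)) (ε i) ∧ linkFun f ε i p = 0 := by
  obtain ⟨ha, hab, hb⟩ := hε
  constructor
  · rintro ⟨q, ⟨hq, h0⟩, rfl⟩
    have hp := shellMap_mem_shell ha hab hb hq
    refine ⟨hp, ?_⟩
    rw [linkFun_eq_edgeMap f ε i q.2 (snd_ne_zero_of_mem_shell ha hb hp),
      shellLocalInv_shellMap ha hab hb hq]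
    exact h0
  · rintro ⟨hp, h0⟩
    rw [linkFun_eq_edgeMap f ε i 0 (snd_ne_zero_of_mem_shell ha hb hp)] at h0
    refine ⟨_, ⟨?_, h0⟩, shellMap_shellLocalInv ha hab hb 0 hp⟩
    have h1 := norm_pos_iff.2 (fst_ne_zero_of_mem_shell ha hp)
    have h2 := shellInv_pos hp.2.1 hp.2.2
    refine mul_ne_zero ?_ (norm_pos_iff.1 h1)
    exact_mod_cast (div_pos h2 h1).ne'

theorem mem_carrier_of_mem_positive {f : MixedPolynomial} {ε : ℕ → ℝ} {i : ℕ} {p τ : ℂ × ℂ}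
    (h : τ ∈ (edgeLink f ε i).positive p) : p ∈ (edgeLink f ε i).carrier := by
  obtain ⟨q, σ, hq, h0, -, rfl, -⟩ := h
  exact ⟨q, ⟨hq, h0⟩, rfl⟩

/-! ### Signs and transversality of intersection points in a chart of the shell -/

section Local

variable {f : MixedPolynomial} {ε : ℕ → ℝ} {i : ℕ} {D : ℂ → ℂ × ℂ} {z : ℂ} {q : ℂ × ℝ}

/-- A disk through the point `q` of the shell, in the coordinates of `ℂ × ℝ`. -/
theorem exists_hasFDerivAt_shellLocalInv (hε : IsShell ε i) (hq : q.1 ≠ 0)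
    (hz : D z = shellMap (ε (i - 1)) (ε i) q) (hD : DifferentiableAt ℝ D z)
    (hs : ∀ᶠ y in 𝓝 z, D y ∈ shell (ε (i - 1)) (ε i)) :
    ∃ T : ℂ →L[ℝ] ℂ × ℝ,
      HasFDerivAt (fun y => shellLocalInv (ε (i - 1)) (ε i) q.2 (D y)) T z ∧
      (∀ v, fderiv ℝ D z v = fderiv ℝ (shellMap (ε (i - 1)) (ε i)) q (T v)) ∧
      HasFDerivAt (fun y => linkFun f ε i (D y)) ((fderiv ℝ (edgeMap f i) q).comp T) z := by
  obtain ⟨ha, hab, hb⟩ := hε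
  set N : ℂ → ℂ × ℝ := fun y => shellLocalInv (ε (i - 1)) (ε i) q.2 (D y) with hN
  have hNz : N z = q := by rw [hN]; simp only [hz, shellLocalInv_shellMap ha hab hb hq]
  have hNd : DifferentiableAt ℝ N z :=
    DifferentiableAt.comp (g := shellLocalInv (ε (i - 1)) (ε i) q.2) z
      (hz ▸ differentiableAt_shellLocalInv ha hab hb hq) hD
  refine ⟨fderiv ℝ N z, hNd.hasFDerivAt, fun v => ?_, ?_⟩
  · have h1 : HasFDerivAt (fun y => shellMap (ε (i - 1)) (ε i) (N y))
        ((fderiv ℝ (shellMap (ε (i - 1)) (ε i)) q).comp (fderiv ℝ N z)) z := by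
      refine HasFDerivAt.comp (g := shellMap (ε (i - 1)) (ε i)) z ?_ hNd.hasFDerivAt
      rw [hNz]
      exact (differentiableAt_shellMap ha hab hb hq).hasFDerivAt
    have h2 : D =ᶠ[𝓝 z] fun y => shellMap (ε (i - 1)) (ε i) (N y) := by
      filter_upwards [hs] with y hy
      exact (shellMap_shellLocalInv ha hab hb _ hy).symm
    rw [(h1.congr_of_eventuallyEq h2).fderiv]
    rfl
  · have h1 : HasFDerivAt (fun y => edgeMap f i (N y))
        ((fderiv ℝ (edgeMap f i) q).comp (fderiv ℝ N z)) z := by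
      refine HasFDerivAt.comp (g := edgeMap f i) z ?_ hNd.hasFDerivAt
      rw [hNz]
      exact ((contDiff_edgeMap f i).differentiable one_ne_zero q).hasFDerivAt
    refine h1.congr_of_eventuallyEq ?_
    filter_upwards [hs] with y hy
    exact linkFun_eq_edgeMap f ε i q.2 (snd_ne_zero_of_mem_shell ha hb hy)

theorem det2_swap (a b : ℂ) : det2 a b = - det2 b a := by
  rw [det2_eq, det2_eq]; ring

theorem det3_swap (a b c : ℂ × ℝ) : det3 a b c = - det3 b a c := by
  rw [det3_eq, det3_eq]; ring

/-- The sign of the intersection of the link with a disk is the sign of the Jacobian determinant of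
the restriction of `linkFun` to the disk. -/
theorem sign_frameDet (hε : IsShell ε i) (hq : q.1 ≠ 0)
    (hz : D z = shellMap (ε (i - 1)) (ε i) q) (hD : DifferentiableAt ℝ D z)
    (hs : ∀ᶠ y in 𝓝 z, D y ∈ shell (ε (i - 1)) (ε i)) {σ : ℂ × ℝ}
    (hσ : IsPositiveTangent (edgeMap f i) q σ) :
    (0 < frameDet D z (fderiv ℝ (shellMap (ε (i - 1)) (ε i)) q σ) →
      0 < det2 (fderiv ℝ (fun y => linkFun f ε i (D y)) z 1)
        (fderiv ℝ (fun y => linkFun f ε i (D y)) z Complex.I)) ∧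
    (frameDet D z (fderiv ℝ (shellMap (ε (i - 1)) (ε i)) q σ) < 0 →
      det2 (fderiv ℝ (fun y => linkFun f ε i (D y)) z 1)
        (fderiv ℝ (fun y => linkFun f ε i (D y)) z Complex.I) < 0) := by
  obtain ⟨T, -, h2, h3⟩ := exists_hasFDerivAt_shellLocalInv (f := f) hε hq hz hD hs
  obtain ⟨κ, hκ, hdet⟩ := exists_det4_fderiv_shellMap hε.1 hε.2.1 hε.2.2 hq
  rw [frameDet, h2, h2, hz, hdet, h3.fderiv]
  simp only [ContinuousLinearMap.comp_apply]
  constructor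
  · intro h
    exact hσ.2.2 _ _ (pos_of_mul_pos_right h hκ.le)
  · intro h
    -- The definition of a positive tangent vector speaks of positive bases only, so the two vectors
    -- of the disk are exchanged.
    rw [det3_swap] at h
    have h4 : 0 < det3 (T Complex.I) (T 1) σ := by
      by_contra! h5
      have := mul_nonneg hκ.le (neg_nonneg.2 h5)
      linarith
    have := hσ.2.2 _ _ h4
    rw [det2_swap]
    linarith

/-- The link is transverse to a disk, on which the linear function `l` is constant, if `l` does not
vanish on the tangent vectors of the link. -/
theorem frameDet_ne_zero (hε : IsShell ε i) (hq : q.1 ≠ 0)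
    (hz : D z = shellMap (ε (i - 1)) (ε i) q) (hD : DifferentiableAt ℝ D z)
    (hs : ∀ᶠ y in 𝓝 z, D y ∈ shell (ε (i - 1)) (ε i))
    (hind : ∀ v, fderiv ℝ D z v = 0 → v = 0) {σ : ℂ × ℝ} (l : ℂ × ℝ →L[ℝ] ℝ) {c : ℝ}
    (hl : ∀ᶠ y in 𝓝 z, l (shellLocalInv (ε (i - 1)) (ε i) q.2 (D y)) = c) (hσ : l σ ≠ 0) :
    frameDet D z (fderiv ℝ (shellMap (ε (i - 1)) (ε i)) q σ) ≠ 0 := by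
  obtain ⟨T, h1, h2, -⟩ :=
    -- Only the derivative of the disk in the chart is needed, so any polynomial serves.
    exists_hasFDerivAt_shellLocalInv (f := (0 : MixedPolynomial)) hε hq hz hD hs
  obtain ⟨κ, hκ, hdet⟩ := exists_det4_fderiv_shellMap hε.1 hε.2.1 hε.2.2 hq
  have hlT : ∀ v, l (T v) = 0 := by
    intro v
    have h3 := (l.hasFDerivAt.comp z h1).congr_of_eventuallyEq
      (hl.mono fun y hy => hy.symm : (fun _ => c) =ᶠ[𝓝 z] _)
    exact (congrArg (fun T : ℂ →L[ℝ] ℝ => T v) (h3.unique (hasFDerivAt_const c z)))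
  have hTinj : ∀ v, T v = 0 → v = 0 := fun v hv => hind v (by rw [h2, hv, map_zero])
  rw [frameDet, h2, h2, hz, hdet]
  refine mul_ne_zero hκ.ne' fun h0 => ?_
  rw [det3] at h0
  -- A linear relation between the two tangent vectors of the disk and `σ`. Applying `l`, which
  -- vanishes on the disk but not on `σ`, removes `σ`; the immersed disk then admits no relation.
  obtain ⟨w, hw0, hw⟩ := Matrix.exists_vecMul_eq_zero_iff.2 h0
  have e0 := congrFun hw 0
  have e1 := congrFun hw 1
  have e2 := congrFun hw 2
  simp [Matrix.vecMul, dotProduct, Fin.sum_univ_three] at e0 e1 e2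
  have hrel : T ((w 0 : ℂ) + (w 1 : ℂ) * Complex.I) + w 2 • σ = 0 := by
    have h4 : ((w 0 : ℂ) + (w 1 : ℂ) * Complex.I) = w 0 • (1 : ℂ) + w 1 • Complex.I := by simp
    rw [h4, map_add, map_smul, map_smul]
    refine Prod.ext (Complex.ext ?_ ?_) ?_
    · simpa using e0
    · simpa using e1
    · simpa using e2
  have hw2 : w 2 = 0 := by
    have := congrArg l hrel
    rw [map_add, hlT, zero_add, map_smul, map_zero, smul_eq_mul] at this
    exact (mul_eq_zero.1 this).resolve_right hσ
  rw [hw2, zero_smul, add_zero] at hrel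
  have h5 := hTinj _ hrel
  have hw00 : w 0 = 0 := by simpa using congrArg Complex.re h5
  have hw11 : w 1 = 0 := by simpa using congrArg Complex.im h5
  exact hw0 (by ext j; fin_cases j <;> simp [hw00, hw11, hw2])

/-- A disk that meets the shell in an annulus. -/
structure IsAnnularDisk (D : ℂ → ℂ × ℂ) (a b A B : ℝ) : Prop where
  nonneg : 0 ≤ A
  mem_shell_iff : ∀ z, D z ∈ shell a b ↔ A < ‖z‖ ∧ ‖z‖ < B
  differentiableAt : ∀ z, ‖z‖ < B → DifferentiableAt ℝ D z

theorem IsAnnularDisk.eventually_mem_shell {a b A B : ℝ} (hD : IsAnnularDisk D a b A B)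
    (hz : D z ∈ shell a b) : ∀ᶠ y in 𝓝 z, D y ∈ shell a b := by
  rw [hD.mem_shell_iff] at hz
  have h1 : ∀ᶠ y in 𝓝 z, A < ‖y‖ := continuous_norm.continuousAt.eventually (lt_mem_nhds hz.1)
  have h2 : ∀ᶠ y in 𝓝 z, ‖y‖ < B := continuous_norm.continuousAt.eventually (gt_mem_nhds hz.2)
  filter_upwards [h1, h2] with y h1 h2
  exact (hD.mem_shell_iff y).2 ⟨h1, h2⟩

theorem intersectionPoints_edgeLink {V : Set (ℂ × ℂ)} {A B : ℝ} (hε : IsShell ε i)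
    (hV : shell (ε (i - 1)) (ε i) ⊆ V) (hD : IsAnnularDisk D (ε (i - 1)) (ε i) A B) :
    intersectionPoints V D (edgeLink f ε i) =
      {z | (A < ‖z‖ ∧ ‖z‖ < B) ∧ linkFun f ε i (D z) = 0} := by
  ext z
  simp only [intersectionPoints, Set.mem_ofPred_eq, mem_carrier_edgeLink hε, hD.mem_shell_iff]
  exact ⟨fun h => h.2, fun h => ⟨hV ((hD.mem_shell_iff z).2 h.1), h⟩⟩

/-- The algebraic intersection number of a link with a transverse disk is a difference of
degrees. -/
theorem algebraicIntersection_edgeLink {V : Set (ℂ × ℂ)} {A B r R : ℝ} (hε : IsShell ε i)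
    (hV : shell (ε (i - 1)) (ε i) ⊆ V) (hD : IsAnnularDisk D (ε (i - 1)) (ε i) A B)
    (hr : A < r) (hrR : r < R) (hR : R < B)
    (h0 : ∀ z, A < ‖z‖ → ‖z‖ ≤ r → linkFun f ε i (D z) ≠ 0)
    (h1 : ∀ z, R ≤ ‖z‖ → ‖z‖ < B → linkFun f ε i (D z) ≠ 0) {m n : ℤ}
    (hm : HasCircleDegree (fun z => linkFun f ε i (D z)) 0 r m)
    (hn : HasCircleDegree (fun z => linkFun f ε i (D z)) 0 R n)
    (htr : IsTransverse V D (edgeLink f ε i)) :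
    (intersectionPoints V D (edgeLink f ε i)).Finite ∧
      algebraicIntersection V D (edgeLink f ε i) = n - m := by
  have hI := intersectionPoints_edgeLink (f := f) hε hV hD
  have hd : ∀ z, A < ‖z‖ → ‖z‖ < B → DifferentiableAt ℝ (fun z => linkFun f ε i (D z)) z := by
    intro z hz hz'
    have hsh := (hD.mem_shell_iff z).2 ⟨hz, hz'⟩
    have hq : (shellLocalInv (ε (i - 1)) (ε i) 0 (D z)).1 ≠ 0 := by
      have h1 := norm_pos_iff.2 (fst_ne_zero_of_mem_shell hε.1 hsh)
      refine mul_ne_zero ?_ (norm_pos_iff.1 h1)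
      exact_mod_cast (div_pos (shellInv_pos hsh.2.1 hsh.2.2) h1).ne'
    obtain ⟨T, -, -, h⟩ := exists_hasFDerivAt_shellLocalInv (f := f) hε hq
      (shellMap_shellLocalInv hε.1 hε.2.1 hε.2.2 0 hsh).symm (hD.differentiableAt z hz')
      (hD.eventually_mem_shell hsh)
    exact h.differentiableAt
  set J : ℂ → ℝ := fun z => det2 (fderiv ℝ (fun z => linkFun f ε i (D z)) z 1)
    (fderiv ℝ (fun z => linkFun f ε i (D z)) z Complex.I) with hJ
  have hsign : ∀ z ∈ intersectionPoints V D (edgeLink f ε i),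
      ∀ τ ∈ (edgeLink f ε i).positive (D z),
      (0 < frameDet D z τ → 0 < J z) ∧ (frameDet D z τ < 0 → J z < 0) := by
    rintro z hz τ ⟨q, σ, hq, -, hσ, hDz, rfl⟩
    rw [hI] at hz
    have hsh := (hD.mem_shell_iff z).2 hz.1
    exact sign_frameDet hε hq hDz (hD.differentiableAt z hz.1.2) (hD.eventually_mem_shell hsh) hσ
  have hpos : {z ∈ intersectionPoints V D (edgeLink f ε i) |
      ∃ τ ∈ (edgeLink f ε i).positive (D z), 0 < frameDet D z τ} =
      {z | ((A < ‖z‖ ∧ ‖z‖ < B) ∧ linkFun f ε i (D z) = 0) ∧ 0 < J z} := by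
    ext z
    constructor
    · rintro ⟨hz, τ, hτ, h⟩
      exact ⟨hI.subset hz, (hsign z hz τ hτ).1 h⟩
    · rintro ⟨hz, h⟩
      -- For the converse, transversality leaves only two signs, and the wrong one would give the
      -- Jacobian the wrong sign.
      have hz := hI.superset hz
      obtain ⟨⟨τ, hτ⟩, hne⟩ := htr z hz
      refine ⟨hz, τ, hτ, (lt_or_gt_of_ne (hne τ hτ)).resolve_left fun h' => ?_⟩
      exact lt_asymm h ((hsign z hz τ hτ).2 h')
  have hneg : {z ∈ intersectionPoints V D (edgeLink f ε i) |
      ∃ τ ∈ (edgeLink f ε i).positive (D z), frameDet D z τ < 0} =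
      {z | ((A < ‖z‖ ∧ ‖z‖ < B) ∧ linkFun f ε i (D z) = 0) ∧ J z < 0} := by
    ext z
    constructor
    · rintro ⟨hz, τ, hτ, h⟩
      exact ⟨hI.subset hz, (hsign z hz τ hτ).2 h⟩
    · rintro ⟨hz, h⟩
      have hz := hI.superset hz
      obtain ⟨⟨τ, hτ⟩, hne⟩ := htr z hz
      refine ⟨hz, τ, hτ, (lt_or_gt_of_ne (hne τ hτ)).resolve_right fun h' => ?_⟩
      exact lt_asymm h ((hsign z hz τ hτ).1 h')
  rw [algebraicIntersection, hpos, hneg, hI]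
  refine signed_count_zeros hD.nonneg hr hrR hR (fun z h2 h3 => (hd z h2 h3).continuousAt)
    (fun z h2 h3 h4 => ⟨hd z h2 h3, ?_⟩) h0 h1 hm hn
  have hz := hI.superset ⟨⟨h2, h3⟩, h4⟩
  obtain ⟨⟨τ, hτ⟩, hne⟩ := htr z hz
  rcases lt_or_gt_of_ne (hne τ hτ) with h | h
  · exact ((hsign z hz τ hτ).2 h).ne
  · exact ((hsign z hz τ hτ).1 h).ne'

/-- Regularity provides a positive tangent vector at each point of the link; transversality is then
a condition on the non-zero kernel vectors at every preimage `q` of the point. -/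
theorem isTransverse_edgeLink {V : Set (ℂ × ℂ)} (hconv : IsConvenient f)
    (hnd : IsNonDegenerate f) (hi : 1 ≤ i) (hiN : i ≤ numEdges f)
    (h : ∀ z q σ, q.1 ≠ 0 → edgeMap f i q = 0 → D z = shellMap (ε (i - 1)) (ε i) q →
      fderiv ℝ (edgeMap f i) q σ = 0 → σ ≠ 0 →
      frameDet D z (fderiv ℝ (shellMap (ε (i - 1)) (ε i)) q σ) ≠ 0) :
    IsTransverse V D (edgeLink f ε i) := by
  rintro z ⟨-, q, ⟨hq, h0⟩, hz⟩
  refine ⟨?_, ?_⟩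
  · obtain ⟨σ, hσ⟩ := exists_isPositiveTangent (surjective_fderiv_edgeMap hconv hnd hi hiN hq h0)
    exact ⟨_, q, σ, hq, h0, hσ, hz.symm, rfl⟩
  · rintro τ ⟨q', σ, hq', h0', hσ, hz', rfl⟩
    exact h z q' σ hq' h0' hz' hσ.2.1 hσ.1

end Local

/-! ### Bounds on the zeros in a shell, and degrees near its ends -/

theorem unshell_polar {a b x y : ℝ} (hx : 0 < x) (hy : 0 < y) {c : ℂ × ℂ} (hc : c ∈ unitTorus) :
    unshell a b ((x : ℂ) * c.1, (y : ℂ) * c.2) = ((shellInv a b x : ℂ) * c.1, c.2) := by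
  have h1 : ‖(x : ℂ) * c.1‖ = x := by
    rw [norm_mul, hc.1, Complex.norm_real, Real.norm_of_nonneg hx.le, mul_one]
  have h2 : ‖(y : ℂ) * c.2‖ = y := by
    rw [norm_mul, hc.2, Complex.norm_real, Real.norm_of_nonneg hy.le, mul_one]
  have hx' : (x : ℂ) ≠ 0 := by exact_mod_cast hx.ne'
  have hy' : (y : ℂ) ≠ 0 := by exact_mod_cast hy.ne'
  simp only [unshell, h1, h2]
  refine Prod.ext ?_ ?_
  · push_cast
    field_simp
  · push_cast
    field_simp

theorem exp_mem_unitTorus (x y : ℝ) :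
    (Complex.exp ((x : ℂ) * Complex.I), Complex.exp ((y : ℂ) * Complex.I)) ∈ unitTorus :=
  ⟨Complex.norm_exp_ofReal_mul_I x, Complex.norm_exp_ofReal_mul_I y⟩

theorem exists_polar {z : ℂ} (hz : z ≠ 0) : ∃ w : ℂ, ‖w‖ = 1 ∧ z = (‖z‖ : ℂ) * w := by
  have h : (‖z‖ : ℂ) ≠ 0 := by exact_mod_cast (norm_pos_iff.2 hz).ne'
  refine ⟨(‖z‖ : ℂ)⁻¹ * z, ?_, by rw [mul_inv_cancel_left₀ h]⟩
  rw [norm_mul, norm_inv, Complex.norm_real, norm_norm, inv_mul_cancel₀ (norm_pos_iff.2 hz).ne']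

variable {f : MixedPolynomial} {ε : ℕ → ℝ} {i : ℕ}

/-- The zeros of `linkFun` are contained in a closed shell, on the ends of which its degrees along
loops of arguments are those of the functions of the vertices. -/
theorem exists_linkFun_degree (hconv : IsConvenient f) (hnd : IsNonDegenerate f)
    (hnice : IsGammaNice f) (hi : 1 ≤ i) (hiN : i ≤ numEdges f) (hε : IsShell ε i) :
    ∃ ρ₁ ρ₂ : ℝ, ε (i - 1) < ρ₁ ∧ ρ₁ < ρ₂ ∧ ρ₂ < ε i ∧
      (∀ p ∈ shell (ε (i - 1)) (ε i), ‖p.1‖ ≤ ρ₁ ∨ ρ₂ ≤ ‖p.1‖ → linkFun f ε i p ≠ 0) ∧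
      (∀ c : ℝ → ℂ × ℂ, Continuous c → Function.Periodic c (2 * Real.pi) →
        (∀ x, c x ∈ unitTorus) → ∀ n y, 0 < y →
        HasLoopDegree (fun x => evalAt (vertexFunction f (i - 1)) (c x)) n →
        HasLoopDegree (fun x => linkFun f ε i ((ρ₁ : ℂ) * (c x).1, ((y : ℝ) : ℂ) * (c x).2)) n) ∧
      (∀ c : ℝ → ℂ × ℂ, Continuous c → Function.Periodic c (2 * Real.pi) →
        (∀ x, c x ∈ unitTorus) → ∀ n y, 0 < y →
        HasLoopDegree (fun x => evalAt (vertexFunction f i) (c x)) n →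
        HasLoopDegree
          (fun x => linkFun f ε i ((ρ₂ : ℂ) * (c x).1, ((y : ℝ) : ℂ) * (c x).2)) n) := by
  obtain ⟨r₀, hr₀, H⟩ := edge_degree_small hconv hnd hnice hi hiN
  obtain ⟨R₀, hR₀, K⟩ := edge_degree_large hconv hnd hnice hi hiN
  obtain ⟨ha, hab, hb⟩ := hε
  -- The bounds `1 / 2` and `1` ensure `r < R`.
  set r := min r₀ (1 / 2) with hr
  set R := max R₀ 1 with hR
  have hr0 : 0 < r := lt_min hr₀ (by norm_num)
  have hrR : r < R := (min_le_right _ _).trans_lt ((by norm_num : (1 / 2 : ℝ) < 1).trans_le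
    (le_max_right _ _))
  have hR0 := hr0.trans hrR
  have m1 := shellRadius_mem hab hr0
  have m2 := shellRadius_mem hab hR0
  have hρ1 : 0 < shellRadius (ε (i - 1)) (ε i) r := ha.trans_lt m1.1
  have hρ2 : 0 < shellRadius (ε (i - 1)) (ε i) R := ha.trans_lt m2.1
  refine ⟨shellRadius (ε (i - 1)) (ε i) r, shellRadius (ε (i - 1)) (ε i) R, m1.1,
    shellRadius_lt_shellRadius hab hr0 hrR, m2.2, ?_, ?_, ?_⟩
  · intro p hp hor
    have hp1 := fst_ne_zero_of_mem_shell ha hp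
    have hp2 := snd_ne_zero_of_mem_shell ha hb hp
    obtain ⟨w₁, hw₁, e₁⟩ := exists_polar hp1
    obtain ⟨w₂, hw₂, e₂⟩ := exists_polar hp2
    have hw : (w₁, w₂) ∈ unitTorus := ⟨hw₁, hw₂⟩
    have hpe : p = ((‖p.1‖ : ℂ) * (w₁, w₂).1, (‖p.2‖ : ℂ) * (w₁, w₂).2) := Prod.ext e₁ e₂
    rw [linkFun, hpe, unshell_polar (norm_pos_iff.2 hp1) (norm_pos_iff.2 hp2) hw]
    rcases hor with h | h
    · exact (H _ (shellInv_pos hp.2.1 hp.2.2)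
        ((shellInv_le hr0 hp.2.2 h).trans (min_le_left _ _))).1 _ hw
    · exact (K _ ((le_max_left _ _).trans (le_shellInv hR0 hp.2.2 h))).1 _ hw
  · intro c hc hp hcT n y hy hn
    have := (H r hr0 (min_le_left _ _)).2 c hc hp hcT n hn
    simp only [linkFun, unshell_polar hρ1 hy (hcT _), shellInv_shellRadius hab hr0]
    exact this
  · intro c hc hp hcT n y hy hn
    have := (K R (le_max_left _ _)).2 c hc hp hcT n hn
    simp only [linkFun, unshell_polar hρ2 hy (hcT _), shellInv_shellRadius hab hR0]
    exact this

/-! ### The two families of meridional disks -/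

theorem differentiableAt_sqrt_one_sub {z : ℂ} (hz : ‖z‖ < 1) :
    DifferentiableAt ℝ (fun z : ℂ => ((Real.sqrt (1 - ‖z‖ ^ 2) : ℝ) : ℂ)) z := by
  have h1 : DifferentiableAt ℝ (fun z : ℂ => ‖z‖ ^ 2) z :=
    (contDiff_norm_sq ℝ (n := 1)).differentiable one_ne_zero z
  have h2 : 1 - ‖z‖ ^ 2 ≠ 0 := by
    have := norm_nonneg z
    nlinarith
  exact Complex.ofRealCLM.differentiableAt.comp z ((h1.const_sub 1).sqrt h2)

theorem diskU_mem_sphere3 {t : ℝ} {z : ℂ} : diskU t z ∈ sphere3 ↔ ‖z‖ ≤ 1 := by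
  have h0 := norm_nonneg z
  have : diskU t z ∈ sphere3 ↔ ‖z‖ ^ 2 + Real.sqrt (1 - ‖z‖ ^ 2) ^ 2 = 1 := by
    simp [sphere3, diskU, Complex.norm_exp_ofReal_mul_I, abs_of_nonneg (Real.sqrt_nonneg _)]
  rw [this]
  constructor
  · intro h
    nlinarith [sq_nonneg (Real.sqrt (1 - ‖z‖ ^ 2))]
  · intro h
    rw [Real.sq_sqrt (by nlinarith)]
    ring

theorem isAnnularDisk_diskU {a b : ℝ} (ha : 0 ≤ a) (hb : b ≤ 1) (t : ℝ) :
    IsAnnularDisk (diskU t) a b a b where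
  nonneg := ha
  mem_shell_iff z := by
    refine ⟨fun h => h.2, fun h => ⟨diskU_mem_sphere3.2 (h.2.le.trans hb), h⟩⟩
  differentiableAt z hz :=
    differentiableAt_id.prodMk ((differentiableAt_sqrt_one_sub (hz.trans_le hb)).mul_const _)

theorem diskV_mem_sphere3 {φ : ℝ} {z : ℂ} : diskV φ z ∈ sphere3 ↔ ‖z‖ ≤ 1 := by
  rw [← diskU_mem_sphere3 (t := φ)]
  simp [sphere3, diskU, diskV, add_comm]

theorem norm_diskV_fst (φ : ℝ) (z : ℂ) : ‖(diskV φ z).1‖ = Real.sqrt (1 - ‖z‖ ^ 2) := by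
  simp [diskV, Complex.norm_exp_ofReal_mul_I, abs_of_nonneg (Real.sqrt_nonneg _)]

/-- On this disk `|u| = √(1 - |v|²)`, so the inner circle of the annulus is the outer end `|u| = b`
of the shell, and conversely. -/
theorem isAnnularDisk_diskV {a b : ℝ} (ha : 0 ≤ a) (hab : a < b) (hb : b ≤ 1) (φ : ℝ) :
    IsAnnularDisk (diskV φ) a b (Real.sqrt (1 - b ^ 2)) (Real.sqrt (1 - a ^ 2)) where
  nonneg := Real.sqrt_nonneg _
  mem_shell_iff z := by
    have hb0 : 0 < b := ha.trans_lt hab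
    have h0 := norm_nonneg z
    simp only [shell, Set.mem_ofPred_eq, diskV_mem_sphere3, norm_diskV_fst]
    rw [Real.sqrt_lt' hb0, Real.lt_sqrt ha, Real.lt_sqrt h0]
    have key : Real.sqrt (1 - b ^ 2) < ‖z‖ ↔ 1 - b ^ 2 < ‖z‖ ^ 2 := by
      have := Real.sqrt_lt_sqrt_iff (x := 1 - b ^ 2) (y := ‖z‖ ^ 2) (by nlinarith)
      rwa [Real.sqrt_sq h0] at this
    rw [key]
    constructor
    · rintro ⟨-, h1, h2⟩
      exact ⟨by linarith, by linarith⟩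
    · rintro ⟨h1, h2⟩
      refine ⟨?_, by linarith, by linarith⟩
      nlinarith [sq_nonneg a]
  differentiableAt z hz := by
    have h1 : ‖z‖ < 1 := hz.trans_le (Real.sqrt_le_one.2 (by nlinarith [sq_nonneg a]))
    exact ((differentiableAt_sqrt_one_sub h1).mul_const _).prodMk differentiableAt_id

/-! ### Intersection numbers of a link with the disks -/

theorem sqrt_one_sub_sq_sqrt {x : ℝ} (hx : 0 ≤ x) (hx1 : x ≤ 1) :
    Real.sqrt (1 - Real.sqrt (1 - x ^ 2) ^ 2) = x := by
  rw [Real.sq_sqrt (by nlinarith), sub_sub_cancel, Real.sqrt_sq hx]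

/-- The intersection numbers of a link with the disks `arg v = s`. -/
theorem exists_algebraicIntersection_diskU (hconv : IsConvenient f) (hnd : IsNonDegenerate f)
    (hnice : IsGammaNice f) (hi : 1 ≤ i) (hiN : i ≤ numEdges f) (hε : IsShell ε i)
    {V : Set (ℂ × ℂ)} (hV : shell (ε (i - 1)) (ε i) ⊆ V) {m n : ℤ} {s : ℝ}
    (hm : HasLoopDegree
      (fun x : ℝ => vertexPolyU f (i - 1) s (Complex.exp (x * Complex.I))) m)
    (hn : HasLoopDegree (fun x : ℝ => vertexPolyU f i s (Complex.exp (x * Complex.I))) n)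
    (htr : IsTransverse V (diskU s) (edgeLink f ε i)) :
    (intersectionPoints V (diskU s) (edgeLink f ε i)).Finite ∧
      algebraicIntersection V (diskU s) (edgeLink f ε i) = n - m := by
  obtain ⟨ρ₁, ρ₂, h1, h12, h2, hne, H1, H2⟩ :=
    exists_linkFun_degree hconv hnd hnice hi hiN hε
  have hD := isAnnularDisk_diskU hε.1 hε.2.2 s
  have key : ∀ ρ : ℝ, 0 < ρ → ρ < 1 → ∀ x : ℝ, diskU s (circleMap 0 ρ x) =
      ((ρ : ℂ) * Complex.exp (x * Complex.I),
        ((Real.sqrt (1 - ρ ^ 2) : ℝ) : ℂ) * Complex.exp (s * Complex.I)) := by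
    intro ρ h0 _ x
    have h : ‖circleMap 0 ρ x‖ = ρ := by rw [norm_circleMap_zero, abs_of_pos h0]
    rw [diskU, h, circleMap, zero_add]
  have hρ1 : 0 < ρ₁ := hε.1.trans_lt h1
  have hρ2 : ρ₂ < 1 := h2.trans_le hε.2.2
  have hc : Continuous fun x : ℝ =>
      (Complex.exp ((x : ℂ) * Complex.I), Complex.exp ((s : ℂ) * Complex.I)) := by fun_prop
  have hp : Function.Periodic (fun x : ℝ =>
      (Complex.exp ((x : ℂ) * Complex.I), Complex.exp ((s : ℂ) * Complex.I))) (2 * Real.pi) :=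
    fun x => Prod.ext (exp_mul_I_periodic x) rfl
  have hsq : ∀ ρ : ℝ, 0 < ρ → ρ < 1 → 0 < Real.sqrt (1 - ρ ^ 2) := fun ρ h0 h1 =>
    Real.sqrt_pos.2 (by nlinarith)
  refine algebraicIntersection_edgeLink hε hV hD h1 h12 h2
    (fun z hz hz' => hne _ ((hD.mem_shell_iff z).2 ⟨hz, (hz'.trans_lt h12).trans h2⟩) (Or.inl hz'))
    (fun z hz hz' => hne _ ((hD.mem_shell_iff z).2 ⟨(h1.trans h12).trans_le hz, hz'⟩) (Or.inr hz))
    ?_ ?_ htr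
  · rw [hasCircleDegree_iff]
    simp only [key ρ₁ hρ1 (h12.trans hρ2)]
    exact H1 _ hc hp (fun x => exp_mem_unitTorus x s) m _ (hsq _ hρ1 (h12.trans hρ2)) hm
  · rw [hasCircleDegree_iff]
    simp only [key ρ₂ (hρ1.trans h12) hρ2]
    exact H2 _ hc hp (fun x => exp_mem_unitTorus x s) n _ (hsq _ (hρ1.trans h12) hρ2) hn

/-- The intersection numbers of a link with the disks `arg u = s`. -/
theorem exists_algebraicIntersection_diskV (hconv : IsConvenient f) (hnd : IsNonDegenerate f)
    (hnice : IsGammaNice f) (hi : 1 ≤ i) (hiN : i ≤ numEdges f) (hε : IsShell ε i)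
    {V : Set (ℂ × ℂ)} (hV : shell (ε (i - 1)) (ε i) ⊆ V) {m n : ℤ} {s : ℝ}
    (hm : HasLoopDegree
      (fun x : ℝ => vertexPolyV f (i - 1) s (Complex.exp (x * Complex.I))) m)
    (hn : HasLoopDegree (fun x : ℝ => vertexPolyV f i s (Complex.exp (x * Complex.I))) n)
    (htr : IsTransverse V (diskV s) (edgeLink f ε i)) :
    (intersectionPoints V (diskV s) (edgeLink f ε i)).Finite ∧
      algebraicIntersection V (diskV s) (edgeLink f ε i) = m - n := by
  obtain ⟨ρ₁, ρ₂, h1, h12, h2, hne, H1, H2⟩ :=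
    exists_linkFun_degree hconv hnd hnice hi hiN hε
  have hD := isAnnularDisk_diskV hε.1 hε.2.1 hε.2.2 s
  have hρ1 : 0 < ρ₁ := hε.1.trans_lt h1
  have hρ2 : ρ₂ < 1 := h2.trans_le hε.2.2
  have hρ0 : 0 < ρ₂ := hρ1.trans h12
  have hsq : ∀ ρ : ℝ, 0 < ρ → ρ < 1 → 0 < Real.sqrt (1 - ρ ^ 2) := fun ρ h0 h1 =>
    Real.sqrt_pos.2 (by nlinarith)
  have hlt : ∀ x y : ℝ, 0 ≤ x → x < y → y ≤ 1 →
      Real.sqrt (1 - y ^ 2) < Real.sqrt (1 - x ^ 2) := fun x y h0 h h' =>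
    Real.sqrt_lt_sqrt (by nlinarith) (by nlinarith)
  have key : ∀ ρ : ℝ, 0 < ρ → ρ < 1 → ∀ x : ℝ,
      diskV s (circleMap 0 (Real.sqrt (1 - ρ ^ 2)) x) =
      ((ρ : ℂ) * Complex.exp (s * Complex.I),
        ((Real.sqrt (1 - ρ ^ 2) : ℝ) : ℂ) * Complex.exp (x * Complex.I)) := by
    intro ρ h0 h1 x
    have h : ‖circleMap 0 (Real.sqrt (1 - ρ ^ 2)) x‖ = Real.sqrt (1 - ρ ^ 2) := by
      rw [norm_circleMap_zero, abs_of_nonneg (Real.sqrt_nonneg _)]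
    rw [diskV, h, circleMap, zero_add, sqrt_one_sub_sq_sqrt h0.le h1.le]
  have hc : Continuous fun x : ℝ =>
      (Complex.exp ((s : ℂ) * Complex.I), Complex.exp ((x : ℂ) * Complex.I)) := by fun_prop
  have hp : Function.Periodic (fun x : ℝ =>
      (Complex.exp ((s : ℂ) * Complex.I), Complex.exp ((x : ℂ) * Complex.I))) (2 * Real.pi) :=
    fun x => Prod.ext rfl (exp_mul_I_periodic x)
  -- The inner circle in `v` corresponds to `ρ₂` and so to the vertex `i`, the outer one to `ρ₁` and
  -- the vertex `i - 1`. This exchange yields `m - n`.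
  refine algebraicIntersection_edgeLink hε hV hD (hlt _ _ hρ0.le h2 hε.2.2)
    (hlt _ _ hρ1.le h12 hρ2.le) (hlt _ _ hε.1 h1 (h12.trans hρ2).le)
    (fun z hz hz' => ?_) (fun z hz hz' => ?_) ?_ ?_ htr
  · refine hne _ ((hD.mem_shell_iff z).2
      ⟨hz, hz'.trans_lt (hlt _ _ hε.1 (h1.trans h12) hρ2.le)⟩) (Or.inr ?_)
    rw [norm_diskV_fst, ← sqrt_one_sub_sq_sqrt hρ0.le hρ2.le]
    exact Real.sqrt_le_sqrt (by nlinarith [norm_nonneg z])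
  · refine hne _ ((hD.mem_shell_iff z).2
      ⟨(hlt _ _ hρ1.le (h12.trans h2) hε.2.2).trans_le hz, hz'⟩) (Or.inl ?_)
    rw [norm_diskV_fst, ← sqrt_one_sub_sq_sqrt hρ1.le (h12.trans hρ2).le]
    exact Real.sqrt_le_sqrt (by nlinarith [norm_nonneg z, Real.sqrt_nonneg (1 - ρ₁ ^ 2)])
  · rw [hasCircleDegree_iff]
    simp only [key ρ₂ hρ0 hρ2]
    exact H2 _ hc hp (fun x => exp_mem_unitTorus s x) n _ (hsq _ hρ0 hρ2) hn
  · rw [hasCircleDegree_iff]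
    simp only [key ρ₁ hρ1 (h12.trans hρ2)]
    exact H1 _ hc hp (fun x => exp_mem_unitTorus s x) m _ (hsq _ hρ1 (h12.trans hρ2)) hm

/-! ### Almost all disks are transverse to a link -/

/-- A linear left inverse of `D` makes it an immersion; for the two families of disks it is a
coordinate projection. -/
theorem eq_zero_of_fderiv_eq_zero {D : ℂ → ℂ × ℂ} {z : ℂ} (hD : DifferentiableAt ℝ D z)
    (l : ℂ × ℂ →L[ℝ] ℂ) (hl : ∀ y, l (D y) = y) {v : ℂ} (hv : fderiv ℝ D z v = 0) : v = 0 := by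
  have h1 : HasFDerivAt (fun y => y) (l.comp (fderiv ℝ D z)) z :=
    (l.hasFDerivAt.comp z hD.hasFDerivAt).congr_of_eventuallyEq
      (Eventually.of_forall fun y => (hl y).symm)
  have h2 := congrArg (fun T : ℂ →L[ℝ] ℂ => T v) (h1.unique (hasFDerivAt_id z))
  simpa [hv] using h2.symm

theorem ofReal_mul_eq_ofReal_mul {x y : ℝ} (hx : 0 ≤ x) (hy : 0 < y) {w w' : ℂ} (hw : ‖w‖ = 1)
    (h : (x : ℂ) * w = (y : ℂ) * w') : w' = (‖w'‖ : ℂ) * w := by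
  have h1 := congrArg norm h
  rw [norm_mul, norm_mul, hw, Complex.norm_real, Complex.norm_real, Real.norm_of_nonneg hx,
    Real.norm_of_nonneg hy.le, mul_one] at h1
  have hy' : (y : ℂ) ≠ 0 := by exact_mod_cast hy.ne'
  refine mul_left_cancel₀ hy' ?_
  rw [← h, h1]
  push_cast
  ring

/-- In the chart the disk lies in a plane `t = const`, so it is transverse to the link where `t` has
non-zero derivative along the link. -/
theorem ae_isTransverse_diskU (hconv : IsConvenient f) (hnd : IsNonDegenerate f)
    (hi : 1 ≤ i) (hiN : i ≤ numEdges f) (hε : IsShell ε i) (V : Set (ℂ × ℂ)) :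
    ∀ᵐ s : ℝ, IsTransverse V (diskU s) (edgeLink f ε i) := by
  filter_upwards [ae_regular_arg_snd hconv hnd hi hiN] with s hs
  refine isTransverse_edgeLink hconv hnd hi hiN fun z q σ hq h0 hz hσ hσ0 => ?_
  have hsh : diskU s z ∈ shell (ε (i - 1)) (ε i) :=
    hz ▸ shellMap_mem_shell hε.1 hε.2.1 hε.2.2 hq
  have hD := isAnnularDisk_diskU hε.1 hε.2.2 s
  have hd := hD.differentiableAt z ((hD.mem_shell_iff z).1 hsh).2
  have harg : Complex.exp ((q.2 : ℂ) * Complex.I) = Complex.exp ((s : ℂ) * Complex.I) := by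
    have h1 := congrArg Prod.snd hz
    have h2 : 0 < Real.sqrt (1 - shellRadius (ε (i - 1)) (ε i) ‖q.1‖ ^ 2) := by
      refine (Real.sqrt_nonneg _).lt_of_ne' fun h => ?_
      refine snd_ne_zero_of_mem_shell hε.1 hε.2.2 (hz ▸ hsh) ?_
      simp [shellMap, h]
    have h3 := ofReal_mul_eq_ofReal_mul (Real.sqrt_nonneg _) h2 (Complex.norm_exp_ofReal_mul_I s) h1
    rwa [Complex.norm_exp_ofReal_mul_I, Complex.ofReal_one, one_mul] at h3
  refine frameDet_ne_zero hε hq hz hd (hD.eventually_mem_shell hsh)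
    (fun v => eq_zero_of_fderiv_eq_zero hd (ContinuousLinearMap.fst ℝ ℂ ℂ) fun _ => rfl)
    (ContinuousLinearMap.snd ℝ ℂ ℝ) (c := q.2) (Eventually.of_forall fun y => ?_)
    (hs q hq h0 harg σ hσ hσ0)
  -- This holds for all `y`: outside the unit disk the square root is `0` by convention, and the
  -- argument of `0` is `0`.
  have h4 : (diskU s y).2 * Complex.exp (((-q.2 : ℝ) : ℂ) * Complex.I) =
      ((Real.sqrt (1 - ‖y‖ ^ 2) : ℝ) : ℂ) := by
    rw [diskU, ← harg, mul_assoc, ← Complex.exp_add]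
    simp
  simp only [shellLocalInv, ContinuousLinearMap.coe_snd', h4, Complex.log_im,
    Complex.arg_ofReal_of_nonneg (Real.sqrt_nonneg _), add_zero]

/-- In the chart the quotient of `u` by its value at `q` is real along the disk, so its imaginary
part is the linear function that vanishes on the disk. -/
theorem ae_isTransverse_diskV (hconv : IsConvenient f) (hnd : IsNonDegenerate f)
    (hi : 1 ≤ i) (hiN : i ≤ numEdges f) (hε : IsShell ε i) (V : Set (ℂ × ℂ)) :
    ∀ᵐ s : ℝ, IsTransverse V (diskV s) (edgeLink f ε i) := by
  filter_upwards [ae_regular_arg_fst hconv hnd hi hiN] with s hs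
  refine isTransverse_edgeLink hconv hnd hi hiN fun z q σ hq h0 hz hσ hσ0 => ?_
  have hsh : diskV s z ∈ shell (ε (i - 1)) (ε i) :=
    hz ▸ shellMap_mem_shell hε.1 hε.2.1 hε.2.2 hq
  have hD := isAnnularDisk_diskV hε.1 hε.2.1 hε.2.2 s
  have hd := hD.differentiableAt z ((hD.mem_shell_iff z).1 hsh).2
  have hq0 := norm_pos_iff.2 hq
  have harg : q.1 = (‖q.1‖ : ℂ) * Complex.exp ((s : ℂ) * Complex.I) :=
    ofReal_mul_eq_ofReal_mul (Real.sqrt_nonneg _)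
      (div_pos (hε.1.trans_lt (shellRadius_mem hε.2.1 hq0).1) hq0)
      (Complex.norm_exp_ofReal_mul_I s) (congrArg Prod.fst hz)
  refine frameDet_ne_zero hε hq hz hd (hD.eventually_mem_shell hsh)
    (fun v => eq_zero_of_fderiv_eq_zero hd (ContinuousLinearMap.snd ℝ ℂ ℂ) fun _ => rfl)
    (Complex.imCLM.comp (((ContinuousLinearMap.mul ℝ ℂ) q.1⁻¹).comp
      (ContinuousLinearMap.fst ℝ ℂ ℝ))) (c := 0) (Eventually.of_forall fun y => ?_)
    (hs q hq h0 harg σ hσ hσ0)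
  have h4 : q.1⁻¹ * Complex.exp ((s : ℂ) * Complex.I) = ((‖q.1‖⁻¹ : ℝ) : ℂ) := by
    have h5 : (‖q.1‖ : ℂ) ≠ 0 := by exact_mod_cast hq0.ne'
    have h6 := Complex.exp_ne_zero ((s : ℂ) * Complex.I)
    set e := Complex.exp ((s : ℂ) * Complex.I)
    rw [eq_comm, Complex.ofReal_inv, inv_eq_iff_eq_inv, mul_inv, inv_inv, ← div_eq_mul_inv,
      eq_div_iff h6]
    exact harg.symm
  have h7 : ∀ x y : ℝ, q.1⁻¹ * ((x : ℂ) * ((y : ℂ) * Complex.exp ((s : ℂ) * Complex.I))) =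
      ((x * y * ‖q.1‖⁻¹ : ℝ) : ℂ) := by
    intro x y
    rw [Complex.ofReal_mul, ← h4, Complex.ofReal_mul]
    ring
  change (q.1⁻¹ * (shellLocalInv (ε (i - 1)) (ε i) q.2 (diskV s y)).1).im = 0
  simp only [shellLocalInv, diskV]
  rw [h7, Complex.ofReal_im]

/-! ### Unions of links -/

/-- Since the carriers are disjoint and positive vectors exist only over the carrier, at each point
of the union just one link contributes; transversality can be checked link by link, and signed
counts add. -/
theorem hasWindingNumber_union {V : Set (ℂ × ℂ)} {D : ℝ → ℂ → ℂ × ℂ} {L : ℕ → OrientedLink}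
    {J : Finset ℕ} {w : ℕ → ℤ}
    (hdisj : (J : Set ℕ).PairwiseDisjoint fun j => (L j).carrier)
    (hsub : ∀ j p τ, τ ∈ (L j).positive p → p ∈ (L j).carrier)
    (hae : ∀ j ∈ J, ∀ᵐ s : ℝ, IsTransverse V (D s) (L j))
    (hw : ∀ j ∈ J, ∀ s, IsTransverse V (D s) (L j) →
      (intersectionPoints V (D s) (L j)).Finite ∧ algebraicIntersection V (D s) (L j) = w j) :
    HasWindingNumber V D (OrientedLink.union (J : Set ℕ) L) (∑ j ∈ J, w j) := by
  have hposJ : ∀ j ∈ J, ∀ p ∈ (L j).carrier,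
      (OrientedLink.union (J : Set ℕ) L).positive p = (L j).positive p := by
    intro j hj p hp
    ext τ
    simp only [OrientedLink.union, Set.mem_iUnion, exists_prop]
    constructor
    · rintro ⟨k, hk, hτ⟩
      rcases eq_or_ne j k with rfl | hjk
      · exact hτ
      · exact absurd (hsub k p τ hτ) (Set.disjoint_left.1 (hdisj hj hk hjk) hp)
    · exact fun h => ⟨j, hj, h⟩
  have hcar : ∀ p, p ∈ (OrientedLink.union (J : Set ℕ) L).carrier ↔
      ∃ j ∈ J, p ∈ (L j).carrier := fun p => by simp [OrientedLink.union]
  have htr : ∀ s, IsTransverse V (D s) (OrientedLink.union (J : Set ℕ) L) ↔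
      ∀ j ∈ J, IsTransverse V (D s) (L j) := by
    intro s
    constructor
    · intro h j hj z hz
      have := h z ⟨hz.1, (hcar _).2 ⟨j, hj, hz.2⟩⟩
      rwa [hposJ j hj _ hz.2] at this
    · rintro h z ⟨hz, hz'⟩
      obtain ⟨j, hj, hzj⟩ := (hcar _).1 hz'
      rw [hposJ j hj _ hzj]
      exact h j hj z ⟨hz, hzj⟩
  refine ⟨?_, fun s hs => ?_⟩
  -- Finitely many sets of full measure have a common point. This is why transversality is proved
  -- for almost every disk and not just for one.
  · obtain ⟨s, hs⟩ := ((J.eventually_all).2 hae).exists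
    exact ⟨s, (htr s).2 hs⟩
  rw [htr] at hs
  have hI : intersectionPoints V (D s) (OrientedLink.union (J : Set ℕ) L) =
      ⋃ j ∈ J, intersectionPoints V (D s) (L j) := by
    ext z
    simp only [intersectionPoints, Set.mem_ofPred_eq, hcar, Set.mem_iUnion, exists_prop]
    tauto
  have hcount : ∀ P : ℝ → Prop,
      ({z ∈ intersectionPoints V (D s) (OrientedLink.union (J : Set ℕ) L) |
        ∃ τ ∈ (OrientedLink.union (J : Set ℕ) L).positive (D s z),
          P (frameDet (D s) z τ)}.ncard : ℤ) =
      ∑ j ∈ J, ({z ∈ intersectionPoints V (D s) (L j) |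
        ∃ τ ∈ (L j).positive (D s z), P (frameDet (D s) z τ)}.ncard : ℤ) := by
    intro P
    have h1 : {z ∈ intersectionPoints V (D s) (OrientedLink.union (J : Set ℕ) L) |
        ∃ τ ∈ (OrientedLink.union (J : Set ℕ) L).positive (D s z),
          P (frameDet (D s) z τ)} =
        ⋃ j ∈ (J : Set ℕ), {z ∈ intersectionPoints V (D s) (L j) |
          ∃ τ ∈ (L j).positive (D s z), P (frameDet (D s) z τ)} := by
      ext z
      simp only [Set.mem_iUnion, exists_prop, Set.mem_ofPred_eq, hI, Finset.mem_coe]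
      constructor
      · rintro ⟨⟨j, hj, hz⟩, h⟩
        rw [hposJ j hj _ hz.2] at h
        exact ⟨j, hj, hz, h⟩
      · rintro ⟨j, hj, hz, h⟩
        rw [hposJ j hj _ hz.2]
        exact ⟨⟨j, hj, hz⟩, h⟩
    rw [h1, J.finite_toSet.ncard_biUnion
      (fun j hj => ((hw j hj s (hs j hj)).1).subset fun z hz => hz.1)
      (fun j hj k hk hjk => Set.disjoint_left.2 fun z hz hz' =>
        Set.disjoint_left.1 (hdisj hj hk hjk) hz.1.2 hz'.1.2),
      finsum_mem_coe_finset]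
    push_cast
    rfl
  constructor
  · rw [hI]
    exact J.finite_toSet.biUnion fun j hj => (hw j hj s (hs j hj)).1
  · rw [algebraicIntersection, hcount (fun x => 0 < x), hcount (fun x => x < 0),
      ← Finset.sum_sub_distrib]
    exact Finset.sum_congr rfl fun j hj => (hw j hj s (hs j hj)).2

theorem union_singleton (L : ℕ → OrientedLink) (i : ℕ) :
    OrientedLink.union {i} L = L i := by
  simp [OrientedLink.union]

/-! ### The shells and the solid tori -/

theorem IsShellRadii.strictMonoOn {N : ℕ} (hε : IsShellRadii N ε) {j k : ℕ} (hjk : j < k)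
    (hk : k ≤ N) : ε j < ε k := by
  induction k, hjk using Nat.le_induction with
  | base => exact hε.2.2 j hk
  | succ k hjk ih => exact (ih (by omega)).trans (hε.2.2 k hk)

theorem IsShellRadii.le {N : ℕ} (hε : IsShellRadii N ε) {j k : ℕ} (hjk : j ≤ k)
    (hk : k ≤ N) : ε j ≤ ε k := by
  rcases hjk.eq_or_lt with rfl | h
  · exact le_rfl
  · exact (hε.strictMonoOn h hk).le

theorem IsShellRadii.isShell {N : ℕ} (hε : IsShellRadii N ε) {j : ℕ} (hj : 1 ≤ j) (hjN : j ≤ N) :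
    IsShell ε j :=
  ⟨hε.1 ▸ hε.le (Nat.zero_le _) (by omega), hε.strictMonoOn (by omega) hjN,
    hε.2.1 ▸ hε.le hjN le_rfl⟩

theorem shell_subset_solidTorusV {a b r : ℝ} (ha : 0 ≤ a) (hb : b ≤ 1) (hr : b ≤ r) :
    shell a b ⊆ solidTorusV r :=
  fun _ hp => ⟨hp.1, hp.2.2.le.trans hr, snd_ne_zero_of_mem_shell ha hb hp⟩

theorem shell_subset_solidTorusW {a b r : ℝ} (ha : 0 ≤ a) (hr : r ≤ a) :
    shell a b ⊆ solidTorusW r :=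
  fun _ hp => ⟨hp.1, hr.trans hp.2.1.le, fst_ne_zero_of_mem_shell ha hp⟩

theorem pairwiseDisjoint_carrier_edgeLink (hε : IsShellRadii (numEdges f) ε) {J : Set ℕ}
    (hJ : ∀ j ∈ J, 1 ≤ j ∧ j ≤ numEdges f) :
    J.PairwiseDisjoint fun j => (edgeLink f ε j).carrier := by
  have key : ∀ j ∈ J, ∀ k ∈ J, j < k →
      Disjoint (edgeLink f ε j).carrier (edgeLink f ε k).carrier := by
    intro j hj k hk hjk
    refine Set.disjoint_left.2 fun p hp hp' => ?_
    rw [mem_carrier_edgeLink (hε.isShell (hJ j hj).1 (hJ j hj).2)] at hp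
    rw [mem_carrier_edgeLink (hε.isShell (hJ k hk).1 (hJ k hk).2)] at hp'
    have h1 : ε j ≤ ε (k - 1) := hε.le (by omega) (by have := (hJ k hk).2; omega)
    exact lt_irrefl _ ((hp.1.2.2.trans_le h1).trans hp'.1.2.1)
  intro j hj k hk hjk
  rcases lt_or_gt_of_ne hjk with h | h
  · exact key j hj k hk h
  · exact (key k hk j hj h).symm

/-! ### The winding numbers -/

theorem sum_Icc_sub_pred (w : ℕ → ℤ) {a b : ℕ} (hab : a ≤ b) :
    ∑ j ∈ Finset.Icc a b, (w j - w (j - 1)) = w b - w (a - 1) := by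
  induction b, hab using Nat.le_induction with
  | base => simp
  | succ b hb ih =>
    rw [Finset.sum_Icc_succ_top (by omega), ih, Nat.add_sub_cancel]
    ring

theorem hasWindingNumberV_union (hconv : IsConvenient f) (hnd : IsNonDegenerate f)
    (hnice : IsGammaNice f) (hε : IsShellRadii (numEdges f) ε) {a b : ℕ} (ha : 1 ≤ a)
    (hab : a ≤ b) (hb : b ≤ numEdges f) (t : ℝ) :
    HasWindingNumberV (ε b) (OrientedLink.union (Set.Icc a b) (edgeLink f ε))
      (signedMultiplicity (vertexPolyU f b t) 0 -
        signedMultiplicity (vertexPolyU f (a - 1) t) 0) := by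
  have hJ : ∀ j ∈ Finset.Icc a b, 1 ≤ j ∧ j ≤ numEdges f := fun j hj => by
    rw [Finset.mem_Icc] at hj
    omega
  -- The multiplicity is taken at `t` but the disk at `s`; the degree depends on neither.
  have hdeg : ∀ j ≤ numEdges f, ∀ s, HasLoopDegree
      (fun x : ℝ => vertexPolyU f j s (Complex.exp (x * Complex.I)))
      (signedMultiplicity (vertexPolyU f j t) 0) := by
    intro j hj s
    obtain ⟨n, hn⟩ := exists_signedMultiplicity_vertexPolyU hconv hnd hnice hj
    rw [(hn t).1.signedMultiplicity_eq]
    exact (hn s).2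
  rw [← sum_Icc_sub_pred (fun j => signedMultiplicity (vertexPolyU f j t) 0) hab,
    ← Finset.coe_Icc]
  refine hasWindingNumber_union (pairwiseDisjoint_carrier_edgeLink hε hJ)
    (fun j p τ => mem_carrier_of_mem_positive) (fun j hj => ?_) (fun j hj s => ?_)
  · exact ae_isTransverse_diskU hconv hnd (hJ j hj).1 (hJ j hj).2
      (hε.isShell (hJ j hj).1 (hJ j hj).2) _
  · have hs := hε.isShell (hJ j hj).1 (hJ j hj).2
    exact exists_algebraicIntersection_diskU hconv hnd hnice (hJ j hj).1 (hJ j hj).2 hs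
      (shell_subset_solidTorusV hs.1 hs.2.2 (hε.le (Finset.mem_Icc.1 hj).2 hb))
      (hdeg _ ((Nat.sub_le _ _).trans (hJ j hj).2) s) (hdeg _ (hJ j hj).2 s)

theorem hasWindingNumberW_union (hconv : IsConvenient f) (hnd : IsNonDegenerate f)
    (hnice : IsGammaNice f) (hε : IsShellRadii (numEdges f) ε) {a b : ℕ} (ha : 1 ≤ a)
    (hab : a ≤ b) (hb : b ≤ numEdges f) (φ : ℝ) :
    HasWindingNumberW (ε (a - 1)) (OrientedLink.union (Set.Icc a b) (edgeLink f ε))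
      (signedMultiplicity (vertexPolyV f (a - 1) φ) 0 -
        signedMultiplicity (vertexPolyV f b φ) 0) := by
  have hJ : ∀ j ∈ Finset.Icc a b, 1 ≤ j ∧ j ≤ numEdges f := fun j hj => by
    rw [Finset.mem_Icc] at hj
    omega
  have hdeg : ∀ j ≤ numEdges f, ∀ s, HasLoopDegree
      (fun x : ℝ => vertexPolyV f j s (Complex.exp (x * Complex.I)))
      (signedMultiplicity (vertexPolyV f j φ) 0) := by
    intro j hj s
    obtain ⟨n, hn⟩ := exists_signedMultiplicity_vertexPolyV hconv hnd hnice hj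
    rw [(hn φ).1.signedMultiplicity_eq]
    exact (hn s).2
  have hsum : ∑ j ∈ Finset.Icc a b, (signedMultiplicity (vertexPolyV f (j - 1) φ) 0 -
      signedMultiplicity (vertexPolyV f j φ) 0) =
      signedMultiplicity (vertexPolyV f (a - 1) φ) 0 -
        signedMultiplicity (vertexPolyV f b φ) 0 := by
    rw [← neg_sub (signedMultiplicity (vertexPolyV f b φ) 0),
      ← sum_Icc_sub_pred (fun j => signedMultiplicity (vertexPolyV f j φ) 0) hab,
      ← Finset.sum_neg_distrib]
    exact Finset.sum_congr rfl fun j _ => (neg_sub _ _).symm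
  rw [← hsum, ← Finset.coe_Icc]
  refine hasWindingNumber_union (pairwiseDisjoint_carrier_edgeLink hε hJ)
    (fun j p τ => mem_carrier_of_mem_positive) (fun j hj => ?_) (fun j hj s => ?_)
  · exact ae_isTransverse_diskV hconv hnd (hJ j hj).1 (hJ j hj).2
      (hε.isShell (hJ j hj).1 (hJ j hj).2) _
  · have hs := hε.isShell (hJ j hj).1 (hJ j hj).2
    refine exists_algebraicIntersection_diskV hconv hnd hnice (hJ j hj).1 (hJ j hj).2 hs
      (shell_subset_solidTorusW hs.1 (hε.le ?_ ?_))
      (hdeg _ ((Nat.sub_le _ _).trans (hJ j hj).2) s) (hdeg _ (hJ j hj).2 s)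
    · have := Finset.mem_Icc.1 hj
      omega
    · have := hJ j hj
      omega

end MixedLink
end

/-- All four winding numbers are instances of the telescoped formula for a block of consecutive
edges: the block `[i, i]` for single links, and `[1, i]` and `[i, N]` for the unions, where the
multiplicity at the extreme vertex is `0`. -/
theorem mainTheorem6 (f : MixedLink.MixedPolynomial) (hf : MvPolynomial.coeff 0 f = 0)
    (hconv : MixedLink.IsConvenient f) (hnd : MixedLink.IsNonDegenerate f)
    (hnice : MixedLink.IsGammaNice f)
    (ε : ℕ → ℝ) (hε : MixedLink.IsShellRadii (MixedLink.numEdges f) ε) :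
    (∀ i ≤ MixedLink.numEdges f, ∀ t φ : ℝ,
      MixedLink.HasSignedMultiplicity (MixedLink.vertexPolyU f i t) 0
        (MixedLink.signedMultiplicity (MixedLink.vertexPolyU f i t) 0) ∧
      MixedLink.HasSignedMultiplicity (MixedLink.vertexPolyV f i φ) 0
        (MixedLink.signedMultiplicity (MixedLink.vertexPolyV f i φ) 0)) ∧
    ∀ i, 1 ≤ i → i ≤ MixedLink.numEdges f → ∀ t φ : ℝ,
      MixedLink.HasWindingNumberV (ε i) (MixedLink.edgeLink f ε i)
        (MixedLink.signedMultiplicity (MixedLink.vertexPolyU f i t) 0 -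
          MixedLink.signedMultiplicity (MixedLink.vertexPolyU f (i - 1) t) 0) ∧
      MixedLink.HasWindingNumberW (ε (i - 1)) (MixedLink.edgeLink f ε i)
        (MixedLink.signedMultiplicity (MixedLink.vertexPolyV f (i - 1) φ) 0 -
          MixedLink.signedMultiplicity (MixedLink.vertexPolyV f i φ) 0) ∧
      MixedLink.HasWindingNumberV (ε i)
        (MixedLink.OrientedLink.union (Set.Icc 1 i) (MixedLink.edgeLink f ε))
        (MixedLink.signedMultiplicity (MixedLink.vertexPolyU f i t) 0) ∧
      MixedLink.HasWindingNumberW (ε (i - 1))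
        (MixedLink.OrientedLink.union (Set.Icc i (MixedLink.numEdges f))
          (MixedLink.edgeLink f ε))
        (MixedLink.signedMultiplicity (MixedLink.vertexPolyV f (i - 1) φ) 0) := by
  refine ⟨fun i hi t φ => ⟨?_, ?_⟩, fun i hi hiN t φ => ⟨?_, ?_, ?_, ?_⟩⟩
  · obtain ⟨n, hn⟩ := MixedLink.exists_signedMultiplicity_vertexPolyU hconv hnd hnice hi
    rw [(hn t).1.signedMultiplicity_eq]
    exact (hn t).1
  · obtain ⟨n, hn⟩ := MixedLink.exists_signedMultiplicity_vertexPolyV hconv hnd hnice hi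
    rw [(hn φ).1.signedMultiplicity_eq]
    exact (hn φ).1
  · have h := MixedLink.hasWindingNumberV_union hconv hnd hnice hε hi le_rfl hiN t
    rwa [Set.Icc_self, MixedLink.union_singleton] at h
  · have h := MixedLink.hasWindingNumberW_union hconv hnd hnice hε hi le_rfl hiN φ
    rwa [Set.Icc_self, MixedLink.union_singleton] at h
  · have h := MixedLink.hasWindingNumberV_union hconv hnd hnice hε le_rfl hi hiN t
    rwa [Nat.sub_self, MixedLink.signedMultiplicity_vertexPolyU_zero hconv hnd hnice,
      sub_zero] at h
  · have h := MixedLink.hasWindingNumberW_union hconv hnd hnice hε hi hiN le_rfl φ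
    rwa [MixedLink.signedMultiplicity_vertexPolyV_numEdges hconv hnd hnice, sub_zero] at h
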